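/- **Conventions.** Fix integers $n\ge 1$, $l\ge 0$ and a tuple $\mathbf a=(a_1,\dots,a_l)$ of positive integers with $|\mathbf a|:=a_1+\dots+a_l\le n$. Put $\nu=n-|\mathbf a|$, $\mathbf a^{\mathbf a}=\prod_k a_k^{a_k}$, and let $\delta=1$ if $\nu=0$ and $\delta=0$ if $\nu>0$. Write $D=q\frac{d}{dq}$ and $f'=Df$ for $f\in\mathbb Q[[q]]$, $[n]=\{0,1,\dots,n-1\}$, let $[\![f]\!]_{q;d}$ be the coefficient of $q^d$ in $f$, and for a finite tuple $\mathbf x$ let $|\mathbf x|$ be the sum of its entries. An empty product is $1$. **Power series.** * $L\in 1+q\mathbb Q[[q]]$ is defined by $L^n-\mathbf a^{\mathbf a}qL^{|\mathbf a|}=1$. * $\chi_i\in\mathbb Q$ are defined by $\prod_{k}\prod_{r=1}^{a_k}(a_kD+r)=\mathbf a^{\mathbf a}\sum_{i=0}^{|\mathbf a|}\chi_{|\mathbf a|-i}D^i$, and $\chi_i=0$ if $i<0$ or $i>|\mathbf a|$. $\mathcal H_{m,j}\in\mathbb Q(u)$ are defined by $\mathcal H_{0,0}=1$, $\mathcal H_{m,j}=0$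 unless $0\le j\le m$, and, for $m\ge1$ and $0\le j\le m$, $\mathcal H_{m,j}=\mathcal H_{m-1,j}+\frac{u-1}{|\mathbf a|+\nu u}\big(nu\frac{d}{du}+m-j\big)\mathcal H_{m-1,j-1}$. For $1\le k\le n$, $$\mathfrak L_k=\sum_{i=0}^k\Big[\tbinom ni L^n\mathcal H_{n-i,k-i}(L^n)-(L^n-1)\sum_{r=0}^{k-i}\tbinom{|\mathbf a|-r}{i}\chi_r\mathcal H_{|\mathbf a|-i-r,k-i-r}(L^n)\Big]D^i .$$ * $\Phi_0\in1+q\mathbb Q[[q]]$ and $\Phi_1,\Phi_2,\ldots\in q\mathbb Q[[q]]$ are the unique power series with $\sum_{k=1}^{n}L^{-(k-1)}\mathfrak L_k\Phi_{b+1-k}=0$ for all $b\ge0$, where $\Phi_b=0$ for $b<0$. * Let $F(w,q)=\sum_{d\ge0}q^dw^{\nu d}\frac{\prod_k\prod_{r=1}^{a_kd}(a_kw+r)}{\prod_{r=1}^d((w+r)^n-w^n)}$ and $\mathbf MH(w,q)=\big(1+\frac qw\frac{d}{dq}\big)\frac{H(w,q)}{H(0,q)}$. For $c\ge0$ put $I_c(q)=(\mathbf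 M^cF)(0,q)$ if $\nu=0$ and $I_c=1$ if $\nu>0$. * If $\nu>0$, let $c_{p,s}^{(d)}$ be the coefficient of $w^s$ in the power series expansion at $w=0$ of $\frac{(w+d)^p\prod_k\prod_{r=1}^{a_kd}(a_kw+r)}{\prod_{r=1}^d(w+r)^n}$, and define $\tilde c_{l+p,l+s}^{(d)}$ for $p,s\ge0$ recursively by $\tilde c_{l+p,l+s}^{(d)}=0$ if $s+\nu d>p$ and $\sum_{d_1+d_2=d}\sum_{r=0}^{p-\nu d_1}\tilde c_{l+p,l+r}^{(d_1)}c_{r,s}^{(d_2)}=\delta_{0,d}\delta_{p,s}$ if $s+\nu d\le p$ (with $d_1,d_2\ge0$). Put $\tilde c_{p,s}^{(d)}=\delta_{0,d}\delta_{p,s}$ unless $p,s\ge l$. * For $p,b\in\mathbb Z$ let $\hat\Phi_{0;b}=\Phi_b$, $\hat\Phi_{p;b}=0$ if $b<0$, and $\hat\Phi_{p+1;b}=L\hat\Phi_{p;b}+\hat\Phi_{p;b-1}'-\big(\sum_{r=0}^{p}\frac{I_r'}{I_r}\big)\hat\Phi_{p;b-1}$ (the sum is empty if $p<0$). For $p\ge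 0$ let $\Phi_{p;b}=\hat\Phi_{p-l;b}$ if $\nu=0$, and $\Phi_{p;b}=\sum_{d\ge0}\sum_{s=0}^{p-\nu d}\tilde c_{p,s}^{(d)}q^d\hat\Phi_{s-l;\,b-(p-\nu d-s)}$ if $\nu>0$. * For $m\ge0$ and a finitely supported sequence $\mathbf c=(c_1,c_2,\dots)$ of non-negative integers, put $|\mathbf c|=\sum_rc_r$, $\|\mathbf c\|=\sum_r r\,c_r$, and $$\Phi_{m,\mathbf c}=\frac{\Phi_0^2}{I_0^2}(-1)^{m+|\mathbf c|}(m+|\mathbf c|)!\prod_{r\ge1}\frac1{c_r!}\Big(\frac{\Phi_r}{(r+1)!\,\Phi_0}\Big)^{c_r}.$$ **Structure constants.** For $d,t\ge0$, $p,p'\in[n]$ and $b,b'\in\mathbb Z$ put $c_{(p,p'),(b,b')}^{(d,t)}=(-1)^b\,[\![L^{\delta(1+t)n}/I_0^2]\!]_{q;d}$ if $b\ge0$, $b+b'=-1$ and $p+p'+nt=n-1+l$, and $c_{(p,p'),(b,b')}^{(d,t)}=0$ otherwise. For $N\ge3$, $\mathbf p\in[n]^N$, $\mathbf b\in(\mathbb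 Z_{\ge0})^N$ and $d,t\ge0$ define inductively $$c_{\mathbf p,\mathbf b}^{(d,t)}=\sum\Big(\prod_{i=1}^m c_{\mathbf p|_{S_i}p_i',\,\mathbf b|_{S_i}b_i'}^{(d_i,t_i)}\Big)\Big[\!\!\Big[\Phi_{m-3,\mathbf c}\prod_{i=1}^m\frac{I_0^2\,\Phi_{p_i';\,b_i'+1+b_i''}}{b_i''!\,L^{\delta n}\,\Phi_0}\Big]\!\!\Big]_{q;d'} .$$ The sum is over the integers $m\ge3$, $d'\ge0$ and $t'$; the unordered partitions $\{S_1,\dots,S_m\}$ of $\{1,\dots,N\}$ into $m$ nonempty subsets one of which is $\{N\}$ (ordered arbitrarily, one ordering for each partition); the tuples of non-negative integers $(d_i)$ and $(t_i)$ with $\sum_i d_i=d-d'$ and $\sum_it_i=t-t'$; the tuples $\mathbf p'\in[n]^m$ and $\mathbf b'\in\mathbb Z^m$ with $|\mathbf p'|-|\mathbf b'|=n-2+(m-1)(l+2)+\nu d'+nt'$; and the tuples $\mathbf b''\in(\mathbb Z_{\ge0})^m$ and sequences $\mathbf c$ with $|\mathbf b''|+\|\mathbf c\|=m-3$. Here $\mathbf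 p|_{S_i}p'_i$ is the tuple $(p_s)_{s\in S_i}$ followed by $p'_i$ (and similarly for $\mathbf b|_{S_i}b_i'$), and the factor $c_{\mathbf p|_{S_i}p_i',\mathbf b|_{S_i}b_i'}^{(d_i,t_i)}$ is taken to be $0$ if $b_i'<0$ and $|S_i|\ge2$. Only finitely many summands are nonzero. **Proposition.** For all $n$, $l$ and $\mathbf a$ as above there is a constant $C_{\mathbf a}>0$, depending only on $n$ and $\mathbf a$, such that $$\big|c_{\mathbf p,\mathbf b}^{(d,0)}\big|\le\frac{N!}{\mathbf b!}\,C_{\mathbf a}^{\,N+d},\qquad \mathbf b!=b_1!\,b_2!\cdots b_N!,$$ for all integers $N\ge3$ and $d\ge0$, all $\mathbf p\in[n]^N$ and all $\mathbf b\in(\mathbb Z_{\ge0})^N$. -/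

import Mathlib

/-!
Structure constants of the multi-pointed genus zero mirror formula for a complete intersection of
multi-degree `a = (a_1, …, a_l)` in the projective space of dimension `n - 1`, where `|a| ≤ n`.
-/

noncomputable section

namespace GWStructure

/-- The operator `q d/dq` on formal power series in `q`. -/
def qD {R : Type*} [CommRing R] (f : PowerSeries R) : PowerSeries R :=
  PowerSeries.mk fun d => (d : R) * PowerSeries.coeff d f

/-- `|a| = a_1 + … + a_l`. -/
def absDeg {l : ℕ} (a : Fin l → ℕ) : ℕ := ∑ k, a k

/-- `a^a = a_1^{a_1} ⋯ a_l^{a_l}`. -/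
def selfPow {l : ℕ} (a : Fin l → ℕ) : ℕ := ∏ k, a k ^ a k

/-- `ν_a = n - |a|`; it is used only when `|a| ≤ n`. -/
def nu (n : ℕ) {l : ℕ} (a : Fin l → ℕ) : ℕ := n - absDeg a

/-- The Kronecker symbol `δ_{0, ν_a}`. -/
def deltaNu (n : ℕ) {l : ℕ} (a : Fin l → ℕ) : ℕ := if nu n a = 0 then 1 else 0

/-! ### The power series `L` -/

/-- The conditions `L ∈ 1 + q ℚ[[q]]` and `L^n - a^a q L^{|a|} = 1`. -/
def IsL (n : ℕ) {l : ℕ} (a : Fin l → ℕ) (f : PowerSeries ℚ) : Prop :=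
  PowerSeries.constantCoeff f = 1 ∧
    f ^ n - PowerSeries.C (selfPow a : ℚ) * PowerSeries.X * f ^ absDeg a = 1

/-- The power series `L(q)`; it is characterized by `IsL`, see `isL_seriesL` and `IsL.unique`. -/
def seriesL (n : ℕ) {l : ℕ} (a : Fin l → ℕ) : PowerSeries ℚ :=
  Classical.epsilon (IsL n a)

/-! ### The differential operators and the power series `Φ_b` -/

/-- The numbers `χ_i`: the polynomial `∏_k ∏_{r=1}^{a_k} (a_k D + r)` is
`a^a ∑_i χ_{|a|-i} D^i`, and `χ_i = 0` for `i > |a|`. -/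
def chi {l : ℕ} (a : Fin l → ℕ) (i : ℕ) : ℚ :=
  if i ≤ absDeg a then
    (∏ k, ∏ r ∈ Finset.Icc 1 (a k),
      (Polynomial.C (a k : ℚ) * Polynomial.X + Polynomial.C (r : ℚ))).coeff (absDeg a - i)
      / (selfPow a : ℚ)
  else 0

/-- The derivative of a rational function, by the quotient rule. -/
def ratDeriv (f : RatFunc ℚ) : RatFunc ℚ :=
  algebraMap (Polynomial ℚ) (RatFunc ℚ)
      (Polynomial.derivative f.num * f.denom - f.num * Polynomial.derivative f.denom) /
    algebraMap (Polynomial ℚ) (RatFunc ℚ) (f.denom ^ 2)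

/-- The rational functions `H_{m,j}(u)`: `H_{0,0} = 1`, `H_{m,j} = 0` unless `0 ≤ j ≤ m`, and
`H_{m,j} = H_{m-1,j} + (u-1)/(|a| + ν_a u) (n u d/du + m - j) H_{m-1,j-1}` for `m ≥ 1`. -/
def calH (n : ℕ) {l : ℕ} (a : Fin l → ℕ) : ℕ → ℕ → RatFunc ℚ
  | 0, 0 => 1
  | 0, _ + 1 => 0
  | m + 1, 0 => calH n a m 0
  | m + 1, j + 1 =>
    if j ≤ m then
      calH n a m (j + 1) +
        (RatFunc.X - 1) / (RatFunc.C (absDeg a : ℚ) + RatFunc.C (nu n a : ℚ) * RatFunc.X) *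
          (RatFunc.C (n : ℚ) * RatFunc.X * ratDeriv (calH n a m j) +
            RatFunc.C ((m : ℚ) - (j : ℚ)) * calH n a m j)
    else 0

/-- The value `f(u)` of a rational function at a power series (used for rational functions whose
denominator does not vanish at the constant term of `u`). -/
def evalAt (f : RatFunc ℚ) (u : PowerSeries ℚ) : PowerSeries ℚ :=
  Polynomial.aeval u f.num * (Polynomial.aeval u f.denom)⁻¹

/-- The differential operator
`𝔏_k = ∑_{i ≤ k} [ (n choose i) L^n H_{n-i,k-i}(L^n)
  - (L^n - 1) ∑_{r ≤ k-i} (|a|-r choose i) χ_r H_{|a|-i-r,k-i-r}(L^n) ] (q d/dq)^i`, `k ≤ n`.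
The terms in which a truncated subtraction of natural numbers occurs have `χ_r = 0` or a
vanishing binomial coefficient. -/
def opL (n : ℕ) {l : ℕ} (a : Fin l → ℕ) (k : ℕ) (f : PowerSeries ℚ) : PowerSeries ℚ :=
  ∑ i ∈ Finset.range (k + 1),
    (PowerSeries.C (n.choose i : ℚ) * seriesL n a ^ n *
        evalAt (calH n a (n - i) (k - i)) (seriesL n a ^ n) -
      (seriesL n a ^ n - 1) *
        ∑ r ∈ Finset.range (k - i + 1),
          PowerSeries.C (((absDeg a - r).choose i : ℚ) * chi a r) *
            evalAt (calH n a (absDeg a - i - r) (k - i - r)) (seriesL n a ^ n)) *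
      qD^[i] f

/-- The conditions `Φ_0 ∈ 1 + q ℚ[[q]]`, `Φ_b ∈ q ℚ[[q]]` for `b ≥ 1`, and
`𝔏_1 Φ_b + L^{-1} 𝔏_2 Φ_{b-1} + … + L^{-(n-1)} 𝔏_n Φ_{b+1-n} = 0` for all `b ≥ 0`,
with `Φ_b = 0` for `b < 0`. -/
def IsPhi (n : ℕ) {l : ℕ} (a : Fin l → ℕ) (Φ : ℕ → PowerSeries ℚ) : Prop :=
  PowerSeries.constantCoeff (Φ 0) = 1 ∧
    (∀ b, 1 ≤ b → PowerSeries.constantCoeff (Φ b) = 0) ∧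
    ∀ b, ∑ k ∈ Finset.Icc 1 n,
      (if k ≤ b + 1 then (seriesL n a)⁻¹ ^ (k - 1) * opL n a k (Φ (b + 1 - k)) else 0) = 0

/-- The power series `Φ_b`; they are characterized by `IsPhi`, see `isPhi_phi` and
`IsPhi.unique`. -/
def phi (n : ℕ) {l : ℕ} (a : Fin l → ℕ) : ℕ → PowerSeries ℚ :=
  Classical.epsilon (IsPhi n a)

/-! ### The hypergeometric series and the power series `I_c` -/

/-- The hypergeometric series
`F(w,q) = ∑_d q^d w^{ν_a d} ∏_k ∏_{r=1}^{a_k d} (a_k w + r) / ∏_{r=1}^d ((w+r)^n - w^n)`,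
a power series in `q` with coefficients in `ℚ(w)`. -/
def hyperF (n : ℕ) {l : ℕ} (a : Fin l → ℕ) : PowerSeries (RatFunc ℚ) :=
  PowerSeries.mk fun d =>
    RatFunc.X ^ (nu n a * d) *
        (∏ k, ∏ r ∈ Finset.Icc 1 (a k * d),
          (RatFunc.C (a k : ℚ) * RatFunc.X + RatFunc.C (r : ℚ))) /
      ∏ r ∈ Finset.Icc 1 d, ((RatFunc.X + RatFunc.C (r : ℚ)) ^ n - RatFunc.X ^ n)

/-- The restriction `H(0,q)` of `H(w,q)` to `w = 0`. -/
def atZero (H : PowerSeries (RatFunc ℚ)) : PowerSeries ℚ :=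
  PowerSeries.mk fun d => RatFunc.eval (RingHom.id ℚ) 0 (PowerSeries.coeff d H)

/-- The quotient `H(w,q) / H(0,q)`. -/
def normalize (H : PowerSeries (RatFunc ℚ)) : PowerSeries (RatFunc ℚ) :=
  H * (PowerSeries.map (RatFunc.C : ℚ →+* RatFunc ℚ) (atZero H))⁻¹

/-- The operator `M H = (1 + w^{-1} q d/dq) (H(w,q) / H(0,q))`. -/
def opM (H : PowerSeries (RatFunc ℚ)) : PowerSeries (RatFunc ℚ) :=
  normalize H + PowerSeries.C (RatFunc.X⁻¹ : RatFunc ℚ) * qD (normalize H)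

/-- The power series `I_c`: it is `1` if `|a| < n`, and `(M^c F)(0,q)` if `|a| = n`. -/
def seriesI (n : ℕ) {l : ℕ} (a : Fin l → ℕ) (c : ℕ) : PowerSeries ℚ :=
  if absDeg a = n then atZero (opM^[c] (hyperF n a)) else 1

/-! ### The numbers `c̃` (for `ν_a > 0`) -/

/-- The number `c_{p,s}^{(d)}`: the coefficient of `w^s` in the expansion at `w = 0` of
`(w+d)^p ∏_k ∏_{r=1}^{a_k d} (a_k w + r) / ∏_{r=1}^d (w+r)^n`. -/
def cCoeff (n : ℕ) {l : ℕ} (a : Fin l → ℕ) (p s d : ℕ) : ℚ :=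
  PowerSeries.coeff s
    ((PowerSeries.X + PowerSeries.C (d : ℚ)) ^ p *
      (∏ k, ∏ r ∈ Finset.Icc 1 (a k * d),
        (PowerSeries.C (a k : ℚ) * PowerSeries.X + PowerSeries.C (r : ℚ))) *
      (∏ r ∈ Finset.Icc 1 d, (PowerSeries.X + PowerSeries.C (r : ℚ)) ^ n)⁻¹ : PowerSeries ℚ)

/-- The number `c̃_{l+p,l+s}^{(d)}`.  It is zero if `s + ν_a d > p`, and for `s + ν_a d ≤ p` it is
determined by `∑_{d₁+d₂=d} ∑_{r=0}^{p-ν_a d₁} c̃_{l+p,l+r}^{(d₁)} c_{r,s}^{(d₂)} = δ_{0,d} δ_{p,s}`,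
where the terms with `d₁ = d` add up to `c̃_{l+p,l+s}^{(d)}` since `c_{r,s}^{(0)} = δ_{r,s}`. -/
def cTildeShift (n : ℕ) {l : ℕ} (a : Fin l → ℕ) (p : ℕ) : ℕ → ℕ → ℚ
  | d, s =>
    if s + nu n a * d ≤ p then
      (if d = 0 ∧ p = s then 1 else 0) -
        ∑ d₁ : Fin d, ∑ r ∈ Finset.range (p - nu n a * d₁ + 1),
          cTildeShift n a p d₁ r * cCoeff n a r s (d - d₁)
    else 0
  termination_by d => d
  decreasing_by exact d₁.isLt

/-- The number `c̃_{p,s}^{(d)}`, which is `δ_{0,d} δ_{p,s}` unless `p, s ≥ l`. -/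
def cTilde (n : ℕ) {l : ℕ} (a : Fin l → ℕ) (p s d : ℕ) : ℚ :=
  if l ≤ p ∧ l ≤ s then cTildeShift n a (p - l) d (s - l)
  else if d = 0 ∧ p = s then 1 else 0

/-! ### The power series `Φ̂_{p;b}`, `Φ_{p;b}` and `Φ_{m,c}` -/

/-- `Φ̂_{p;b}` for `p, b ≥ 0`: `Φ̂_{0;b} = Φ_b` and
`Φ̂_{p+1;b} = L Φ̂_{p;b} + q d/dq Φ̂_{p;b-1} - (∑_{r=0}^p (q d/dq I_r) / I_r) Φ̂_{p;b-1}`,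
with `Φ̂_{p;-1} = 0`. -/
def phiHatUp (n : ℕ) {l : ℕ} (a : Fin l → ℕ) : ℕ → ℕ → PowerSeries ℚ
  | 0, b => phi n a b
  | p + 1, 0 => seriesL n a * phiHatUp n a p 0
  | p + 1, b + 1 =>
    seriesL n a * phiHatUp n a p (b + 1) + qD (phiHatUp n a p b) -
      (∑ r ∈ Finset.range (p + 1), qD (seriesI n a r) * (seriesI n a r)⁻¹) * phiHatUp n a p b

/-- `Φ̂_{-k;b}` for `k, b ≥ 0`: the same recursion with `p = -(k+1) < 0`, where the sum over `r` is
empty, solved for `Φ̂_{p;b}`. -/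
def phiHatDown (n : ℕ) {l : ℕ} (a : Fin l → ℕ) : ℕ → ℕ → PowerSeries ℚ
  | 0, b => phi n a b
  | k + 1, 0 => (seriesL n a)⁻¹ * phiHatDown n a k 0
  | k + 1, b + 1 =>
    (seriesL n a)⁻¹ * (phiHatDown n a k (b + 1) - qD (phiHatDown n a (k + 1) b))

/-- `Φ̂_{p;b}` for integers `p` and `b`; it is zero if `b < 0`. -/
def phiHat (n : ℕ) {l : ℕ} (a : Fin l → ℕ) (p b : ℤ) : PowerSeries ℚ :=
  if b < 0 then 0
  else if 0 ≤ p then phiHatUp n a p.toNat b.toNat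
  else phiHatDown n a (-p).toNat b.toNat

/-- `Φ_{p;b}`: it is `Φ̂_{p-l;b}` if `ν_a = 0`, and
`∑_d ∑_{s=0}^{p-ν_a d} c̃_{p,s}^{(d)} q^d Φ̂_{s-l;b-(p-ν_a d-s)}` if `ν_a > 0`. -/
def phiP (n : ℕ) {l : ℕ} (a : Fin l → ℕ) (p : ℕ) (b : ℤ) : PowerSeries ℚ :=
  if nu n a = 0 then phiHat n a ((p : ℤ) - (l : ℤ)) b
  else
    ∑ d ∈ Finset.range (p + 1),
      if nu n a * d ≤ p then
        ∑ s ∈ Finset.range (p - nu n a * d + 1),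
          PowerSeries.C (cTilde n a p s d) * PowerSeries.X ^ d *
            phiHat n a ((s : ℤ) - (l : ℤ)) (b - ((p : ℤ) - (nu n a : ℤ) * (d : ℤ) - (s : ℤ)))
      else 0

/-- `Φ_{m,c} = (Φ_0^2/I_0^2) (-1)^{m+|c|} (m+|c|)! ∏_r (1/c_r!) (Φ_r / ((r+1)! Φ_0))^{c_r}`, where
the finitely supported sequence `c = (c_1, c_2, …)` is given by the multiset that contains each
`r ≥ 1` exactly `c_r` times; thus `|c| = ∑ c_r` is its cardinality. -/
def phiM (n : ℕ) {l : ℕ} (a : Fin l → ℕ) (m : ℕ) (c : Multiset ℕ) : PowerSeries ℚ :=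
  phi n a 0 ^ 2 * (seriesI n a 0 ^ 2)⁻¹ *
    PowerSeries.C ((-1 : ℚ) ^ (m + c.card) * ((m + c.card).factorial : ℚ)) *
    ∏ r ∈ c.toFinset,
      (PowerSeries.C (1 / ((c.count r).factorial : ℚ)) *
        (phi n a r * (PowerSeries.C ((r + 1).factorial : ℚ) * phi n a 0)⁻¹) ^ c.count r)

/-! ### The structure constants -/

/-- The two-pointed constants `c_{(pp'),(bb')}^{(d,t)}`: the coefficient of `q^d` in
`(-1)^b L^{δ_{0,ν_a} (1+t) n} / I_0^2` if `b ≥ 0`, `b + b' = -1` and `p + p' + n t = n - 1 + l`,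
and zero otherwise. -/
def twoPointConst (n : ℕ) {l : ℕ} (a : Fin l → ℕ) (p p' : ℕ) (b b' : ℤ) (d t : ℕ) : ℚ :=
  if 0 ≤ b ∧ b + b' = -1 ∧ p + p' + n * t + 1 = n + l then
    (-1) ^ b.toNat *
      PowerSeries.coeff d
        (seriesL n a ^ (deltaNu n a * ((1 + t) * n)) * (seriesI n a 0 ^ 2)⁻¹)
  else 0

/-- The second factor of the recursion for the structure constants: the sum over `b'' ∈ ℕ^m` and
`c` with `|b''| + ∑_r r c_r = m - 3` of the coefficient of `q^{d'}` in
`Φ_{m-3,c} ∏_i I_0^2 Φ_{p'_i; b'_i+1+b''_i} / (b''_i! L^{δ_{0,ν_a} n} Φ_0)`.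
The set of indices `i` is a finite type `ι` with `m` elements; the sequences `c` with
`∑_r r c_r = k` are the partitions of `k`. -/
def vertexFactor (n : ℕ) {l : ℕ} (a : Fin l → ℕ) {ι : Type} [Fintype ι] [DecidableEq ι]
    (p' : ι → Fin n) (b' : ι → ℤ) (d' : ℕ) : ℚ :=
  ∑ x ∈ Finset.HasAntidiagonal.antidiagonal (Fintype.card ι - 3),
    ∑ b'' ∈ Finset.piAntidiag (Finset.univ : Finset ι) x.1,
      ∑ c : Nat.Partition x.2,
        PowerSeries.coeff d'
          (phiM n a (Fintype.card ι - 3) c.parts *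
            ∏ i, (seriesI n a 0 ^ 2 * phiP n a (p' i) (b' i + 1 + (b'' i : ℤ)) *
              (PowerSeries.C ((b'' i).factorial : ℚ) * seriesL n a ^ (deltaNu n a * n) *
                phi n a 0)⁻¹))

/-- The condition `(p', b') ∈ S_m(d', t')`, that is
`|p'| - |b'| = n - 2 + (m - 1)(l + 2) + ν_a d' + n t'`, for tuples indexed by a type with `m`
elements. -/
def InS (n : ℕ) {l : ℕ} (a : Fin l → ℕ) {ι : Type} [Fintype ι]
    (p' : ι → Fin n) (b' : ι → ℤ) (d' : ℕ) (t' : ℤ) : Prop :=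
  (∑ i, (((p' i : ℕ)) : ℤ)) - ∑ i, b' i =
    (n : ℤ) - 2 + ((Fintype.card ι : ℤ) - 1) * ((l : ℤ) + 2) + (nu n a : ℤ) * (d' : ℤ)
      + (n : ℤ) * t'

instance (n : ℕ) {l : ℕ} (a : Fin l → ℕ) {ι : Type} [Fintype ι]
    (p' : ι → Fin n) (b' : ι → ℤ) (d' : ℕ) (t' : ℤ) : Decidable (InS n a p' b' d' t') :=
  inferInstanceAs (Decidable (_ = _))

/-- The structure constants `c_{p,b}^{(d,t)}` for `N`-tuples `p` and `b`, where `N ≥ 2`.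

For `N = 2` they are the two-pointed constants.  For `N ≥ 3` they are given inductively by a sum
over
* the partitions `{S_i}` of the `N` marked points into `m ≥ 3` nonempty subsets, one of which
  consists of the last marked point only;
* the `m`-tuples `p'` of elements of `{0, …, n-1}` and `b'` of integers, the tuples of natural
  numbers `(t_i)` and `(d_i)`, and `d'`, where `d' + ∑ d_i = d`, and where `(p', b')` lies in
  `S_m(d', t')` with `t' = t - ∑ t_i ∈ ℤ`.

The summand is the product of the constants `c^{(d_i,t_i)}` for the tuples `p|_{S_i} p'_i` and
`b|_{S_i} b'_i` (taken to be zero if `b'_i < 0` and `|S_i| ≥ 2`) and of `vertexFactor`.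

A priori, `b'_i` and `t_i` run over all integers and all natural numbers, respectively.  By
`structConst_bounds` below, the summand is zero unless they lie in the ranges that are written here
to keep the sums finite (`mem_ranges_of_structConst_ne_zero`). -/
def structConst (n : ℕ) {l : ℕ} (a : Fin l → ℕ) :
    (N : ℕ) → (Fin N → Fin n) → (Fin N → ℤ) → ℕ → ℕ → ℚ
  | N, p, b, d, t =>
    if h₂ : N = 2 then
      twoPointConst n a (p ⟨0, by omega⟩) (p ⟨1, by omega⟩) (b ⟨0, by omega⟩) (b ⟨1, by omega⟩) d t
    else if h₃ : 3 ≤ N then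
      ∑ P : Finpartition (Finset.univ : Finset (Fin N)),
        if {(⟨N - 1, by omega⟩ : Fin N)} ∈ P.parts ∧ 3 ≤ P.parts.card then
          ∑ p' : P.parts → Fin n,
            ∑ b' ∈ Fintype.piFinset fun S : P.parts =>
                Finset.Icc (-1 - ∑ s ∈ S.1, |b s|) (N : ℤ),
              ∑ τ ∈ Fintype.piFinset fun _ : P.parts => Finset.range (N + 1),
                ∑ d' ∈ Finset.range (d + 1),
                  ∑ e ∈ Finset.piAntidiag (Finset.univ : Finset P.parts) (d - d'),
                    if InS n a p' b' d' ((t : ℤ) - ∑ S, (τ S : ℤ)) then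
                      (∏ S : P.parts,
                        if b' S < 0 ∧ 2 ≤ S.1.card then 0
                        else if h : S.1.card + 1 < N then
                          structConst n a (S.1.card + 1)
                            (Fin.snoc (α := fun _ => Fin n)
                              (fun i => p (S.1.orderEmbOfFin rfl i)) (p' S))
                            (Fin.snoc (α := fun _ => ℤ)
                              (fun i => b (S.1.orderEmbOfFin rfl i)) (b' S))
                            (e S) (τ S)
                        else 0) *
                      vertexFactor n a p' b' d'
                    else 0
        else 0
    else 0
  termination_by N => N
  decreasing_by exact h

end GWStructure

end

noncomputable section
namespace GWStructure

theorem IsL.unique {n l : ℕ} {a : Fin l → ℕ} (hn : 1 ≤ n) {f g : PowerSeries ℚ}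
    (hf : IsL n a f) (hg : IsL n a g) : f = g := by
  have h1 := geom_sum₂_mul f g n
  have h2 := geom_sum₂_mul f g (absDeg a)
  have h3 : (∑ i ∈ Finset.range n, f ^ i * g ^ (n - 1 - i) -
      PowerSeries.C (selfPow a : ℚ) * PowerSeries.X *
        ∑ i ∈ Finset.range (absDeg a), f ^ i * g ^ (absDeg a - 1 - i)) * (f - g) = 0 := by
    have e1 := hf.2
    have e2 := hg.2
    linear_combination h1 - PowerSeries.C (selfPow a : ℚ) * PowerSeries.X * h2 + e1 - e2
  rcases mul_eq_zero.1 h3 with h | h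
  · have := congrArg PowerSeries.constantCoeff h
    simp [hf.1, hg.1] at this
    omega
  · exact sub_eq_zero.1 h

theorem exists_isL {n l : ℕ} {a : Fin l → ℕ} (hn : 1 ≤ n) (ha : absDeg a ≤ n) :
    ∃ f, IsL n a f := by
  set c : PowerSeries ℚ := PowerSeries.C (selfPow a : ℚ) * PowerSeries.X with hc
  have c0 : PowerSeries.constantCoeff c = 0 := by simp [hc]
  have hI : ∀ x : PowerSeries ℚ, x ∈ Ideal.span {(PowerSeries.X : PowerSeries ℚ)} ↔
      PowerSeries.constantCoeff x = 0 := fun x => by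
    rw [Ideal.mem_span_singleton, PowerSeries.X_dvd_iff]
  have key : ∀ P : Polynomial (PowerSeries ℚ), P.Monic →
      PowerSeries.constantCoeff (P.eval 1) = 0 →
      PowerSeries.constantCoeff ((Polynomial.derivative P).eval 1) ≠ 0 →
      ∃ x, P.eval x = 0 ∧ PowerSeries.constantCoeff x = 1 := by
    intro P hP h0 h1
    obtain ⟨x, hx, hx1⟩ := HenselianRing.is_henselian (R := PowerSeries ℚ)
      (I := Ideal.span {(PowerSeries.X : PowerSeries ℚ)}) P hP 1 ((hI _).2 h0)
      (IsUnit.map _ (PowerSeries.isUnit_iff_constantCoeff.2 (isUnit_iff_ne_zero.2 h1)))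
    refine ⟨x, hx, ?_⟩
    have := (hI _).1 hx1
    simp only [map_sub, map_one] at this
    linarith
  have hn0 : (n : ℚ) ≠ 0 := by positivity
  rcases lt_or_eq_of_le ha with h | h
  · obtain ⟨x, hx, hx1⟩ := key
      (Polynomial.X ^ n - (Polynomial.C c * Polynomial.X ^ absDeg a + Polynomial.C 1)) (by
        apply Polynomial.monic_X_pow_sub
        refine (Polynomial.degree_add_le _ _).trans_lt (max_lt ?_ ?_)
        · refine (Polynomial.degree_C_mul_X_pow_le _ _).trans_lt ?_
          exact_mod_cast h
        · refine Polynomial.degree_C_le.trans_lt ?_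
          exact_mod_cast hn)
      (by simp [c0]) (by simpa [c0, Polynomial.derivative_X_pow] using hn0)
    refine ⟨x, hx1, ?_⟩
    simp at hx
    linear_combination hx
  · have hu : PowerSeries.constantCoeff (1 - c) ≠ 0 := by simp [c0]
    obtain ⟨x, hx, hx1⟩ := key (Polynomial.X ^ n - Polynomial.C ((1 - c)⁻¹))
      (Polynomial.monic_X_pow_sub_C _ (by omega))
      (by simp [c0]) (by simpa [Polynomial.derivative_X_pow] using hn0)
    refine ⟨x, hx1, ?_⟩
    simp at hx
    have h5 := PowerSeries.mul_inv_cancel _ hu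
    rw [h, ← hc]
    linear_combination (1 - c) * hx + h5

theorem isL_seriesL {n l : ℕ} {a : Fin l → ℕ} (hn : 1 ≤ n) (ha : absDeg a ≤ n) :
    IsL n a (seriesL n a) := Classical.epsilon_spec (exists_isL hn ha)

/-! existence of Phi -/

def odeCoeff (A B g : PowerSeries ℚ) (c : ℚ) : ℕ → ℚ
  | 0 => c
  | d + 1 =>
    (PowerSeries.coeff (d + 1) g - ∑ j : Fin (d + 1),
      (PowerSeries.coeff (d + 1 - j) A * (j : ℚ) + PowerSeries.coeff (d + 1 - j) B) *
        odeCoeff A B g c j) / (PowerSeries.constantCoeff A * (d + 1 : ℚ))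
  termination_by d => d
  decreasing_by exact j.isLt

theorem ode_coeff_eq (A B f : PowerSeries ℚ) (d : ℕ) :
    PowerSeries.coeff d (A * qD f + B * f) = ∑ j ∈ Finset.range (d + 1),
      (PowerSeries.coeff (d - j) A * (j : ℚ) + PowerSeries.coeff (d - j) B) *
        PowerSeries.coeff j f := by
  rw [map_add, mul_comm A, mul_comm B, PowerSeries.coeff_mul, PowerSeries.coeff_mul,
    Finset.Nat.sum_antidiagonal_eq_sum_range_succ_mk,
    Finset.Nat.sum_antidiagonal_eq_sum_range_succ_mk, ← Finset.sum_add_distrib]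
  refine Finset.sum_congr rfl fun j _ => ?_
  simp only [qD, PowerSeries.coeff_mk]
  ring

theorem ode_exists (A B g : PowerSeries ℚ) (c : ℚ) (hA : PowerSeries.constantCoeff A ≠ 0)
    (hB : PowerSeries.constantCoeff B = 0) (hg : PowerSeries.constantCoeff g = 0) :
    PowerSeries.constantCoeff (PowerSeries.mk (odeCoeff A B g c)) = c ∧
    A * qD (PowerSeries.mk (odeCoeff A B g c)) + B * PowerSeries.mk (odeCoeff A B g c) = g := by
  refine ⟨by rw [← PowerSeries.coeff_zero_eq_constantCoeff_apply, PowerSeries.coeff_mk, odeCoeff],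
    ?_⟩
  ext d
  rw [ode_coeff_eq]
  rcases d with _ | d
  · simp [hB, hg]
  · rw [Finset.sum_range_succ]
    have hd : (d : ℚ) + 1 ≠ 0 := by positivity
    conv_lhs => enter [2, 2]; rw [PowerSeries.coeff_mk, odeCoeff]
    simp only [PowerSeries.coeff_mk, Nat.sub_self, PowerSeries.coeff_zero_eq_constantCoeff_apply, hB]
    rw [Finset.sum_range]
    push_cast
    field_simp
    ring

theorem ode_unique (A B f f' : PowerSeries ℚ) (hA : PowerSeries.constantCoeff A ≠ 0)
    (hB : PowerSeries.constantCoeff B = 0)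
    (h0 : PowerSeries.constantCoeff f = PowerSeries.constantCoeff f')
    (h : A * qD f + B * f = A * qD f' + B * f') : f = f' := by
  ext d
  induction d using Nat.strong_induction_on with
  | _ d ih =>
    rcases d with _ | d
    · simpa using h0
    · have := congrArg (PowerSeries.coeff (d + 1)) h
      rw [ode_coeff_eq, ode_coeff_eq, Finset.sum_range_succ _ (d + 1),
        Finset.sum_range_succ _ (d + 1),
        Finset.sum_congr (g := fun j => (PowerSeries.coeff (d + 1 - j) A * (j : ℚ) +
          PowerSeries.coeff (d + 1 - j) B) * PowerSeries.coeff j f') rfl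
          (fun j hj => by rw [ih j (Finset.mem_range.1 hj)])] at this
      have h2 := add_left_cancel this
      simp only [Nat.sub_self, PowerSeries.coeff_zero_eq_constantCoeff_apply, hB] at h2
      refine mul_left_cancel₀ ?_ h2
      push_cast
      have hd : (d : ℚ) + 1 ≠ 0 := by positivity
      simpa using ⟨hA, hd⟩


theorem constantCoeff_evalAt (f : RatFunc ℚ) (u : PowerSeries ℚ)
    (hu : PowerSeries.constantCoeff u = 1) :
    PowerSeries.constantCoeff (evalAt f u) = RatFunc.eval (RingHom.id ℚ) 1 f := by
  have h : ∀ p : Polynomial ℚ, PowerSeries.constantCoeff (Polynomial.aeval u p) = p.eval 1 := by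
    intro p
    induction p using Polynomial.induction_on' with
    | add p q hp hq => simp [hp, hq]
    | monomial k c =>
      rw [Polynomial.aeval_monomial]
      simp [hu]
  rw [evalAt, map_mul, PowerSeries.constantCoeff_inv, h, h, RatFunc.eval, Polynomial.eval₂_id,
    Polynomial.eval₂_id, div_eq_mul_inv]

/-- The denominator does not vanish at `1`. -/
def RegularAtOne (f : RatFunc ℚ) : Prop := f.denom.eval 1 ≠ 0

theorem RegularAtOne.of_dvd {f : RatFunc ℚ} {p : Polynomial ℚ} (h : f.denom ∣ p)
    (hp : p.eval 1 ≠ 0) : RegularAtOne f := fun h0 => hp (Polynomial.eval_eq_zero_of_dvd_of_eval_eq_zero h h0)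

theorem RegularAtOne.add {f g : RatFunc ℚ} (hf : RegularAtOne f) (hg : RegularAtOne g) :
    RegularAtOne (f + g) :=
  .of_dvd (RatFunc.denom_add_dvd f g) (by rw [Polynomial.eval_mul]; exact mul_ne_zero hf hg)

theorem RegularAtOne.mul {f g : RatFunc ℚ} (hf : RegularAtOne f) (hg : RegularAtOne g) :
    RegularAtOne (f * g) :=
  .of_dvd (RatFunc.denom_mul_dvd f g) (by rw [Polynomial.eval_mul]; exact mul_ne_zero hf hg)

theorem RegularAtOne.eval_mul {f g : RatFunc ℚ} (hf : RegularAtOne f) (hg : RegularAtOne g) :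
    RatFunc.eval (RingHom.id ℚ) 1 (f * g) =
      RatFunc.eval (RingHom.id ℚ) 1 f * RatFunc.eval (RingHom.id ℚ) 1 g :=
  RatFunc.eval_mul _ _ (by rwa [Polynomial.eval₂_id]) (by rwa [Polynomial.eval₂_id])

theorem RegularAtOne.eval_add {f g : RatFunc ℚ} (hf : RegularAtOne f) (hg : RegularAtOne g) :
    RatFunc.eval (RingHom.id ℚ) 1 (f + g) =
      RatFunc.eval (RingHom.id ℚ) 1 f + RatFunc.eval (RingHom.id ℚ) 1 g :=
  RatFunc.eval_add _ _ (by rwa [Polynomial.eval₂_id]) (by rwa [Polynomial.eval₂_id])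

theorem RegularAtOne.poly_div (p q : Polynomial ℚ) (hq : q.eval 1 ≠ 0) :
    RegularAtOne (algebraMap (Polynomial ℚ) (RatFunc ℚ) p / algebraMap (Polynomial ℚ) (RatFunc ℚ) q) :=
  .of_dvd (RatFunc.denom_div_dvd p q) hq

theorem RegularAtOne.poly (p : Polynomial ℚ) :
    RegularAtOne (algebraMap (Polynomial ℚ) (RatFunc ℚ) p) := by
  simp [RegularAtOne, RatFunc.denom_algebraMap]

theorem RegularAtOne.ratDeriv {f : RatFunc ℚ} (hf : RegularAtOne f) :
    RegularAtOne (ratDeriv f) :=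
  .poly_div _ _ (by rw [Polynomial.eval_pow]; exact pow_ne_zero 2 hf)

theorem calH_one {n l : ℕ} {a : Fin l → ℕ} (hn : 1 ≤ n) (ha : absDeg a ≤ n) (m j : ℕ) :
    RegularAtOne (calH n a m j) ∧ (j ≠ 0 →
      RatFunc.eval (RingHom.id ℚ) 1 (calH n a m j) = 0) := by
  have r1 : RegularAtOne (1 : RatFunc ℚ) := by simpa using RegularAtOne.poly 1
  have r0 : RegularAtOne (0 : RatFunc ℚ) := by simpa using RegularAtOne.poly 0
  have rX : RegularAtOne (RatFunc.X : RatFunc ℚ) := by simpa using RegularAtOne.poly Polynomial.X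
  have rC : ∀ c : ℚ, RegularAtOne (RatFunc.C c) := fun c => by
    simpa using RegularAtOne.poly (Polynomial.C c)
  have rX1 : RegularAtOne (RatFunc.X - 1 : RatFunc ℚ) := by
    have := RegularAtOne.poly (Polynomial.X - 1)
    rwa [map_sub, RatFunc.algebraMap_X, map_one] at this
  have eX1 : RatFunc.eval (RingHom.id ℚ) 1 (RatFunc.X - 1 : RatFunc ℚ) = 0 := by
    have := RatFunc.eval_algebraMap (RingHom.id ℚ) (1 : ℚ) (Polynomial.X - 1 : Polynomial ℚ)
    simpa using this
  have rI : RegularAtOne (RatFunc.C (absDeg a : ℚ) + RatFunc.C (nu n a : ℚ) * RatFunc.X)⁻¹ := by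
    have := RegularAtOne.poly_div 1
      (Polynomial.C (absDeg a : ℚ) + Polynomial.C (nu n a : ℚ) * Polynomial.X) (by
        simp only [Polynomial.eval_add, Polynomial.eval_mul, Polynomial.eval_C, Polynomial.eval_X,
          mul_one]
        have : absDeg a + nu n a ≠ 0 := by unfold nu; omega
        exact_mod_cast this)
    simpa using this
  induction m generalizing j with
  | zero =>
    cases j with
    | zero => simpa [calH] using r1
    | succ j => simpa [calH] using r0
  | succ m ih =>
    cases j with
    | zero => simpa [calH] using (ih 0).1
    | succ j =>
      rw [calH]
      split_ifs with h
      · have g := (((rC (n : ℚ)).mul rX).mul (ih j).1.ratDeriv).add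
          ((rC ((m : ℚ) - (j : ℚ))).mul (ih j).1)
        rw [div_eq_mul_inv]
        refine ⟨(ih _).1.add ((rX1.mul rI).mul g), fun _ => ?_⟩
        rw [RegularAtOne.eval_add (ih _).1 ((rX1.mul rI).mul g),
          RegularAtOne.eval_mul (rX1.mul rI) g, RegularAtOne.eval_mul rX1 rI, eX1,
          (ih (j + 1)).2 (by simp)]
        simp
      · exact ⟨r0, fun _ => by simp⟩

theorem constantCoeff_qD_iterate (i : ℕ) (hi : i ≠ 0) (f : PowerSeries ℚ) :
    PowerSeries.constantCoeff (qD^[i] f) = 0 := by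
  obtain ⟨i, rfl⟩ := Nat.exists_eq_succ_of_ne_zero hi
  rw [Function.iterate_succ_apply', ← PowerSeries.coeff_zero_eq_constantCoeff_apply, qD]
  simp

/-- The coefficient of `(q d/dq)^i` in `opL`. -/
def opLCoeff (n : ℕ) {l : ℕ} (a : Fin l → ℕ) (k i : ℕ) : PowerSeries ℚ :=
  PowerSeries.C (n.choose i : ℚ) * seriesL n a ^ n *
      evalAt (calH n a (n - i) (k - i)) (seriesL n a ^ n) -
    (seriesL n a ^ n - 1) *
      ∑ r ∈ Finset.range (k - i + 1),
        PowerSeries.C (((absDeg a - r).choose i : ℚ) * chi a r) *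
          evalAt (calH n a (absDeg a - i - r) (k - i - r)) (seriesL n a ^ n)

theorem opL_eq (n : ℕ) {l : ℕ} (a : Fin l → ℕ) (k : ℕ) (f : PowerSeries ℚ) :
    opL n a k f = ∑ i ∈ Finset.range (k + 1), opLCoeff n a k i * qD^[i] f := rfl

theorem constantCoeff_opLCoeff {n l : ℕ} {a : Fin l → ℕ} (hn : 1 ≤ n) (ha : absDeg a ≤ n)
    (k : ℕ) (hk : k ≠ 0) : PowerSeries.constantCoeff (opLCoeff n a k 0) = 0 := by
  have hL := (isL_seriesL hn ha).1
  simp [opLCoeff, hL, constantCoeff_evalAt, (calH_one hn ha n k).2 hk]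

theorem constantCoeff_opL {n l : ℕ} {a : Fin l → ℕ} (hn : 1 ≤ n) (ha : absDeg a ≤ n)
    (k : ℕ) (hk : k ≠ 0) (f : PowerSeries ℚ) : PowerSeries.constantCoeff (opL n a k f) = 0 := by
  rw [opL_eq, map_sum]
  refine Finset.sum_eq_zero fun i _ => ?_
  rw [map_mul]
  rcases eq_or_ne i 0 with rfl | hi
  · rw [constantCoeff_opLCoeff hn ha k hk, zero_mul]
  · rw [constantCoeff_qD_iterate i hi, mul_zero]

theorem calH_zero (n : ℕ) {l : ℕ} (a : Fin l → ℕ) (m : ℕ) : calH n a m 0 = 1 := by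
  induction m with
  | zero => rfl
  | succ m ih => rw [calH, ih]

theorem constantCoeff_opLCoeff_one {n l : ℕ} {a : Fin l → ℕ} (hn : 1 ≤ n) (ha : absDeg a ≤ n) :
    PowerSeries.constantCoeff (opLCoeff n a 1 1) ≠ 0 := by
  have hL := (isL_seriesL hn ha).1
  simp [opLCoeff, hL, constantCoeff_evalAt, calH_zero]
  omega

theorem opL_one (n : ℕ) {l : ℕ} (a : Fin l → ℕ) (f : PowerSeries ℚ) :
    opL n a 1 f = opLCoeff n a 1 1 * qD f + opLCoeff n a 1 0 * f := by
  rw [opL_eq, Finset.sum_range_succ, Finset.sum_range_one]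
  simp [add_comm]

/-- The part of the equation for `Φ_b` that involves only `Φ_{b'}` with `b' < b`. -/
def phiRhs (n : ℕ) {l : ℕ} (a : Fin l → ℕ) (b : ℕ) (Φ : ℕ → PowerSeries ℚ) : PowerSeries ℚ :=
  -∑ k ∈ Finset.Icc 2 n,
    (if k ≤ b + 1 then (seriesL n a)⁻¹ ^ (k - 1) * opL n a k (Φ (b + 1 - k)) else 0)

theorem phiRhs_congr (n : ℕ) {l : ℕ} (a : Fin l → ℕ) (b : ℕ) (Φ Ψ : ℕ → PowerSeries ℚ)
    (h : ∀ i < b, Φ i = Ψ i) : phiRhs n a b Φ = phiRhs n a b Ψ := by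
  refine congrArg Neg.neg (Finset.sum_congr rfl fun k hk => ?_)
  rw [Finset.mem_Icc] at hk
  split_ifs with h1
  · rw [h _ (by omega)]
  · rfl

theorem constantCoeff_phiRhs {n l : ℕ} {a : Fin l → ℕ} (hn : 1 ≤ n) (ha : absDeg a ≤ n) (b : ℕ)
    (Φ : ℕ → PowerSeries ℚ) : PowerSeries.constantCoeff (phiRhs n a b Φ) = 0 := by
  rw [phiRhs, map_neg, map_sum, Finset.sum_eq_zero, neg_zero]
  intro k hk
  rw [Finset.mem_Icc] at hk
  split_ifs
  · rw [map_mul, constantCoeff_opL hn ha k (by omega), mul_zero]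
  · simp

theorem phi_eq_iff {n l : ℕ} (a : Fin l → ℕ) (hn : 1 ≤ n) (b : ℕ) (Φ : ℕ → PowerSeries ℚ) :
    (∑ k ∈ Finset.Icc 1 n,
      (if k ≤ b + 1 then (seriesL n a)⁻¹ ^ (k - 1) * opL n a k (Φ (b + 1 - k)) else 0) = 0) ↔
      opLCoeff n a 1 1 * qD (Φ b) + opLCoeff n a 1 0 * Φ b = phiRhs n a b Φ := by
  rw [← Finset.add_sum_Ioc_eq_sum_Icc hn, ← opL_one, phiRhs, eq_neg_iff_add_eq_zero]
  simp
  rfl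

/-- An explicit solution of the equations for `Φ_b`. -/
def phiSol (n : ℕ) {l : ℕ} (a : Fin l → ℕ) (b : ℕ) : PowerSeries ℚ :=
  PowerSeries.mk (odeCoeff (opLCoeff n a 1 1) (opLCoeff n a 1 0)
    (phiRhs n a b fun i => if i < b then phiSol n a i else 0) (if b = 0 then 1 else 0))
  termination_by b

theorem isPhi_phi {n l : ℕ} {a : Fin l → ℕ} (hn : 1 ≤ n) (ha : absDeg a ≤ n) :
    IsPhi n a (phi n a) := by
  refine Classical.epsilon_spec (p := IsPhi n a) ⟨phiSol n a, ?_⟩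
  have key := fun b => ode_exists (opLCoeff n a 1 1) (opLCoeff n a 1 0)
    (phiRhs n a b fun i => if i < b then phiSol n a i else 0) (if b = 0 then 1 else 0)
    (constantCoeff_opLCoeff_one hn ha) (constantCoeff_opLCoeff hn ha 1 one_ne_zero)
    (constantCoeff_phiRhs hn ha _ _)
  have e := fun b => phiSol.eq_1 n a b
  simp only [← e] at key
  refine ⟨by simpa using (key 0).1, fun b hb => ?_, fun b => ?_⟩
  · simpa [show b ≠ 0 by omega] using (key b).1
  · rw [phi_eq_iff a hn, (key b).2]
    exact phiRhs_congr _ _ _ _ _ fun i hi => by simp [hi]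

theorem IsPhi.unique {n l : ℕ} {a : Fin l → ℕ} (hn : 1 ≤ n) (ha : absDeg a ≤ n)
    {Φ Ψ : ℕ → PowerSeries ℚ} (h : IsPhi n a Φ) (h' : IsPhi n a Ψ) : Φ = Ψ := by
  funext b
  induction b using Nat.strong_induction_on with
  | _ b ih =>
    refine ode_unique (opLCoeff n a 1 1) (opLCoeff n a 1 0) _ _
      (constantCoeff_opLCoeff_one hn ha) (constantCoeff_opLCoeff hn ha 1 one_ne_zero) ?_ ?_
    · rcases Nat.eq_zero_or_pos b with rfl | hb
      · rw [h.1, h'.1]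
      · rw [h.2.1 b hb, h'.2.1 b hb]
    · rw [(phi_eq_iff a hn b Φ).1 (h.2.2 b), (phi_eq_iff a hn b Ψ).1 (h'.2.2 b)]
      exact phiRhs_congr _ _ _ _ _ ih

end GWStructure
end

noncomputable section
namespace GWStructure

theorem cCoeff_zero (n : ℕ) {l : ℕ} (a : Fin l → ℕ) (p s : ℕ) :
    cCoeff n a p s 0 = if p = s then 1 else 0 := by
  simp [cCoeff, PowerSeries.coeff_X_pow, eq_comm]

theorem cTildeShift_eq (n : ℕ) {l : ℕ} (a : Fin l → ℕ) (p s d : ℕ) (h : s + nu n a * d ≤ p) :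
    ∑ d₁ ∈ Finset.range (d + 1), ∑ r ∈ Finset.range (p - nu n a * d₁ + 1),
      cTildeShift n a p d₁ r * cCoeff n a r s (d - d₁) = if d = 0 ∧ p = s then 1 else 0 := by
  have h1 : ∑ r ∈ Finset.range (p - nu n a * d + 1),
      cTildeShift n a p d r * cCoeff n a r s (d - d) = cTildeShift n a p d s := by
    rw [Finset.sum_eq_single_of_mem s (Finset.mem_range.2 (by omega))
      (fun r _ hr => by rw [Nat.sub_self, cCoeff_zero, if_neg hr, mul_zero]), Nat.sub_self,
      cCoeff_zero, if_pos rfl, mul_one]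
  rw [Finset.sum_range_succ, h1, cTildeShift, if_pos h, Finset.sum_range]
  ring

theorem phiP_of_neg (n : ℕ) {l : ℕ} (a : Fin l → ℕ) (p : ℕ) (b : ℤ) (hb : b < 0) :
    phiP n a p b = 0 := by
  unfold phiP
  split_ifs with h
  · rw [phiHat, if_pos hb]
  · refine Finset.sum_eq_zero fun d _ => ?_
    split_ifs with h2
    · refine Finset.sum_eq_zero fun s hs => ?_
      rw [Finset.mem_range] at hs
      zify [h2] at hs
      rw [phiHat, if_pos (by linarith), mul_zero]
    · rfl

theorem exists_of_vertexFactor_ne_zero {n l : ℕ} {a : Fin l → ℕ} {ι : Type} [Fintype ι]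
    [DecidableEq ι] {p' : ι → Fin n} {b' : ι → ℤ} {d' : ℕ} (h : vertexFactor n a p' b' d' ≠ 0) :
    ∃ b'' : ι → ℕ, ∑ i, b'' i ≤ Fintype.card ι - 3 ∧ ∀ i, 0 ≤ b' i + 1 + (b'' i : ℤ) := by
  obtain ⟨x, hx, h⟩ := Finset.exists_ne_zero_of_sum_ne_zero h
  obtain ⟨b'', hb, h⟩ := Finset.exists_ne_zero_of_sum_ne_zero h
  obtain ⟨c, hc, h⟩ := Finset.exists_ne_zero_of_sum_ne_zero h
  refine ⟨b'', ?_, fun i => ?_⟩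
  · have h1 := (Finset.mem_piAntidiag.1 hb).1
    have h2 := Finset.HasAntidiagonal.mem_antidiagonal.1 hx
    change ∑ i, b'' i = x.1 at h1
    omega
  · by_contra hi
    refine h ?_
    rw [Finset.prod_eq_zero (Finset.mem_univ i), mul_zero, map_zero]
    rw [phiP_of_neg _ _ _ _ (by omega)]
    simp

theorem of_twoPointConst_ne_zero {n l : ℕ} {a : Fin l → ℕ}
    {p p' : ℕ} {b b' : ℤ} {d t : ℕ} (h : twoPointConst n a p p' b b' d t ≠ 0) :
    0 ≤ b ∧ b + b' = -1 ∧ p + p' + n * t + 1 = n + l ∧ nu n a * d = 0 := by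
  unfold twoPointConst at h
  split_ifs at h with h1
  · refine ⟨h1.1, h1.2.1, h1.2.2, ?_⟩
    by_contra h0
    refine h ?_
    have hd : d ≠ 0 := fun h => h0 (by simp [h])
    have hv : nu n a ≠ 0 := fun h => h0 (by simp [h])
    have hA : absDeg a ≠ n := fun h => hv (by simp [nu, h])
    simp [deltaNu, hv, seriesI, hA, PowerSeries.coeff_one, hd]
  · exact absurd rfl h

theorem sum_orderEmb {N : ℕ} (S : Finset (Fin N)) (f : Fin N → ℤ) :
    ∑ i, f (S.orderEmbOfFin rfl i) = ∑ s ∈ S, f s := by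
  conv_rhs => rw [← Finset.map_orderEmbOfFin_univ S rfl, Finset.sum_map]
  rfl

theorem sum_parts {N : ℕ} (P : Finpartition (Finset.univ : Finset (Fin N))) (f : Fin N → ℤ) :
    ∑ S : P.parts, ∑ s ∈ S.1, f s = ∑ s, f s := by
  rw [Finset.sum_coe_sort P.parts (fun S => ∑ s ∈ S, f s)]
  conv_rhs => rw [← P.biUnion_parts, Finset.sum_biUnion P.disjoint]
  rfl

/-- The bound on `|b|` and the relation between `p`, `b`, `d`, `t` that hold for nonzero
structure constants. -/
def Bounds (n : ℕ) {l : ℕ} (a : Fin l → ℕ) (N : ℕ) (p : Fin N → Fin n) (b : Fin N → ℤ)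
    (d t : ℕ) : Prop :=
  ∑ s, b s ≤ (N : ℤ) - 3 ∧
    (∑ s, ((p s : ℕ) : ℤ)) - ∑ s, b s + (nu n a : ℤ) * d + (n : ℤ) * t =
      ((N : ℤ) - 1) * ((n : ℤ) - 2) + 2 + l

theorem block_bounds {n l : ℕ} {a : Fin l → ℕ} (k : ℕ) (hk : 1 ≤ k)
    (q : Fin (k + 1) → Fin n) (c : Fin (k + 1) → ℤ) (d t : ℕ)
    (ih : 2 ≤ k → Bounds n a (k + 1) q c d t) (h : structConst n a (k + 1) q c d t ≠ 0) :
    (∑ s, ((q s : ℕ) : ℤ)) - ∑ s, c s + (nu n a : ℤ) * d + (n : ℤ) * t =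
      (k : ℤ) * ((n : ℤ) - 2) + 2 + l ∧
    (2 ≤ k → ∑ s, c s ≤ (k : ℤ) - 2) ∧ (k = 1 → 0 ≤ c 0 ∧ ∑ s, c s = -1) := by
  rcases eq_or_lt_of_le hk with rfl | h2
  · rw [structConst, dif_pos rfl] at h
    obtain ⟨j1, j2, j3, j4⟩ := of_twoPointConst_ne_zero h
    change 0 ≤ c 0 at j1
    change c 0 + c 1 = -1 at j2
    change (q 0 : ℕ) + (q 1 : ℕ) + n * t + 1 = n + l at j3
    zify at j3 j4
    refine ⟨?_, fun h => by omega, fun _ => ⟨j1, ?_⟩⟩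
    · have e1 : ∑ s : Fin (1 + 1), ((q s : ℕ) : ℤ) = ((q 0 : ℕ) : ℤ) + ((q 1 : ℕ) : ℤ) :=
        Fin.sum_univ_two _
      have e2 : ∑ s : Fin (1 + 1), c s = c 0 + c 1 := Fin.sum_univ_two _
      rw [e1, e2]
      push_cast
      linarith
    · have e2 : ∑ s : Fin (1 + 1), c s = c 0 + c 1 := Fin.sum_univ_two _
      rw [e2]
      exact j2
  · obtain ⟨i1, i2⟩ := ih h2
    push_cast at i1 i2
    exact ⟨by linarith, fun _ => by linarith, fun h => by omega⟩

/-- If `b ≥ 0` and `c_{p,b}^{(d,t)} ≠ 0`, then `|b| ≤ N - 3` and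
`|p| - |b| + ν_a d + n t = (N - 1)(n - 2) + 2 + l`. -/
theorem structConst_bounds {n l : ℕ} {a : Fin l → ℕ} (N : ℕ) :
    3 ≤ N → ∀ (p : Fin N → Fin n) (b : Fin N → ℤ) (d t : ℕ), (∀ s, 0 ≤ b s) →
      structConst n a N p b d t ≠ 0 → Bounds n a N p b d t := by
  induction N using Nat.strong_induction_on with
  | _ N ih =>
  intro hN p b d t hb h
  rw [structConst, dif_neg (by omega), dif_pos hN] at h
  obtain ⟨P, -, h⟩ := Finset.exists_ne_zero_of_sum_ne_zero h
  obtain ⟨hP, h⟩ := ite_ne_right_iff.1 h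
  obtain ⟨p', -, h⟩ := Finset.exists_ne_zero_of_sum_ne_zero h
  obtain ⟨b', -, h⟩ := Finset.exists_ne_zero_of_sum_ne_zero h
  obtain ⟨τ, -, h⟩ := Finset.exists_ne_zero_of_sum_ne_zero h
  obtain ⟨d', hd', h⟩ := Finset.exists_ne_zero_of_sum_ne_zero h
  obtain ⟨e, he, h⟩ := Finset.exists_ne_zero_of_sum_ne_zero h
  obtain ⟨hS, h⟩ := ite_ne_right_iff.1 h
  obtain ⟨b'', hb1, hb2⟩ := exists_of_vertexFactor_ne_zero (right_ne_zero_of_mul h)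
  have hprod := Finset.prod_ne_zero_iff.1 (left_ne_zero_of_mul h)
  clear h
  have key : ∀ S : P.parts,
      (∑ s ∈ S.1, ((p s : ℕ) : ℤ)) + ((p' S : ℕ) : ℤ) - (∑ s ∈ S.1, b s) - b' S
          + (nu n a : ℤ) * (e S : ℤ) + (n : ℤ) * (τ S : ℤ) =
        (S.1.card : ℤ) * ((n : ℤ) - 2) + (2 + l) ∧
      ∑ s ∈ S.1, b s ≤ (S.1.card : ℤ) + (b'' S - 1) := by
    intro S
    have h1 := hprod S (Finset.mem_univ _)
    have h2 := hb2 S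
    have hpos : 1 ≤ S.1.card := Finset.card_pos.2 (P.nonempty_of_mem_parts S.2)
    have eb := sum_orderEmb S.1 b
    have ep := sum_orderEmb S.1 (fun s => ((p s : ℕ) : ℤ))
    obtain ⟨h3, h1⟩ := ite_ne_left_iff.1 h1
    have h4 : S.1.card + 1 < N := by
      by_contra h4
      simp [h4] at h1
    rw [dif_pos h4] at h1
    have h1 := Ne.symm h1
    obtain ⟨k1, k2, k3⟩ := block_bounds _ hpos _ _ _ _ (fun h5 =>
      ih _ h4 (by omega) _ _ _ _ (fun s => by
        refine Fin.lastCases ?_ (fun i => ?_) s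
        · rw [Fin.snoc_last]
          by_contra h7
          exact h3 ⟨by omega, h5⟩
        · rw [Fin.snoc_castSucc]
          exact hb _) h1) h1
    simp only [Fin.sum_univ_castSucc, Fin.snoc_castSucc, Fin.snoc_last, eb, ep] at k1 k2 k3
    refine ⟨by linarith, ?_⟩
    rcases Nat.lt_or_ge 1 S.1.card with h5 | h5
    · have h6 : 0 ≤ b' S := by by_contra h7; exact h3 ⟨by omega, h5⟩
      have := k2 h5
      linarith [Int.natCast_nonneg (b'' S)]
    · have := (k3 (by omega)).2
      have : (S.1.card : ℤ) = 1 := by exact_mod_cast (by omega : S.1.card = 1)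
      linarith
  have s1 := Finset.sum_congr (rfl : (Finset.univ : Finset P.parts) = _) fun S _ => (key S).1
  have s2 := Finset.sum_le_sum fun S (_ : S ∈ (Finset.univ : Finset P.parts)) => (key S).2
  have s3 := (Finset.mem_piAntidiag.1 he).1
  change ∑ i, e i = d - d' at s3
  rw [Finset.mem_range] at hd'
  have s4 : (∑ i, (e i : ℤ)) = (d : ℤ) - d' := by
    rw [← Nat.cast_sum, s3]
    omega
  have s5 : (∑ i, (b'' i : ℤ)) ≤ (P.parts.card : ℤ) - 3 := by
    rw [← Nat.cast_sum]
    rw [Fintype.card_coe] at hb1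
    omega
  have s6 : (∑ S : P.parts, (S.1.card : ℤ)) = N := by
    simpa using sum_parts P fun _ => 1
  unfold InS at hS
  simp only [Finset.sum_add_distrib, Finset.sum_sub_distrib, ← Finset.mul_sum, ← Finset.sum_mul,
    sum_parts, s4, s6, Finset.sum_const, Finset.card_univ, Fintype.card_coe, nsmul_eq_mul,
    mul_one] at s1 s2 hS
  refine ⟨by linarith, ?_⟩
  linear_combination s1 - hS

/-- In the recursion for the structure constants, a factor `c_{p|_S p', b|_S b'}^{(d,t)}` with
`|S| = k`, which is taken to be zero if `b' < 0` and `k ≥ 2`, can be nonzero only if `b'` and `t`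
lie in the ranges over which they are summed. -/
theorem mem_ranges_of_structConst_ne_zero {n l : ℕ} {a : Fin l → ℕ} (hn : 1 ≤ n) (hl : l ≤ n)
    (N k : ℕ) (hk : 1 ≤ k) (hkN : k + 1 < N) (q : Fin k → Fin n) (c : Fin k → ℤ)
    (hc : ∀ s, 0 ≤ c s) (p' : Fin n) (b' : ℤ) (hb' : ¬(b' < 0 ∧ 2 ≤ k)) (d t : ℕ)
    (h : structConst n a (k + 1) (Fin.snoc (α := fun _ => Fin n) q p')
      (Fin.snoc (α := fun _ => ℤ) c b') d t ≠ 0) :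
    b' ∈ Finset.Icc (-1 - ∑ s, |c s|) (N : ℤ) ∧ t ∈ Finset.range (N + 1) := by
  obtain ⟨k1, k2, k3⟩ := block_bounds _ hk _ _ _ _ (fun h5 =>
    structConst_bounds _ (by omega) _ _ _ _ (fun s => by
      refine Fin.lastCases ?_ (fun i => ?_) s
      · rw [Fin.snoc_last]
        by_contra h7
        exact hb' ⟨by omega, h5⟩
      · rw [Fin.snoc_castSucc]
        exact hc _) h) h
  simp only [Fin.sum_univ_castSucc, Fin.snoc_castSucc, Fin.snoc_last] at k1 k2 k3
  have e1 : ∑ s, |c s| = ∑ s, c s := Finset.sum_congr rfl fun s _ => abs_of_nonneg (hc s)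
  have e2 : 0 ≤ ∑ s, c s := Finset.sum_nonneg fun s _ => hc s
  have e3 : 0 ≤ ∑ s, ((q s : ℕ) : ℤ) := Finset.sum_nonneg fun s _ => by positivity
  have e4 : (0 : ℤ) ≤ (nu n a : ℤ) * d := by positivity
  have e5 : ∑ s, c s + b' ≤ (k : ℤ) - 2 := by
    rcases Nat.lt_or_ge 1 k with h5 | h5
    · exact k2 h5
    · have := (k3 (by omega)).2
      have : (k : ℤ) = 1 := by exact_mod_cast (by omega : k = 1)
      linarith
  have hkN' : (k : ℤ) + 1 < N := by exact_mod_cast hkN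
  rw [Finset.mem_Icc, Finset.mem_range, e1]
  refine ⟨⟨?_, by linarith⟩, ?_⟩
  · rcases Nat.lt_or_ge 1 k with h5 | h5
    · have h6 : 0 ≤ b' := by by_contra h7; exact hb' ⟨by omega, h5⟩
      linarith
    · have := (k3 (by omega)).2
      linarith
  · have hl' : (l : ℤ) ≤ n := by exact_mod_cast hl
    have hn' : (1 : ℤ) ≤ n := by exact_mod_cast hn
    have e6 : (n : ℤ) * t ≤ n * (k + 1) := by
      nlinarith [Int.natCast_nonneg (p' : ℕ), Int.natCast_nonneg k]
    have e7 : (t : ℤ) ≤ k + 1 := le_of_mul_le_mul_left e6 (by linarith)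
    omega

end GWStructure
end

/-!
The bound is proved by majorization, in the norms `‖f‖ = ∑_d |f_d| A^{-d}` on `ℚ[[q]]` for a
sufficiently large integer `A`.  These norms are submultiplicative, so that the recursion for the
structure constants becomes an inequality between the norms of generating functions in the degree.

*The series.*  The series `L` is algebraic and the series `I_c` come from hypergeometric series, so
they converge near `q = 0` (`convergent_seriesL`, `convergent_seriesI`).  The series `Φ_b` solve
first-order equations in which `D Φ_b`, where `D = q d/dq`, is expressed by derivatives of order at
most `k` of the earlier series `Φ_{b+1-k}`, `2 ≤ k ≤ n`.  Hence `Φ_b` is controlled by `b`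
derivatives, and its norm is at most `b!` times a geometric sequence in `b` (`gevrey_phi`,
`Gevrey.eventually_qnorm_le`).  The same holds for `Φ_{p;b}` (`gevrey_phiP`).

*The vertices.*  The factorials of the previous step are compensated by the factors `1/b''!` and
`1/(r+1)!` in the recursion.  Thus a vertex with `m` legs has norm at most `(m-3)! B^m` times a
product of weights, `(2A)^{β+1} (β+1)!` for a leg with `b' = β ≥ 0`, and `1/((8A)^β β!)` for a leg
with `b' = -1-β` (`qnorm_vertexFactor_le`).  On an edge of the recursion indices `β` and `-1-β`
meet, and the product of their weights is summable over `β` (`tsum_legWeight_mul_le`).  The weight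
of a marked point is that of a leg with `b' = -1-b_s`, which yields the factor `1/b_s!`.

*The recursion.*  What remains is a recursion over the set partitions of `k` points into at least
two blocks.  The number `k!` times `(K/M) M^k / k²` is a majorant: by the exponential formula
(`sum_prod_fiber_eq`) and the stability of `1/k²` under convolution (`sum_piAntidiag_inv_sq_le`), a
partition into `j` blocks yields a factor of order `M^{-j}` instead of `M^{-1}`, and `j ≥ 2`
(`sum_recursionPartitions_le`).  If `M` is large, the induction closes (`blockNorm_le`).  The
variable `t` causes no divergence, because the degrees determine it (`tsum_qnorm_vertexSeries_le`).
-/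

noncomputable section

open PowerSeries Filter
open scoped ENNReal NNReal Nat RatFunc

namespace GWStructure

/-! ### Weighted `ℓ¹` norms of power series -/

/-- The weighted `ℓ¹` norm `∑_d |f_d| v_d` of a power series, as an extended non-negative real, so
that no summability has to be known in advance. -/
def wnorm (v : ℕ → ℝ≥0∞) (f : PowerSeries ℚ) : ℝ≥0∞ := ∑' d, ‖coeff d f‖ₑ * v d

theorem wnorm_zero (v : ℕ → ℝ≥0∞) : wnorm v 0 = 0 := by simp [wnorm]

theorem wnorm_mono {v w : ℕ → ℝ≥0∞} (h : ∀ d, v d ≤ w d) (f : PowerSeries ℚ) :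
    wnorm v f ≤ wnorm w f :=
  ENNReal.tsum_le_tsum fun d => by gcongr; exact h d

theorem wnorm_mono_coeff (v : ℕ → ℝ≥0∞) {f g : PowerSeries ℚ}
    (h : ∀ d, ‖coeff d f‖ₑ ≤ ‖coeff d g‖ₑ) : wnorm v f ≤ wnorm v g :=
  ENNReal.tsum_le_tsum fun d => by gcongr; exact h d

theorem wnorm_mul_le {u v w : ℕ → ℝ≥0∞} (h : ∀ i j, w (i + j) ≤ u i * v j)
    (f g : PowerSeries ℚ) : wnorm w (f * g) ≤ wnorm u f * wnorm v g := by
  have h1 : wnorm u f * wnorm v g = ∑' d, ∑ x ∈ Finset.HasAntidiagonal.antidiagonal d,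
      (‖coeff x.1 f‖ₑ * u x.1) * (‖coeff x.2 g‖ₑ * v x.2) := by
    rw [wnorm, wnorm, ← ENNReal.tsum_mul_right]
    simp_rw [← ENNReal.tsum_mul_left]
    rw [← ENNReal.tsum_prod, ← Finset.HasAntidiagonal.sigmaAntidiagonalEquivProd.tsum_eq,
      ENNReal.tsum_sigma']
    refine tsum_congr fun d => ?_
    rw [tsum_fintype]
    exact Finset.sum_coe_sort (Finset.HasAntidiagonal.antidiagonal d) fun x : ℕ × ℕ =>
      (‖coeff x.1 f‖ₑ * u x.1) * (‖coeff x.2 g‖ₑ * v x.2)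
  rw [h1]
  refine ENNReal.tsum_le_tsum fun d => ?_
  rw [coeff_mul]
  refine (mul_le_mul_left (enorm_sum_le _ _) _).trans ?_
  rw [Finset.sum_mul]
  refine Finset.sum_le_sum fun x hx => ?_
  rw [← Finset.HasAntidiagonal.mem_antidiagonal.1 hx, enorm_mul]
  calc ‖coeff x.1 f‖ₑ * ‖coeff x.2 g‖ₑ * w (x.1 + x.2)
      ≤ ‖coeff x.1 f‖ₑ * ‖coeff x.2 g‖ₑ * (u x.1 * v x.2) := by gcongr; exact h _ _
    _ = _ := by ring

theorem wnorm_C_mul (v : ℕ → ℝ≥0∞) (c : ℚ) (f : PowerSeries ℚ) :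
    wnorm v (C c * f) = ‖c‖ₑ * wnorm v f := by
  rw [wnorm, wnorm, ← ENNReal.tsum_mul_left]
  simp [coeff_C_mul, enorm_mul, mul_assoc]

theorem wnorm_C (v : ℕ → ℝ≥0∞) (c : ℚ) : wnorm v (C c) = ‖c‖ₑ * v 0 := by
  rw [wnorm, tsum_eq_single 0]
  · simp
  · intro d hd
    simp [coeff_C, hd]

theorem wnorm_add_le (v : ℕ → ℝ≥0∞) (f g : PowerSeries ℚ) :
    wnorm v (f + g) ≤ wnorm v f + wnorm v g := by
  rw [wnorm, wnorm, wnorm, ← ENNReal.tsum_add]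
  refine ENNReal.tsum_le_tsum fun d => ?_
  rw [map_add, ← add_mul]
  gcongr
  exact enorm_add_le _ _

theorem wnorm_neg (v : ℕ → ℝ≥0∞) (f : PowerSeries ℚ) : wnorm v (-f) = wnorm v f := by
  simp [wnorm]

theorem wnorm_sub_le (v : ℕ → ℝ≥0∞) (f g : PowerSeries ℚ) :
    wnorm v (f - g) ≤ wnorm v f + wnorm v g := by
  rw [sub_eq_add_neg, ← wnorm_neg v g]
  exact wnorm_add_le _ _ _

theorem wnorm_sum_le (v : ℕ → ℝ≥0∞) {ι : Type*} (s : Finset ι) (f : ι → PowerSeries ℚ) :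
    wnorm v (∑ i ∈ s, f i) ≤ ∑ i ∈ s, wnorm v (f i) := by
  classical
  induction s using Finset.induction_on with
  | empty => simp [wnorm_zero]
  | insert i s hi ih =>
    rw [Finset.sum_insert hi, Finset.sum_insert hi]
    exact (wnorm_add_le _ _ _).trans (by gcongr)

theorem enorm_coeff_mul_le (v : ℕ → ℝ≥0∞) (f : PowerSeries ℚ) (d : ℕ) :
    ‖coeff d f‖ₑ * v d ≤ wnorm v f := ENNReal.le_tsum (f := fun d => ‖coeff d f‖ₑ * v d) d

theorem enorm_ratCast (x : ℚ) : ‖x‖ₑ = ENNReal.ofReal (|x| : ℚ) := by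
  rw [← ofReal_norm]
  simp [← Rat.norm_cast_real]

theorem enorm_natCast (n : ℕ) : ‖(n : ℚ)‖ₑ = n := by
  rw [enorm_ratCast]
  simp

/-- The truncation of a power series to degrees less than `D`. -/
def truncLT (D : ℕ) (f : PowerSeries ℚ) : PowerSeries ℚ := (trunc D f : Polynomial ℚ)

theorem coeff_truncLT (D d : ℕ) (f : PowerSeries ℚ) :
    coeff d (truncLT D f) = if d < D then coeff d f else 0 := by
  rw [truncLT, Polynomial.coeff_coe, coeff_trunc]

theorem wnorm_truncLT_le (v : ℕ → ℝ≥0∞) (D : ℕ) (f : PowerSeries ℚ) :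
    wnorm v (truncLT D f) ≤ wnorm v f := by
  refine wnorm_mono_coeff _ fun d => ?_
  rw [coeff_truncLT]
  split_ifs <;> simp

theorem wnorm_truncLT_ne_top {v : ℕ → ℝ≥0∞} (hv : ∀ d, v d ≠ ∞) (D : ℕ) (f : PowerSeries ℚ) :
    wnorm v (truncLT D f) ≠ ∞ := by
  rw [wnorm, tsum_eq_sum (s := Finset.range D)]
  · exact ENNReal.sum_ne_top.2 fun d _ => ENNReal.mul_ne_top (by simp) (hv d)
  · intro d hd
    rw [coeff_truncLT, if_neg (by simpa using hd)]
    simp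

/-- A bound for the norms of all truncations bounds the norm.  Absorption arguments apply to the
truncations, whose norms are finite. -/
theorem wnorm_le_of_truncLT {v : ℕ → ℝ≥0∞} {B : ℝ≥0∞} {f : PowerSeries ℚ}
    (h : ∀ D, wnorm v (truncLT D f) ≤ B) : wnorm v f ≤ B := by
  rw [wnorm, ENNReal.tsum_eq_iSup_nat]
  refine iSup_le fun D => le_trans ?_ (h D)
  refine le_trans (le_of_eq (Finset.sum_congr rfl fun d hd => ?_))
    (ENNReal.sum_le_tsum (f := fun d => ‖coeff d (truncLT D f)‖ₑ * v d) (Finset.range D))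
  rw [coeff_truncLT, if_pos (by simpa using hd)]

/-- The product to order `D` depends on one factor to order `D` only. -/
theorem truncLT_mul (D : ℕ) (u f : PowerSeries ℚ) :
    truncLT D (u * truncLT D f) = truncLT D (u * f) := by
  ext d
  rw [coeff_truncLT, coeff_truncLT]
  split_ifs with hd
  · rw [coeff_mul, coeff_mul]
    refine Finset.sum_congr rfl fun x hx => ?_
    rw [coeff_truncLT, if_pos]
    have := Finset.HasAntidiagonal.mem_antidiagonal.1 hx
    omega
  · rfl

theorem truncLT_add (D : ℕ) (f g : PowerSeries ℚ) :
    truncLT D (f + g) = truncLT D f + truncLT D g := by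
  ext d
  simp only [map_add, coeff_truncLT]
  split_ifs <;> simp

/-- Absorption of a term on the right; it needs the finiteness of `x`. -/
theorem le_two_mul_of_le_add_half {x K : ℝ≥0∞} (hx : x ≠ ∞) (h : x ≤ K + 2⁻¹ * x) :
    x ≤ 2 * K := by
  by_cases hK : K = ∞
  · simp [hK]
  lift x to ℝ≥0 using hx
  lift K to ℝ≥0 using hK
  have h4 : (x : ℝ≥0∞) ≤ ((K + 2⁻¹ * x : ℝ≥0) : ℝ≥0∞) := by
    rw [ENNReal.coe_add, ENNReal.coe_mul, ENNReal.coe_inv (by norm_num)]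
    simpa using h
  have h5 : x ≤ K + 2⁻¹ * x := by exact_mod_cast h4
  have h6 : (x : ℝ) ≤ K + 2⁻¹ * x := by exact_mod_cast h5
  have h7 : x ≤ 2 * K := by
    rw [← NNReal.coe_le_coe]
    push_cast
    linarith
  exact_mod_cast h7

/-- The norm `∑_d |f_d| ρ^d`. -/
def qnorm (ρ : ℝ≥0∞) (f : PowerSeries ℚ) : ℝ≥0∞ := wnorm (fun d => ρ ^ d) f

theorem qnorm_mul_le (ρ : ℝ≥0∞) (f g : PowerSeries ℚ) :
    qnorm ρ (f * g) ≤ qnorm ρ f * qnorm ρ g :=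
  wnorm_mul_le (fun i j => (pow_add ρ i j).le) f g

theorem qnorm_C (ρ : ℝ≥0∞) (c : ℚ) : qnorm ρ (C c) = ‖c‖ₑ := by
  rw [qnorm, wnorm_C, pow_zero, mul_one]

theorem qnorm_one (ρ : ℝ≥0∞) : qnorm ρ 1 = 1 := by
  simpa using qnorm_C ρ 1

theorem qnorm_X_mul (ρ : ℝ≥0∞) (f : PowerSeries ℚ) : qnorm ρ (X * f) = ρ * qnorm ρ f := by
  rw [qnorm, wnorm, tsum_eq_zero_add' ENNReal.summable, qnorm, wnorm, ← ENNReal.tsum_mul_left]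
  simp only [coeff_zero_X_mul, enorm_zero, zero_mul, zero_add, coeff_succ_X_mul]
  exact tsum_congr fun d => by ring

theorem qnorm_prod_le (ρ : ℝ≥0∞) {ι : Type*} (s : Finset ι) (f : ι → PowerSeries ℚ) :
    qnorm ρ (∏ i ∈ s, f i) ≤ ∏ i ∈ s, qnorm ρ (f i) := by
  classical
  induction s using Finset.induction_on with
  | empty => simp [qnorm_one]
  | insert i s hi ih =>
    rw [Finset.prod_insert hi, Finset.prod_insert hi]
    exact (qnorm_mul_le _ _ _).trans (by gcongr)

theorem qnorm_pow_le (ρ : ℝ≥0∞) (f : PowerSeries ℚ) (k : ℕ) :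
    qnorm ρ (f ^ k) ≤ qnorm ρ f ^ k := by
  simpa using qnorm_prod_le ρ (Finset.range k) fun _ => f

theorem qnorm_mono {ρ σ : ℝ≥0∞} (h : ρ ≤ σ) (f : PowerSeries ℚ) : qnorm ρ f ≤ qnorm σ f :=
  wnorm_mono (fun d => by gcongr) f

/-- A power series `f` with `f = 1 + u f` and `‖u‖ ≤ 1/2` has norm at most `2`. -/
theorem qnorm_le_two {ρ : ℝ≥0∞} (hρ : ρ ≠ ∞) {f u : PowerSeries ℚ} (hu : qnorm ρ u ≤ 2⁻¹)
    (h : f = 1 + u * f) : qnorm ρ f ≤ 2 := by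
  refine wnorm_le_of_truncLT fun D => ?_
  have h1 : truncLT D f = truncLT D 1 + truncLT D (u * truncLT D f) := by
    conv_lhs => rw [h]
    rw [truncLT_mul, truncLT_add]
  have h2 : qnorm ρ (truncLT D f) ≤ 1 + 2⁻¹ * qnorm ρ (truncLT D f) := by
    conv_lhs => rw [h1]
    refine (wnorm_add_le _ _ _).trans (add_le_add ?_ ?_)
    · exact (wnorm_truncLT_le _ _ _).trans (qnorm_one ρ).le
    · exact (wnorm_truncLT_le _ _ _).trans ((qnorm_mul_le _ _ _).trans (by gcongr))
  simpa using le_two_mul_of_le_add_half (wnorm_truncLT_ne_top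
      (fun d => ENNReal.pow_ne_top hρ) D f) h2

/-! ### Convergent power series -/

/-- A power series with positive radius of convergence: the norm `∑_d |f_d| A^{-d}` is finite for
all sufficiently large natural numbers `A`. -/
def Convergent (f : PowerSeries ℚ) : Prop := ∀ᶠ A : ℕ in atTop, qnorm (A : ℝ≥0∞)⁻¹ f ≠ ∞

theorem convergent_of_exists {f : PowerSeries ℚ} {ρ : ℝ≥0∞} (hρ : ρ ≠ 0) (h : qnorm ρ f ≠ ∞) :
    Convergent f := by
  obtain ⟨A, hA⟩ := ENNReal.exists_inv_nat_lt hρ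
  filter_upwards [eventually_ge_atTop A] with B hB
  refine ne_top_of_le_ne_top h (qnorm_mono (le_trans ?_ hA.le) f)
  gcongr

namespace Convergent

theorem const (c : ℚ) : Convergent (C c) := Eventually.of_forall fun A => by
  rw [qnorm_C]
  exact enorm_ne_top

theorem one : Convergent 1 := by simpa using const 1

theorem zero : Convergent 0 := by simpa using const 0

variable {f g : PowerSeries ℚ}

theorem add (hf : Convergent f) (hg : Convergent g) : Convergent (f + g) := by
  filter_upwards [hf, hg] with A h1 h2
  exact ne_top_of_le_ne_top (ENNReal.add_ne_top.2 ⟨h1, h2⟩) (wnorm_add_le _ _ _)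

theorem neg (hf : Convergent f) : Convergent (-f) := by
  filter_upwards [hf] with A h1
  rwa [qnorm, wnorm_neg]

theorem sub (hf : Convergent f) (hg : Convergent g) : Convergent (f - g) := by
  rw [sub_eq_add_neg]
  exact hf.add hg.neg

theorem mul (hf : Convergent f) (hg : Convergent g) : Convergent (f * g) := by
  filter_upwards [hf, hg] with A h1 h2
  exact ne_top_of_le_ne_top (ENNReal.mul_ne_top h1 h2) (qnorm_mul_le _ _ _)

theorem pow (hf : Convergent f) (k : ℕ) : Convergent (f ^ k) := by
  induction k with
  | zero => simpa using one
  | succ k ih => rw [pow_succ]; exact ih.mul hf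

theorem sum {ι : Type*} (s : Finset ι) {F : ι → PowerSeries ℚ} (h : ∀ i ∈ s, Convergent (F i)) :
    Convergent (∑ i ∈ s, F i) := Finset.sum_induction _ _ (fun _ _ => add) zero h

theorem X : Convergent X := by
  filter_upwards [eventually_ne_atTop 0] with A hA
  rw [← mul_one PowerSeries.X, qnorm_X_mul, qnorm_one]
  simpa using hA

theorem aeval (hf : Convergent f) (p : Polynomial ℚ) : Convergent (Polynomial.aeval f p) := by
  induction p using Polynomial.induction_on' with
  | add p q hp hq => rw [map_add]; exact hp.add hq
  | monomial k c =>
    rw [Polynomial.aeval_monomial]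
    exact (const c).mul (hf.pow k)

theorem of_X_mul (h : Convergent (PowerSeries.X * f)) : Convergent f := by
  filter_upwards [h] with A hA
  rw [qnorm_X_mul] at hA
  intro h
  rw [h, ENNReal.mul_top] at hA
  · exact hA rfl
  · simp

/-- The norm of a convergent power series without constant term tends to zero with the radius. -/
theorem eventually_le (hf : Convergent f) (h0 : constantCoeff f = 0) {ε : ℝ≥0∞} (hε : ε ≠ 0) :
    ∀ᶠ A : ℕ in atTop, qnorm (A : ℝ≥0∞)⁻¹ f ≤ ε := by
  obtain ⟨v, rfl⟩ := X_dvd_iff.2 h0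
  obtain ⟨A, hA⟩ := hf.of_X_mul.exists
  by_cases hv : qnorm (A : ℝ≥0∞)⁻¹ v = 0
  · filter_upwards [eventually_ge_atTop A] with B hB
    have : qnorm (B : ℝ≥0∞)⁻¹ v ≤ 0 := hv ▸ qnorm_mono (by gcongr) v
    rw [qnorm_X_mul, nonpos_iff_eq_zero.1 this]
    simp
  obtain ⟨M, hM⟩ := ENNReal.exists_inv_nat_lt (ENNReal.div_pos hε hA).ne'
  filter_upwards [eventually_ge_atTop A, eventually_ge_atTop M] with B h1 h2
  rw [qnorm_X_mul]
  calc (B : ℝ≥0∞)⁻¹ * qnorm (B : ℝ≥0∞)⁻¹ v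
      ≤ (M : ℝ≥0∞)⁻¹ * qnorm (A : ℝ≥0∞)⁻¹ v := by
        gcongr
        exact qnorm_mono (by gcongr) v
    _ ≤ (ε / qnorm (A : ℝ≥0∞)⁻¹ v) * qnorm (A : ℝ≥0∞)⁻¹ v := by gcongr
    _ = ε := ENNReal.div_mul_cancel hv hA

theorem inv (hf : Convergent f) : Convergent f⁻¹ := by
  by_cases h0 : constantCoeff f = 0
  · rw [PowerSeries.inv_eq_zero.2 h0]
    exact zero
  set c := constantCoeff f with hc
  have hu0 : constantCoeff (1 - C c⁻¹ * f) = 0 := by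
    simp [← hc, h0]
  have hu : Convergent (1 - C c⁻¹ * f) := one.sub ((const _).mul hf)
  have hg : Convergent (C c * f⁻¹) := by
    filter_upwards [hu.eventually_le hu0 (ε := 2⁻¹) (by simp), eventually_ne_atTop 0] with A hA hA0
    refine ne_top_of_le_ne_top (by simp) (qnorm_le_two (by simpa using hA0) hA ?_)
    have e1 : f * f⁻¹ = 1 := PowerSeries.mul_inv_cancel _ h0
    have e2 : (C c⁻¹ : PowerSeries ℚ) * C c = 1 := by
      rw [← map_mul, inv_mul_cancel₀ h0, map_one]
    linear_combination (C c⁻¹ * C c) * e1 + e2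
  have : f⁻¹ = C c⁻¹ * (C c * f⁻¹) := by
    rw [← mul_assoc, ← map_mul, inv_mul_cancel₀ h0, map_one, one_mul]
  rw [this]
  exact (const _).mul hg

theorem qD (hf : Convergent f) : Convergent (qD f) := by
  obtain ⟨A, hA⟩ := hf.exists
  refine convergent_of_exists (ρ := (A : ℝ≥0∞)⁻¹ * 2⁻¹) (by simp) (ne_top_of_le_ne_top hA ?_)
  refine ENNReal.tsum_le_tsum fun d => ?_
  have h2 : (d : ℝ≥0∞) * 2⁻¹ ^ d ≤ 1 := by
    rw [← ENNReal.inv_pow]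
    refine (ENNReal.mul_inv_le_iff (by simp) (by simp)).2 ?_
    rw [one_mul]
    exact_mod_cast Nat.lt_two_pow_self.le
  rw [GWStructure.qD, coeff_mk, enorm_mul, enorm_natCast]
  dsimp only
  rw [mul_pow]
  calc (d : ℝ≥0∞) * ‖coeff d f‖ₑ * ((A : ℝ≥0∞)⁻¹ ^ d * 2⁻¹ ^ d)
      = ‖coeff d f‖ₑ * (A : ℝ≥0∞)⁻¹ ^ d * (d * 2⁻¹ ^ d) := by ring
    _ ≤ ‖coeff d f‖ₑ * (A : ℝ≥0∞)⁻¹ ^ d * 1 := by gcongr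
    _ = _ := mul_one _

theorem evalAt (hf : Convergent f) (r : RatFunc ℚ) : Convergent (evalAt r f) :=
  (hf.aeval _).mul (hf.aeval _).inv

end Convergent

/-! ### The algebraic series `L` converges -/

/-- For series without constant term, a power with exponent at least two is determined to order
`D + 1` by the series to order `D`. -/
theorem X_pow_dvd_pow_sub_pow {u v : PowerSeries ℚ} {D : ℕ} (hu : X ∣ u) (hv : X ∣ v)
    (h : X ^ D ∣ u - v) (m : ℕ) : X ^ (D + 1) ∣ u ^ (m + 2) - v ^ (m + 2) := by
  have e : u ^ (m + 2) - v ^ (m + 2) =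
      (u ^ (m + 1) - v ^ (m + 1)) * u + (u - v) * v ^ (m + 1) := by ring
  rw [e, pow_succ X D]
  exact dvd_add (mul_dvd_mul (h.trans (sub_dvd_pow_sub_pow u v (m + 1))) hu)
    (mul_dvd_mul h (dvd_pow hv (by omega)))

theorem X_pow_dvd_sub_truncLT (D : ℕ) (u : PowerSeries ℚ) : X ^ D ∣ u - truncLT D u := by
  rw [X_pow_dvd_iff]
  intro m hm
  rw [map_sub, coeff_truncLT, if_pos hm, sub_self]

theorem truncLT_congr {D : ℕ} {f g : PowerSeries ℚ} (h : X ^ D ∣ f - g) :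
    truncLT D f = truncLT D g := by
  rw [X_pow_dvd_iff] at h
  ext d
  rw [coeff_truncLT, coeff_truncLT]
  split_ifs with hd
  · have := h d hd
    rwa [map_sub, sub_eq_zero] at this
  · rfl

/-- A solution of `(1 + u)^n - c q (1 + u)^k = 1` without constant term converges.  The equation
reads `n u = c q (1 + u)^k - ∑_{j ≥ 2} (n choose j) u^j`, and it bounds the norm of a truncation
of `u` by means of the norm of the previous one. -/
theorem convergent_of_pow_eq {n k : ℕ} (hn : 1 ≤ n) (c : ℕ) {u : PowerSeries ℚ} (h0 : X ∣ u)
    (hu : (1 + u) ^ n - C (c : ℚ) * X * (1 + u) ^ k = 1) : Convergent u := by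
  obtain ⟨m, rfl⟩ : ∃ m, n = m + 1 := ⟨n - 1, by omega⟩
  set s : PowerSeries ℚ → PowerSeries ℚ := fun v =>
    ∑ i ∈ Finset.range m, C ((m + 1).choose (i + 2) : ℚ) * v ^ (i + 2) with hs
  set T : PowerSeries ℚ → PowerSeries ℚ := fun v => X * (C (c : ℚ) * (1 + v) ^ k) - s v with hT
  have key : C ((m + 1 : ℕ) : ℚ) * u = T u := by
    have e : (1 + u) ^ (m + 1) = s u + C ((m + 1 : ℕ) : ℚ) * u + 1 := by
      rw [add_comm 1 u, add_pow, Finset.sum_range_succ', Finset.sum_range_succ']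
      simp [hs, mul_comm]
    rw [hT]
    dsimp only
    linear_combination hu - e
  -- For `‖v‖ ≤ ε`, the terms with `j ≥ 2` are at most `2^{m+1} ε² = ε/2`, and `ρ` is so small that
  -- the term with the factor `q` is at most `ε/2`, too.
  set ε : ℝ≥0∞ := (2 ^ (m + 2))⁻¹ with hε
  set ρ : ℝ≥0∞ := ((c + 1) * 2 ^ k * 2 ^ (m + 3))⁻¹ with hρ
  have hρ1 : ρ ≠ ∞ := by simp [hρ]
  have hρ0 : ρ ≠ 0 := by
    rw [hρ, ENNReal.inv_ne_zero]
    exact ENNReal.mul_ne_top (ENNReal.mul_ne_top (by simp) (by simp)) (by simp)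
  have hε1 : ε ≤ 1 := by
    rw [hε, ENNReal.inv_le_one]
    exact one_le_pow₀ (by norm_num)
  have two_half : ∀ j : ℕ, (2 : ℝ≥0∞) ^ j * (2 ^ (j + 1))⁻¹ = 2⁻¹ := fun j => by
    rw [pow_succ, ENNReal.mul_inv (by simp) (by simp), ← mul_assoc,
      ENNReal.mul_inv_cancel (by simp) (by simp), one_mul]
  have hbound : ∀ v, qnorm ρ v ≤ ε → qnorm ρ (T v) ≤ ε := by
    intro v hv
    have h1 : qnorm ρ (X * (C (c : ℚ) * (1 + v) ^ k)) ≤ 2⁻¹ * ε := by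
      have h2 : qnorm ρ (1 + v) ≤ 2 := (wnorm_add_le _ _ _).trans
        ((add_le_add (qnorm_one ρ).le (hv.trans hε1)).trans (by norm_num))
      have h3 : qnorm ρ (C (c : ℚ) * (1 + v) ^ k) ≤ (c + 1) * 2 ^ k := by
        refine (qnorm_mul_le _ _ _).trans ?_
        rw [qnorm_C, enorm_natCast]
        gcongr
        · exact le_self_add
        · exact (qnorm_pow_le _ _ _).trans (by gcongr)
      rw [qnorm_X_mul]
      calc ρ * _ ≤ ρ * ((c + 1) * 2 ^ k) := by gcongr
        _ = (2 ^ (m + 3))⁻¹ := by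
          rw [hρ, ENNReal.mul_inv (by simp) (by simp), mul_right_comm, ENNReal.inv_mul_cancel,
            one_mul]
          · simp
          · exact ENNReal.mul_ne_top (by simp) (by simp)
        _ = 2⁻¹ * ε := by
          rw [hε, ← ENNReal.mul_inv (by simp) (by simp), ← pow_succ']
    have h4 : qnorm ρ (s v) ≤ 2⁻¹ * ε := by
      refine (wnorm_sum_le _ _ _).trans ?_
      calc ∑ i ∈ Finset.range m, wnorm (fun d => ρ ^ d) (C ((m + 1).choose (i + 2) : ℚ) * v ^
          (i + 2))
          ≤ ∑ i ∈ Finset.range m, ((m + 1).choose (i + 2) : ℝ≥0∞) * ε ^ 2 := by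
            refine Finset.sum_le_sum fun i _ => ?_
            rw [wnorm_C_mul, enorm_natCast]
            gcongr
            refine (qnorm_pow_le _ _ _).trans ?_
            calc qnorm ρ v ^ (i + 2) ≤ ε ^ (i + 2) := by gcongr
              _ ≤ ε ^ 2 := pow_le_pow_right_of_le_one' hε1 (by omega)
        _ = ((∑ i ∈ Finset.range m, (m + 1).choose (i + 2) : ℕ) : ℝ≥0∞) * ε ^ 2 := by
            rw [← Finset.sum_mul, Nat.cast_sum]
        _ ≤ (2 ^ (m + 1) : ℝ≥0∞) * ε ^ 2 := by
            gcongr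
            have := Nat.sum_range_choose (m + 1)
            rw [Finset.sum_range_succ', Finset.sum_range_succ'] at this
            have h5 : ∑ i ∈ Finset.range m, (m + 1).choose (i + 2) ≤ 2 ^ (m + 1) := by
              rw [← this]
              exact (Nat.le_add_right _ _).trans (Nat.le_add_right _ _)
            exact_mod_cast h5
        _ = 2⁻¹ * ε := by
            rw [pow_two, ← mul_assoc]
            congr 1
            rw [hε]
            exact two_half (m + 1)
    refine (wnorm_sub_le _ _ _).trans ((add_le_add h1 h4).trans ?_)
    rw [← add_mul, ENNReal.inv_two_add_inv_two, one_mul]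
  refine convergent_of_exists hρ0 (ne_top_of_le_ne_top (ne_top_of_le_ne_top (by simp) hε1)
    (wnorm_le_of_truncLT (B := ε) fun D => ?_))
  -- the coefficient of degree `D` of the equation involves only those of lower degree on the right
  rcases Nat.eq_zero_or_pos D with rfl | hD
  · rw [show truncLT 0 u = 0 by ext d; simp [coeff_truncLT], wnorm_zero]
    exact zero_le
  induction D, hD using Nat.le_induction with
  | base =>
    rw [show truncLT (0 + 1) u = 0 by
      ext d
      rw [coeff_truncLT]
      split_ifs with hd
      · rw [show d = 0 by omega, coeff_zero_eq_constantCoeff_apply, X_dvd_iff.1 h0, map_zero]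
      · simp, wnorm_zero]
    exact zero_le
  | succ D hD ih =>
    have hdvd := X_pow_dvd_sub_truncLT D u
    have hX : X ∣ truncLT D u := by
      rw [X_dvd_iff, ← coeff_zero_eq_constantCoeff_apply, coeff_truncLT]
      simp [X_dvd_iff.1 h0]
    have e : truncLT (D + 1) (C ((m + 1 : ℕ) : ℚ) * u) = truncLT (D + 1) (T (truncLT D u)) := by
      rw [key]
      refine truncLT_congr ?_
      have e2 : T u - T (truncLT D u) =
          C (c : ℚ) * (X * ((1 + u) ^ k - (1 + truncLT D u) ^ k)) - (s u - s (truncLT D u)) := by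
        rw [hT]
        ring
      rw [e2, hs]
      dsimp only
      rw [← Finset.sum_sub_distrib]
      refine dvd_sub (Dvd.dvd.mul_left ?_ _) (Finset.dvd_sum fun i _ => ?_)
      · rw [pow_succ']
        refine mul_dvd_mul_left _ (dvd_trans ?_ (sub_dvd_pow_sub_pow _ _ k))
        rwa [add_sub_add_left_eq_sub]
      · rw [← mul_sub]
        exact (X_pow_dvd_pow_sub_pow h0 hX hdvd i).mul_left _
    calc wnorm (fun d => ρ ^ d) (truncLT (D + 1) u)
        ≤ wnorm (fun d => ρ ^ d) (truncLT (D + 1) (C ((m + 1 : ℕ) : ℚ) * u)) := by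
          refine wnorm_mono_coeff _ fun d => ?_
          rw [coeff_truncLT, coeff_truncLT, coeff_C_mul]
          split_ifs
          · rw [enorm_mul, enorm_natCast]
            exact le_mul_of_one_le_left' (by exact_mod_cast (by omega : 1 ≤ m + 1))
          · simp
      _ ≤ ε := by
          rw [e]
          exact (wnorm_truncLT_le _ _ _).trans (hbound _ ih)

theorem convergent_seriesL {n l : ℕ} {a : Fin l → ℕ} (hn : 1 ≤ n) (ha : absDeg a ≤ n) :
    Convergent (seriesL n a) := by
  obtain ⟨h1, h2⟩ := isL_seriesL hn ha
  have h3 : X ∣ seriesL n a - 1 := X_dvd_iff.2 (by simp [h1])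
  have := (convergent_of_pow_eq hn (selfPow a) (k := absDeg a) h3
      (by simpa using h2)).add Convergent.one
  simpa using this

theorem convergent_opLCoeff {n l : ℕ} {a : Fin l → ℕ} (hn : 1 ≤ n) (ha : absDeg a ≤ n) (k i : ℕ) :
    Convergent (opLCoeff n a k i) := by
  have hL := (convergent_seriesL hn ha).pow n
  exact (((Convergent.const _).mul hL).mul (hL.evalAt _)).sub ((hL.sub Convergent.one).mul
    (Convergent.sum _ fun r _ => (Convergent.const _).mul (hL.evalAt _)))

/-! ### Gevrey bounds -/

/-- The weight `ρ^d / (d+1)^b`. -/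
def gwt (ρ : ℝ≥0∞) (b d : ℕ) : ℝ≥0∞ := ρ ^ d * ((d + 1 : ℕ) : ℝ≥0∞)⁻¹ ^ b

theorem inv_succ_le_one (d : ℕ) : ((d + 1 : ℕ) : ℝ≥0∞)⁻¹ ≤ 1 := by
  rw [ENNReal.inv_le_one]
  exact_mod_cast Nat.succ_pos d

theorem gwt_ne_top {ρ : ℝ≥0∞} (hρ : ρ ≠ ∞) (b d : ℕ) : gwt ρ b d ≠ ∞ :=
  ENNReal.mul_ne_top (ENNReal.pow_ne_top hρ)
    (ENNReal.pow_ne_top (ne_top_of_le_ne_top (by simp) (inv_succ_le_one d)))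

theorem gwt_anti (ρ : ℝ≥0∞) {b b' : ℕ} (h : b ≤ b') (d : ℕ) : gwt ρ b' d ≤ gwt ρ b d := by
  unfold gwt
  gcongr 1
  exact pow_le_pow_right_of_le_one' (inv_succ_le_one d) h

/-- The norm `∑_d |f_d| ρ^d / (d+1)^b`, for which `b` derivatives `q d/dq` are bounded. -/
def gnorm (ρ : ℝ≥0∞) (b : ℕ) (f : PowerSeries ℚ) : ℝ≥0∞ := wnorm (gwt ρ b) f

/-- Multiplication by a convergent series is bounded, since `(d+1)^{-b}` decreases in `d`. -/
theorem gnorm_mul_le (ρ : ℝ≥0∞) (b : ℕ) (f g : PowerSeries ℚ) :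
    gnorm ρ b (f * g) ≤ qnorm ρ f * gnorm ρ b g := by
  refine wnorm_mul_le (fun i j => ?_) f g
  unfold gwt
  rw [pow_add, mul_assoc]
  gcongr
  omega

theorem gnorm_anti (ρ : ℝ≥0∞) {b b' : ℕ} (h : b ≤ b') (f : PowerSeries ℚ) :
    gnorm ρ b' f ≤ gnorm ρ b f := wnorm_mono (gwt_anti ρ h) f

theorem gnorm_le_qnorm (ρ : ℝ≥0∞) (b : ℕ) (f : PowerSeries ℚ) : gnorm ρ b f ≤ qnorm ρ f :=
  wnorm_mono (fun d => (gwt_anti ρ (Nat.zero_le b) d).trans (by simp [gwt])) f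

theorem gnorm_qD_le (ρ : ℝ≥0∞) (b : ℕ) (f : PowerSeries ℚ) :
    gnorm ρ (b + 1) (qD f) ≤ gnorm ρ b f := by
  refine ENNReal.tsum_le_tsum fun d => ?_
  rw [qD, coeff_mk, enorm_mul, enorm_natCast, gwt, gwt]
  have h : (d : ℝ≥0∞) * ((d + 1 : ℕ) : ℝ≥0∞)⁻¹ ≤ 1 := by
    rw [← div_eq_mul_inv]
    refine ENNReal.div_le_of_le_mul ?_
    rw [one_mul]
    exact_mod_cast Nat.le_succ d
  calc _ = ‖coeff d f‖ₑ * (ρ ^ d * ((d + 1 : ℕ) : ℝ≥0∞)⁻¹ ^ b) *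
        (d * ((d + 1 : ℕ) : ℝ≥0∞)⁻¹) := by ring
    _ ≤ ‖coeff d f‖ₑ * (ρ ^ d * ((d + 1 : ℕ) : ℝ≥0∞)⁻¹ ^ b) * 1 := by gcongr
    _ = _ := mul_one _

theorem gnorm_qD_iterate_le (ρ : ℝ≥0∞) (b i : ℕ) (f : PowerSeries ℚ) :
    gnorm ρ (b + i) (qD^[i] f) ≤ gnorm ρ b f := by
  induction i with
  | zero => rfl
  | succ i ih =>
    rw [Function.iterate_succ_apply']
    exact (gnorm_qD_le ρ (b + i) _).trans ih

/-- For `d ≥ 1`, the operator `q d/dq` is the multiplication by `d ≥ (d + 1)/2`. -/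
theorem gnorm_le_add_qD (ρ : ℝ≥0∞) (b : ℕ) (f : PowerSeries ℚ) :
    gnorm ρ b f ≤ ‖constantCoeff f‖ₑ + 2 * gnorm ρ (b + 1) (qD f) := by
  have h0 : (‖constantCoeff f‖ₑ : ℝ≥0∞) = ∑' d, if d = 0 then ‖constantCoeff f‖ₑ else 0 := by
    rw [tsum_ite_eq]
  rw [h0, gnorm, gnorm, wnorm, wnorm, ← ENNReal.tsum_mul_left, ← ENNReal.tsum_add]
  refine ENNReal.tsum_le_tsum fun d => ?_
  rcases Nat.eq_zero_or_pos d with rfl | hd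
  · simp [gwt]
  · rw [if_neg hd.ne', zero_add, qD, coeff_mk, enorm_mul, enorm_natCast, gwt, gwt, pow_succ]
    have h : 1 ≤ 2 * ((d : ℝ≥0∞) * ((d + 1 : ℕ) : ℝ≥0∞)⁻¹) := by
      rw [← mul_assoc, ← div_eq_mul_inv, ENNReal.le_div_iff_mul_le (by simp) (by simp), one_mul]
      exact_mod_cast (by omega : d + 1 ≤ 2 * d)
    calc _ = ‖coeff d f‖ₑ * (ρ ^ d * ((d + 1 : ℕ) : ℝ≥0∞)⁻¹ ^ b) * 1 := (mul_one _).symm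
      _ ≤ ‖coeff d f‖ₑ * (ρ ^ d * ((d + 1 : ℕ) : ℝ≥0∞)⁻¹ ^ b) *
        (2 * ((d : ℝ≥0∞) * ((d + 1 : ℕ) : ℝ≥0∞)⁻¹)) := by gcongr
      _ = _ := by ring

/-- A sequence of power series `f_b` of Gevrey type: for all small `ρ = 1/A` there is `K` such that
`∑_d |f_{b,d}| ρ^d / (d+1)^b ≤ K^{b+1}` for all `b`.  It implies that `‖f_b‖_ρ` grows at most like
`b!` times a geometric sequence, see `Gevrey.eventually_qnorm_le`. -/
def Gevrey (f : ℕ → PowerSeries ℚ) : Prop :=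
  ∀ᶠ A : ℕ in atTop, ∃ K : ℕ, 1 ≤ K ∧ ∀ b, gnorm (A : ℝ≥0∞)⁻¹ b (f b) ≤ (K : ℝ≥0∞) ^ (b + 1)

theorem exists_natCast_ge {x : ℝ≥0∞} (hx : x ≠ ∞) : ∃ K : ℕ, 1 ≤ K ∧ x ≤ K := by
  obtain ⟨K, hK⟩ := ENNReal.exists_nat_gt hx
  refine ⟨K + 1, by omega, hK.le.trans ?_⟩
  push_cast
  exact le_self_add

namespace Gevrey

theorem of_convergent {g : PowerSeries ℚ} (hg : Convergent g) : Gevrey fun _ => g := by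
  filter_upwards [hg] with A hA
  obtain ⟨K, hK, h⟩ := exists_natCast_ge hA
  refine ⟨K, hK, fun b => (gnorm_le_qnorm _ _ _).trans (h.trans ?_)⟩
  exact le_self_pow₀ (by exact_mod_cast hK) (by omega)

theorem zero : Gevrey fun _ => 0 := of_convergent Convergent.zero

variable {f g h : ℕ → PowerSeries ℚ}

theorem add (hf : Gevrey f) (hg : Gevrey g) : Gevrey fun b => f b + g b := by
  filter_upwards [hf, hg] with A ⟨K, hK, h1⟩ ⟨M, hM, h2⟩
  refine ⟨K + M, by omega, fun b => (wnorm_add_le _ _ _).trans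
      ((add_le_add (h1 b) (h2 b)).trans ?_)⟩
  push_cast
  exact pow_add_pow_le zero_le zero_le (by omega)

theorem convergent_mul {u : PowerSeries ℚ} (hu : Convergent u) (hf : Gevrey f) : Gevrey fun b => u *
    f b := by
  filter_upwards [hu, hf] with A hA ⟨K, hK, h1⟩
  obtain ⟨U, hU, h⟩ := exists_natCast_ge hA
  refine ⟨U * K, Nat.mul_pos hU hK, fun b => (gnorm_mul_le _ _ _ _).trans ?_⟩
  calc _ ≤ (U : ℝ≥0∞) * (K : ℝ≥0∞) ^ (b + 1) := by gcongr; exact h1 b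
    _ ≤ (U : ℝ≥0∞) ^ (b + 1) * (K : ℝ≥0∞) ^ (b + 1) := by
      gcongr
      exact le_self_pow₀ (by exact_mod_cast hU) (by omega)
    _ = _ := by rw [← mul_pow, Nat.cast_mul]

theorem sum {ι : Type*} (s : Finset ι) {F : ι → ℕ → PowerSeries ℚ} (h : ∀ i ∈ s, Gevrey (F i)) :
    Gevrey fun b => ∑ i ∈ s, F i b := by
  classical
  induction s using Finset.induction_on with
  | empty => simpa using zero
  | insert i s hi ih =>
    simp only [Finset.sum_insert hi]
    exact (h i (Finset.mem_insert_self _ _)).add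
      (ih fun j hj => h j (Finset.mem_insert_of_mem hj))

/-- The index may be shifted upwards, by setting the first terms equal to zero. -/
theorem shift (hf : Gevrey f) (k : ℕ) : Gevrey fun b => if k ≤ b then f (b - k) else 0 := by
  filter_upwards [hf] with A ⟨K, hK, h1⟩
  refine ⟨K, hK, fun b => ?_⟩
  split_ifs with h
  · refine (gnorm_anti _ (Nat.sub_le b k) _).trans ((h1 _).trans ?_)
    exact pow_le_pow_right₀ (by exact_mod_cast hK) (by omega)
  · rw [gnorm, wnorm_zero]
    exact zero_le

theorem shift_qD (hf : Gevrey f) : Gevrey fun b => if 1 ≤ b then GWStructure.qD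
    (f (b - 1)) else 0 := by
  filter_upwards [hf] with A ⟨K, hK, h1⟩
  refine ⟨K, hK, fun b => ?_⟩
  split_ifs with h
  · obtain ⟨b, rfl⟩ : ∃ c, b = c + 1 := ⟨b - 1, by omega⟩
    refine (gnorm_qD_le _ _ _).trans ((h1 _).trans ?_)
    exact pow_le_pow_right₀ (by exact_mod_cast hK) (by omega)
  · rw [gnorm, wnorm_zero]
    exact zero_le

/-- The sequence `h` with `h_b = u (f_b - h_{b-1}')` is of Gevrey type if `f` is. -/
theorem of_rec {u : PowerSeries ℚ} (hu : Convergent u) (hf : Gevrey f) (h0 : h 0 = u * f 0)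
    (hs : ∀ b, h (b + 1) = u * (f (b + 1) - GWStructure.qD (h b))) : Gevrey h := by
  filter_upwards [hu, hf] with A hA ⟨K, hK, h1⟩
  obtain ⟨U, hU, h2⟩ := exists_natCast_ge hA
  have hK' : (1 : ℝ≥0∞) ≤ K := by exact_mod_cast hK
  have hU' : (1 : ℝ≥0∞) ≤ U := by exact_mod_cast hU
  have hM : (K : ℝ≥0∞) ≤ 2 * U * K := le_mul_of_one_le_left' (one_le_mul (by norm_num) hU')
  refine ⟨2 * U * K, Nat.mul_pos (Nat.mul_pos two_pos hU) hK, fun b => ?_⟩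
  push_cast
  induction b with
  | zero =>
    rw [h0]
    refine (gnorm_mul_le _ _ _ _).trans ((mul_le_mul' h2 (h1 0)).trans ?_)
    simp only [zero_add, pow_one]
    exact mul_le_mul' (le_mul_of_one_le_left' (by norm_num)) le_rfl
  | succ b ih =>
    rw [hs]
    refine (gnorm_mul_le _ _ _ _).trans ((mul_le_mul' h2 ((wnorm_sub_le _ _ _).trans
      (add_le_add (h1 (b + 1)) ((gnorm_qD_le _ b _).trans ih)))).trans ?_)
    calc (U : ℝ≥0∞) * ((K : ℝ≥0∞) ^ (b + 1 + 1) + (2 * U * K) ^ (b + 1))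
        ≤ (U : ℝ≥0∞) * (K * (2 * U * K) ^ (b + 1) + K * (2 * U * K) ^ (b + 1)) := by
          rw [pow_succ' _ (b + 1)]
          gcongr
          exact le_mul_of_one_le_left' hK'
      _ = _ := by ring

theorem succ_pow_le (d b : ℕ) : (d + 1) ^ b ≤ b ! * 2 ^ (d + b) := by
  refine (Nat.pow_succ_le_ascFactorial d.succ b).trans ?_
  have := Nat.ascFactorial_eq_factorial_mul_choose d b
  rw [Nat.succ_eq_add_one, this]
  gcongr
  exact Nat.choose_le_two_pow _ _

/-- This rests on `(d+1)^b ≤ b! 2^{d+b}`: a factor `2^d` is absorbed by the radius, a factor `2^b`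
by the constant. -/
theorem eventually_qnorm_le (hf : Gevrey f) :
    ∀ᶠ A : ℕ in atTop, ∀ b, qnorm (A : ℝ≥0∞)⁻¹ (f b) ≤ (b ! : ℝ≥0∞) * (A : ℝ≥0∞) ^ (b + 1) := by
  obtain ⟨A₀, K, hK, h⟩ := hf.exists
  filter_upwards [eventually_ge_atTop (2 * A₀), eventually_ge_atTop (2 * K)] with A h1 h2 b
  have key : ∀ d, (A : ℝ≥0∞)⁻¹ ^ d ≤ ((b ! * 2 ^ b : ℕ) : ℝ≥0∞) * gwt (A₀ : ℝ≥0∞)⁻¹ b d := by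
    intro d
    have e1 : (A : ℝ≥0∞)⁻¹ ≤ 2⁻¹ * (A₀ : ℝ≥0∞)⁻¹ := by
      rw [← ENNReal.mul_inv (by simp) (by simp)]
      gcongr
      exact_mod_cast h1
    have e2 : (1 : ℝ≥0∞) ≤ ((b ! * 2 ^ b : ℕ) : ℝ≥0∞) * 2 ^ d * ((d + 1 : ℕ) : ℝ≥0∞)⁻¹ ^ b := by
      rw [← ENNReal.inv_pow, ← div_eq_mul_inv, ENNReal.le_div_iff_mul_le (by simp) (by simp),
        one_mul]
      have := succ_pow_le d b
      rw [pow_add, mul_comm (2 ^ d), ← mul_assoc] at this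
      exact_mod_cast this
    calc (A : ℝ≥0∞)⁻¹ ^ d ≤ (2⁻¹ * (A₀ : ℝ≥0∞)⁻¹) ^ d * 1 := by rw [mul_one]; gcongr
      _ ≤ (2⁻¹ * (A₀ : ℝ≥0∞)⁻¹) ^ d *
          (((b ! * 2 ^ b : ℕ) : ℝ≥0∞) * 2 ^ d * ((d + 1 : ℕ) : ℝ≥0∞)⁻¹ ^ b) := by gcongr
      _ = ((b ! * 2 ^ b : ℕ) : ℝ≥0∞) * gwt (A₀ : ℝ≥0∞)⁻¹ b d * ((2⁻¹ * 2) ^ d) := by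
        rw [gwt, mul_pow, mul_pow]
        ring
      _ = _ := by rw [ENNReal.inv_mul_cancel (by simp) (by simp), one_pow, mul_one]
  calc qnorm (A : ℝ≥0∞)⁻¹ (f b)
      ≤ ((b ! * 2 ^ b : ℕ) : ℝ≥0∞) * gnorm (A₀ : ℝ≥0∞)⁻¹ b (f b) := by
        rw [qnorm, wnorm, gnorm, wnorm, ← ENNReal.tsum_mul_left]
        refine ENNReal.tsum_le_tsum fun d => ?_
        rw [mul_left_comm]
        gcongr
        exact key d
    _ ≤ ((b ! * 2 ^ b : ℕ) : ℝ≥0∞) * (K : ℝ≥0∞) ^ (b + 1) := by gcongr; exact h b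
    _ ≤ (b ! : ℝ≥0∞) * (A : ℝ≥0∞) ^ (b + 1) := by
        have : b ! * 2 ^ b * K ^ (b + 1) ≤ b ! * A ^ (b + 1) := by
          calc b ! * 2 ^ b * K ^ (b + 1) ≤ b ! * (2 ^ (b + 1) * K ^ (b + 1)) := by
                rw [mul_assoc]
                gcongr <;> omega
            _ = b ! * (2 * K) ^ (b + 1) := by rw [mul_pow]
            _ ≤ _ := by gcongr
        exact_mod_cast this

end Gevrey

/-! ### The series `Φ_b` are of Gevrey type -/

theorem qD_truncLT (D : ℕ) (f : PowerSeries ℚ) : qD (truncLT D f) = truncLT D (qD f) := by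
  ext d
  simp only [qD, coeff_mk, coeff_truncLT]
  split_ifs <;> simp

/-- The equation for `Φ_b` is a first-order equation whose right-hand side contains
`(q d/dq)^i Φ_{b+1-k}` for `2 ≤ k ≤ n` and `i ≤ k`.  Thus, up to convergent factors, `(q d/dq) Φ_b`
is bounded by `b + 1` derivatives, and `Φ_b` by `b` derivatives. -/
theorem gevrey_phi {n l : ℕ} {a : Fin l → ℕ} (hn : 1 ≤ n) (ha : absDeg a ≤ n) : Gevrey (phi n a) :=
    by
  have hΦ := isPhi_phi hn ha
  set α := opLCoeff n a 1 1 with hα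
  set γ := α⁻¹ * opLCoeff n a 1 0 with hγ
  have hα0 : constantCoeff α ≠ 0 := constantCoeff_opLCoeff_one hn ha
  have hαa : Convergent α⁻¹ := (convergent_opLCoeff hn ha 1 1).inv
  have hγa : Convergent γ := hαa.mul (convergent_opLCoeff hn ha 1 0)
  have hγ0 : constantCoeff γ = 0 := by
    rw [hγ, map_mul, constantCoeff_opLCoeff hn ha 1 one_ne_zero, mul_zero]
  set e : ℕ → ℕ → PowerSeries ℚ := fun k i => α⁻¹ * ((seriesL n a)⁻¹ ^ (k - 1) * opLCoeff n a k i)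
    with he
  have hea : ∀ k i, Convergent (e k i) := fun k i =>
    hαa.mul (((convergent_seriesL hn ha).inv.pow _).mul (convergent_opLCoeff hn ha k i))
  have hEa : ∀ᶠ A : ℕ in atTop, ∀ k ∈ Finset.Icc 2 n, ∀ i ∈ Finset.range (k + 1),
      qnorm (A : ℝ≥0∞)⁻¹ (e k i) ≠ ∞ := by
    rw [eventually_all_finset]
    intro k _
    rw [eventually_all_finset]
    exact fun i _ => hea k i
  filter_upwards [hEa, hγa.eventually_le hγ0 (ε := 4⁻¹) (by simp), eventually_ne_atTop 0]
    with A hA hγA hA0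
  set ρ : ℝ≥0∞ := (A : ℝ≥0∞)⁻¹ with hρ
  have hρ1 : ρ ≠ ∞ := by simpa [hρ] using hA0
  obtain ⟨E, hE1, hE⟩ : ∃ E : ℕ, 1 ≤ E ∧
      ∑ k ∈ Finset.Icc 2 n, ∑ i ∈ Finset.range (k + 1), qnorm ρ (e k i) ≤ E :=
    exists_natCast_ge (ENNReal.sum_ne_top.2 fun k hk => ENNReal.sum_ne_top.2 fun i hi =>
      hA k hk i hi)
  refine ⟨2 + 4 * E, by omega, fun b => ?_⟩
  set K : ℝ≥0∞ := ((2 + 4 * E : ℕ) : ℝ≥0∞) with hK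
  have hK1 : 1 ≤ K := by rw [hK]; exact_mod_cast (by omega : 1 ≤ 2 + 4 * E)
  induction b using Nat.strong_induction_on with
  | _ b ih =>
  have hode := (phi_eq_iff a hn b (phi n a)).1 (hΦ.2.2 b)
  have hqD : qD (phi n a b) = α⁻¹ * phiRhs n a b (phi n a) - γ * phi n a b := by
    rw [← hode]
    have := PowerSeries.inv_mul_cancel α hα0
    rw [hγ]
    linear_combination -qD (phi n a b) * this
  have hrhs : gnorm ρ (b + 1) (α⁻¹ * phiRhs n a b (phi n a)) ≤ E * K ^ b := by
    rw [phiRhs, mul_neg, gnorm, wnorm_neg, Finset.mul_sum]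
    refine (wnorm_sum_le _ _ _).trans ?_
    have hE' := mul_le_mul_left hE (K ^ b)
    rw [Finset.sum_mul] at hE'
    refine le_trans (Finset.sum_le_sum fun k hk => ?_) hE'
    · rw [Finset.sum_mul]
      rw [Finset.mem_Icc] at hk
      split_ifs with hkb
      · rw [opL_eq, Finset.mul_sum, Finset.mul_sum]
        refine (wnorm_sum_le _ _ _).trans (Finset.sum_le_sum fun i hi => ?_)
        rw [Finset.mem_range] at hi
        rw [← mul_assoc, ← mul_assoc]
        have e1 : α⁻¹ * (seriesL n a)⁻¹ ^ (k - 1) * opLCoeff n a k i = e k i := mul_assoc _ _ _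
        rw [e1]
        refine (gnorm_mul_le _ _ _ _).trans ?_
        gcongr
        refine (gnorm_anti ρ (b := b + 1 - k + i) (by omega) _).trans
          ((gnorm_qD_iterate_le _ _ _ _).trans ((ih _ (by omega)).trans ?_))
        exact pow_le_pow_right₀ hK1 (by omega)
      · rw [mul_zero, wnorm_zero]
        exact zero_le
  have hc : ‖constantCoeff (phi n a b)‖ₑ ≤ 1 := by
    rcases Nat.eq_zero_or_pos b with rfl | hb
    · rw [hΦ.1]
      simp
    · rw [hΦ.2.1 b hb]
      simp
  -- The term with `γ`, which is small near `q = 0`, is absorbed in the truncated series.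
  refine wnorm_le_of_truncLT fun D => ?_
  set t := truncLT D (phi n a b) with ht
  have hct : ‖constantCoeff t‖ₑ ≤ 1 := by
    refine le_trans ?_ hc
    rw [← coeff_zero_eq_constantCoeff_apply, ← coeff_zero_eq_constantCoeff_apply, ht,
      coeff_truncLT]
    split_ifs <;> simp
  have hqt : qD t = truncLT D (α⁻¹ * phiRhs n a b (phi n a)) + truncLT D (-γ * t) := by
    rw [ht, qD_truncLT, truncLT_mul, hqD, ← truncLT_add]
    congr 1
    ring
  have h1 : gnorm ρ b t ≤ (1 + 2 * (E * K ^ b)) + 2⁻¹ * gnorm ρ b t := by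
    refine (gnorm_le_add_qD ρ b t).trans ?_
    have h2 : gnorm ρ (b + 1) (qD t) ≤ E * K ^ b + 4⁻¹ * gnorm ρ b t := by
      rw [hqt]
      refine (wnorm_add_le _ _ _).trans (add_le_add ((wnorm_truncLT_le _ _ _).trans hrhs)
        ((wnorm_truncLT_le _ _ _).trans ((gnorm_mul_le _ _ _ _).trans ?_)))
      rw [qnorm, wnorm_neg]
      exact mul_le_mul' hγA (gnorm_anti _ (Nat.le_succ b) _)
    calc _ ≤ 1 + 2 * (E * K ^ b + 4⁻¹ * gnorm ρ b t) := by gcongr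
      _ = (1 + 2 * (E * K ^ b)) + (2 * 4⁻¹) * gnorm ρ b t := by ring
      _ = _ := by
        have : (2 : ℝ≥0∞) * 4⁻¹ = 2⁻¹ := by
          rw [show (4 : ℝ≥0∞) = 2 * 2 by norm_num, ENNReal.mul_inv (by simp) (by simp),
            ← mul_assoc, ENNReal.mul_inv_cancel (by simp) (by simp), one_mul]
        rw [this]
  refine (le_two_mul_of_le_add_half (wnorm_truncLT_ne_top (gwt_ne_top hρ1 b) D _) h1).trans ?_
  have hKb : 1 ≤ K ^ b := one_le_pow₀ hK1
  calc 2 * (1 + 2 * (E * K ^ b)) ≤ 2 * (K ^ b + 2 * (E * K ^ b)) := by gcongr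
    _ = (2 + 4 * E) * K ^ b := by ring
    _ = K ^ (b + 1) := by
      rw [pow_succ', hK]
      push_cast
      rfl

/-! ### The series `I_c` converge -/

/-- Convergence is a geometric bound for the coefficients. -/
theorem convergent_iff {f : PowerSeries ℚ} :
    Convergent f ↔ ∃ G : ℕ, 1 ≤ G ∧ ∀ d, ‖coeff d f‖ₑ ≤ (G : ℝ≥0∞) ^ (d + 1) := by
  constructor
  · intro h
    obtain ⟨A, hA, hA0⟩ := (h.and (eventually_ge_atTop 1)).exists
    obtain ⟨K, hK, h1⟩ := exists_natCast_ge hA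
    refine ⟨K * A, Nat.mul_pos hK hA0, fun d => ?_⟩
    have h2 := (enorm_coeff_mul_le _ f d).trans h1
    rw [← ENNReal.inv_pow, ← div_eq_mul_inv, ENNReal.div_le_iff (by simp; omega) (by simp)] at h2
    refine h2.trans ?_
    push_cast
    rw [mul_pow]
    gcongr
    · exact le_self_pow₀ (by exact_mod_cast hK) (by omega)
    · exact_mod_cast hA0
    · omega
  · rintro ⟨G, hG, h⟩
    refine convergent_of_exists (ρ := (2 * (G : ℝ≥0∞))⁻¹) (by simp [ENNReal.mul_eq_top]) ?_
    have h1 : ∀ d, ‖coeff d f‖ₑ * (2 * (G : ℝ≥0∞))⁻¹ ^ d ≤ G * 2⁻¹ ^ d := fun d => by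
      calc _ ≤ (G : ℝ≥0∞) ^ (d + 1) * (2 * (G : ℝ≥0∞))⁻¹ ^ d := by gcongr; exact h d
        _ = G * 2⁻¹ ^ d * ((G : ℝ≥0∞) * (G : ℝ≥0∞)⁻¹) ^ d := by
          rw [ENNReal.mul_inv (by simp) (by simp), mul_pow, mul_pow]
          ring
        _ = _ := by
          rw [ENNReal.mul_inv_cancel (by simp; omega) (by simp), one_pow, mul_one]
    refine ne_top_of_le_ne_top ?_ (ENNReal.tsum_le_tsum h1)
    rw [ENNReal.tsum_mul_left, ENNReal.tsum_geometric]
    refine ENNReal.mul_ne_top (by simp) (by simp)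

/-- The power series `g` is the expansion at `w = 0` of the rational function `f`. -/
def Expands (f : RatFunc ℚ) (g : PowerSeries ℚ) : Prop :=
  algebraMap (RatFunc ℚ) (LaurentSeries ℚ) f = HahnSeries.ofPowerSeries ℤ ℚ g

namespace Expands

theorem poly (p : Polynomial ℚ) : Expands (algebraMap (Polynomial ℚ) (RatFunc ℚ) p) p :=
  (RatFunc.coe_coe p).symm

theorem C (c : ℚ) : Expands (RatFunc.C c) (PowerSeries.C c) := by
  simpa using poly (Polynomial.C c)

theorem X : Expands RatFunc.X PowerSeries.X := by
  simpa using poly Polynomial.X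

variable {f f' : RatFunc ℚ} {g g' : PowerSeries ℚ}

theorem add (h : Expands f g) (h' : Expands f' g') : Expands (f + f') (g + g') := by
  unfold Expands at *
  rw [map_add, map_add, h, h']

theorem sub (h : Expands f g) (h' : Expands f' g') : Expands (f - f') (g - g') := by
  unfold Expands at *
  rw [map_sub, map_sub, h, h']

theorem mul (h : Expands f g) (h' : Expands f' g') : Expands (f * f') (g * g') := by
  unfold Expands at *
  rw [map_mul, map_mul, h, h']

theorem pow (h : Expands f g) (k : ℕ) : Expands (f ^ k) (g ^ k) := by
  unfold Expands at *
  rw [map_pow, map_pow, h]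

theorem prod {ι : Type*} (s : Finset ι) {f : ι → RatFunc ℚ} {g : ι → PowerSeries ℚ}
    (h : ∀ i ∈ s, Expands (f i) (g i)) : Expands (∏ i ∈ s, f i) (∏ i ∈ s, g i) := by
  unfold Expands at *
  rw [map_prod, map_prod]
  exact Finset.prod_congr rfl h

theorem sum {ι : Type*} (s : Finset ι) {f : ι → RatFunc ℚ} {g : ι → PowerSeries ℚ}
    (h : ∀ i ∈ s, Expands (f i) (g i)) : Expands (∑ i ∈ s, f i) (∑ i ∈ s, g i) := by
  unfold Expands at *
  rw [map_sum, map_sum]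
  exact Finset.sum_congr rfl h

theorem inv (h : Expands f g) (h0 : constantCoeff g ≠ 0) : Expands f⁻¹ g⁻¹ := by
  unfold Expands at *
  rw [map_inv₀, h]
  refine inv_eq_of_mul_eq_one_right ?_
  rw [← map_mul, PowerSeries.mul_inv_cancel _ h0, map_one]

theorem X_inv_mul (h : Expands f (PowerSeries.X * g)) : Expands (RatFunc.X⁻¹ * f) g := by
  unfold Expands at *
  rw [map_mul, h, map_mul, ← mul_assoc]
  have hX := X
  unfold Expands at hX
  rw [← hX, ← map_mul, inv_mul_cancel₀ RatFunc.X_ne_zero, map_one, one_mul]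

/-- A rational function that has an expansion at `w = 0` is regular there. -/
theorem eval_eq (h : Expands f g) :
    RatFunc.eval (RingHom.id ℚ) 0 f = constantCoeff g := by
  have h1 : g * (f.denom : PowerSeries ℚ) = f.num := by
    have h2 : Expands (f * algebraMap _ _ f.denom) (g * f.denom) := h.mul (poly f.denom)
    have h3 : f * algebraMap (Polynomial ℚ) (RatFunc ℚ) f.denom = algebraMap _ _ f.num := by
      conv_lhs => rw [← RatFunc.num_div_denom f, RatFunc.num_div_denom f]
      nth_rewrite 1 [← RatFunc.num_div_denom f]
      exact div_mul_cancel₀ _ (by simpa using f.denom_ne_zero)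
    rw [h3] at h2
    exact HahnSeries.ofPowerSeries_injective (h2.symm.trans (poly f.num))
  have h4 := congrArg constantCoeff h1
  rw [map_mul, Polynomial.constantCoeff_coe, Polynomial.constantCoeff_coe] at h4
  have h5 : f.denom.coeff 0 ≠ 0 := by
    intro h5
    rw [h5, mul_zero] at h4
    obtain ⟨u, v, huv⟩ := f.isCoprime_num_denom
    have := congrArg (Polynomial.eval 0) huv
    rw [Polynomial.eval_add, Polynomial.eval_mul, Polynomial.eval_mul,
      ← Polynomial.coeff_zero_eq_eval_zero f.num, ← Polynomial.coeff_zero_eq_eval_zero f.denom,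
      ← h4, h5] at this
    simp at this
  rw [RatFunc.eval, Polynomial.eval₂_id, Polynomial.eval₂_id, ← Polynomial.coeff_zero_eq_eval_zero,
    ← Polynomial.coeff_zero_eq_eval_zero, ← h4, mul_div_cancel_right₀ _ h5]

end Expands

/-- The series `h_d(w)` are the expansions at `w = 0` of the coefficients of a power series
`H(w,q)`, and they converge uniformly: `|h_{d,s}| ≤ C^{d+s+1}` for some `C`. -/
def Regular (H : PowerSeries (RatFunc ℚ)) (h : ℕ → PowerSeries ℚ) : Prop :=
  (∀ d, Expands (coeff d H) (h d)) ∧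
    ∃ C : ℕ, 1 ≤ C ∧ ∀ d s, ‖coeff s (h d)‖ₑ ≤ (C : ℝ≥0∞) ^ (d + s + 1)

theorem Regular.convergent_atZero {H : PowerSeries (RatFunc ℚ)} {h : ℕ → PowerSeries ℚ}
    (hH : Regular H h) : Convergent (atZero H) := by
  obtain ⟨h1, C, hC, h2⟩ := hH
  refine convergent_iff.2 ⟨C, hC, fun d => ?_⟩
  rw [atZero, coeff_mk, (h1 d).eval_eq, ← coeff_zero_eq_constantCoeff_apply]
  exact h2 d 0

/-- The normalized series restricts to a constant at `w = 0`, so that its coefficients of positive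
degree in `q` are divisible by `w`; hence `opM` creates no pole. -/
theorem Regular.normalize {H : PowerSeries (RatFunc ℚ)} {h : ℕ → PowerSeries ℚ}
    (hH : Regular H h) : ∃ h', Regular (normalize H) h' ∧ ∀ d, d ≠ 0 → constantCoeff (h' d) = 0 :=
        by
  have hz := hH.convergent_atZero.inv
  obtain ⟨h1, C₀, hC, h2⟩ := hH
  obtain ⟨G, hG, h3⟩ := convergent_iff.1 hz
  refine ⟨fun d => ∑ x ∈ Finset.HasAntidiagonal.antidiagonal d,
    h x.1 * C (coeff x.2 (atZero H)⁻¹), ⟨fun d => ?_, 2 * C₀ * G, ?_, fun d s => ?_⟩, fun d hd =>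
        ?_⟩
  · have e : (map (RatFunc.C : ℚ →+* RatFunc ℚ) (atZero H))⁻¹ =
        map (RatFunc.C : ℚ →+* RatFunc ℚ) (atZero H)⁻¹ := by
      by_cases h0 : constantCoeff (atZero H) = 0
      · rw [PowerSeries.inv_eq_zero.2 h0, PowerSeries.inv_eq_zero.2, map_zero]
        rw [← coeff_zero_eq_constantCoeff_apply, coeff_map, coeff_zero_eq_constantCoeff_apply, h0,
          map_zero]
      · rw [PowerSeries.inv_eq_iff_mul_eq_one, ← map_mul, PowerSeries.inv_mul_cancel _ h0, map_one]
        rw [← coeff_zero_eq_constantCoeff_apply, coeff_map, coeff_zero_eq_constantCoeff_apply]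
        simpa using h0
    rw [GWStructure.normalize, e, coeff_mul]
    refine Expands.sum _ fun x _ => (h1 _).mul ?_
    rw [coeff_map]
    exact Expands.C _
  · exact Nat.mul_pos (Nat.mul_pos two_pos hC) hG
  · rw [map_sum]
    refine (enorm_sum_le _ _).trans ?_
    calc _ ≤ ∑ x ∈ Finset.HasAntidiagonal.antidiagonal d,
          (C₀ : ℝ≥0∞) ^ (d + s + 1) * (G : ℝ≥0∞) ^ (d + s + 1) := by
          refine Finset.sum_le_sum fun x hx => ?_
          have := Finset.HasAntidiagonal.mem_antidiagonal.1 hx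
          rw [coeff_mul_C, enorm_mul]
          gcongr
          · exact (h2 _ _).trans (pow_le_pow_right₀ (by exact_mod_cast hC) (by omega))
          · exact (h3 _).trans (pow_le_pow_right₀ (by exact_mod_cast hG) (by omega))
      _ = ((d + 1 : ℕ) : ℝ≥0∞) * ((C₀ : ℝ≥0∞) ^ (d + s + 1) * (G : ℝ≥0∞) ^ (d + s + 1)) := by
          rw [Finset.sum_const, Finset.Nat.card_antidiagonal, nsmul_eq_mul]
      _ ≤ 2 ^ (d + s + 1) * ((C₀ : ℝ≥0∞) ^ (d + s + 1) * (G : ℝ≥0∞) ^ (d + s + 1)) := by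
          gcongr
          have : d + 1 ≤ 2 ^ (d + s + 1) :=
            Nat.lt_two_pow_self.le.trans (Nat.pow_le_pow_right two_pos (by omega))
          exact_mod_cast this
      _ = _ := by
          push_cast
          rw [mul_pow, mul_pow, mul_assoc]
  · have e : constantCoeff (∑ x ∈ Finset.HasAntidiagonal.antidiagonal d,
        h x.1 * C (coeff x.2 (atZero H)⁻¹)) = coeff d (atZero H * (atZero H)⁻¹) := by
      rw [map_sum, coeff_mul]
      refine Finset.sum_congr rfl fun x _ => ?_
      rw [map_mul, constantCoeff_C, ← (h1 x.1).eval_eq, atZero, coeff_mk]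
    rw [e]
    by_cases h0 : constantCoeff (atZero H) = 0
    · rw [PowerSeries.inv_eq_zero.2 h0, mul_zero, map_zero]
    · rw [PowerSeries.mul_inv_cancel _ h0, coeff_one, if_neg hd]

theorem Regular.opM {H : PowerSeries (RatFunc ℚ)} {h : ℕ → PowerSeries ℚ}
    (hH : Regular H h) : ∃ h', Regular (opM H) h' := by
  obtain ⟨g, ⟨h1, C₀, hC, h2⟩, h0⟩ := hH.normalize
  refine ⟨fun d => g d + C (d : ℚ) * mk fun s => coeff (s + 1) (g d), fun d => ?_,
    2 * C₀ ^ 2, Nat.mul_pos two_pos (pow_pos hC 2), fun d s => ?_⟩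
  · rw [GWStructure.opM, map_add, coeff_C_mul]
    refine (h1 d).add (Expands.X_inv_mul ?_)
    rw [qD, coeff_mk]
    rcases eq_or_ne d 0 with rfl | hd
    · simpa using Expands.C 0
    · have e : X * (C (d : ℚ) * mk fun s => coeff (s + 1) (g d)) = C (d : ℚ) * g d := by
        rw [mul_left_comm]
        congr 1
        ext s
        rcases s with _ | s
        · simp [h0 d hd]
        · rw [coeff_succ_X_mul, coeff_mk]
      rw [e]
      refine Expands.mul ?_ (h1 d)
      simpa using Expands.C (d : ℚ)
  · have hC' : (1 : ℝ≥0∞) ≤ C₀ := by exact_mod_cast hC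
    rw [map_add, coeff_C_mul, coeff_mk]
    refine (enorm_add_le _ _).trans ?_
    rw [enorm_mul, enorm_natCast]
    calc _ ≤ (C₀ : ℝ≥0∞) ^ (2 * (d + s + 1)) + d * (C₀ : ℝ≥0∞) ^ (2 * (d + s + 1)) := by
          gcongr
          · exact (h2 _ _).trans (pow_le_pow_right₀ hC' (by omega))
          · exact (h2 _ _).trans (pow_le_pow_right₀ hC' (by omega))
      _ = ((d + 1 : ℕ) : ℝ≥0∞) * (C₀ : ℝ≥0∞) ^ (2 * (d + s + 1)) := by
          push_cast
          ring
      _ ≤ 2 ^ (d + s + 1) * (C₀ : ℝ≥0∞) ^ (2 * (d + s + 1)) := by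
          gcongr
          have : d + 1 ≤ 2 ^ (d + s + 1) :=
            Nat.lt_two_pow_self.le.trans (Nat.pow_le_pow_right two_pos (by omega))
          exact_mod_cast this
      _ = _ := by
          push_cast
          rw [mul_pow, pow_mul]

/-! ### The hypergeometric series -/

theorem Icc_one_eq_Ioc (m : ℕ) : Finset.Icc 1 m = Finset.Ioc 0 m := by
  ext x
  simp only [Finset.mem_Icc, Finset.mem_Ioc]
  omega

/-- For small `w`, the denominator `(w + r)^n - w^n` is bounded below by `r^n / 2`. -/
theorem qnorm_inv_pow_sub_pow_le {n : ℕ} (hn : 1 ≤ n) {r : ℕ} (hr : 1 ≤ r) :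
    (r : ℝ≥0∞) ^ n * qnorm (2 ^ (n + 1))⁻¹ ((X + C (r : ℚ)) ^ n - X ^ n)⁻¹ ≤ 2 := by
  obtain ⟨m, rfl⟩ : ∃ m, n = m + 1 := ⟨n - 1, by omega⟩
  set σ : ℝ≥0∞ := (2 ^ (m + 1 + 1))⁻¹ with hσ
  have hσ1 : σ ≤ 1 := by
    rw [hσ, ENNReal.inv_le_one]
    exact one_le_pow₀ (by norm_num)
  set g : PowerSeries ℚ := (X + C (r : ℚ)) ^ (m + 1) - X ^ (m + 1) with hg
  have hr0 : (r : ℚ) ≠ 0 := by positivity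
  have hrE : (r : ℝ≥0∞) ^ (m + 1) ≠ 0 := pow_ne_zero _ (by simp; omega)
  have hg0 : constantCoeff g ≠ 0 := by
    simp [hg, hr0]
  -- up to the factor `r^{m+1}`, the denominator is `1 - u` with `‖u‖ ≤ 1/2`
  set u : PowerSeries ℚ := 1 - C (((r : ℚ) ^ (m + 1))⁻¹) * g with hu
  have hC : (C ((r : ℚ) ^ (m + 1)) : PowerSeries ℚ) * C (((r : ℚ) ^ (m + 1))⁻¹) = 1 := by
    rw [← map_mul, mul_inv_cancel₀ (pow_ne_zero _ hr0), map_one]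
  have hnC : ∀ f : PowerSeries ℚ, qnorm σ (C ((r : ℚ) ^ (m + 1)) * f) =
      (r : ℝ≥0∞) ^ (m + 1) * qnorm σ f := fun f => by
    rw [qnorm, wnorm_C_mul, enorm_pow, enorm_natCast, qnorm]
  have hexp : C ((r : ℚ) ^ (m + 1)) * u =
      -∑ i ∈ Finset.range m, X ^ (i + 1) * C ((r : ℚ) ^ (m - i) * ((m + 1).choose (i + 1) : ℚ)) :=
          by
    have e : (X + C (r : ℚ)) ^ (m + 1) = ∑ i ∈ Finset.range m,
        X ^ (i + 1) * C ((r : ℚ) ^ (m - i) * ((m + 1).choose (i + 1) : ℚ)) +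
          C ((r : ℚ) ^ (m + 1)) + X ^ (m + 1) := by
      rw [add_pow, Finset.sum_range_succ, Finset.sum_range_succ']
      simp [mul_assoc]
    rw [hu, hg, mul_sub, ← mul_assoc, hC]
    linear_combination -e
  have hun : qnorm σ u ≤ 2⁻¹ := by
    rw [← ENNReal.mul_le_mul_iff_right hrE (by simp), ← hnC, hexp, qnorm, wnorm_neg]
    refine (wnorm_sum_le _ _ _).trans ?_
    calc _ ≤ ∑ i ∈ Finset.range m, σ * ((r : ℝ≥0∞) ^ (m + 1) * ((m + 1).choose (i + 1) : ℝ≥0∞)) :=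
        by
          refine Finset.sum_le_sum fun i _ => ?_
          rw [pow_succ', mul_assoc]
          refine (qnorm_X_mul _ _).le.trans ?_
          gcongr
          refine (qnorm_mul_le _ _ _).trans ?_
          rw [qnorm_C, enorm_mul, enorm_pow, enorm_natCast, enorm_natCast]
          have hX : qnorm σ (X ^ i) ≤ 1 := by
            refine (qnorm_pow_le _ _ _).trans (pow_le_one' ?_ _)
            rw [← mul_one X, qnorm_X_mul, qnorm_one, mul_one]
            exact hσ1
          refine (mul_le_mul' hX le_rfl).trans ?_
          rw [one_mul]
          gcongr
          · exact_mod_cast hr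
          · omega
      _ = (r : ℝ≥0∞) ^ (m + 1) * (σ * ((∑ i ∈ Finset.range m, (m + 1).choose (i + 1) : ℕ) :
          ℝ≥0∞)) := by
          rw [Nat.cast_sum, Finset.mul_sum, Finset.mul_sum]
          exact Finset.sum_congr rfl fun i _ => by ring
      _ ≤ (r : ℝ≥0∞) ^ (m + 1) * (σ * 2 ^ (m + 1)) := by
          gcongr
          have := Nat.sum_range_choose (m + 1)
          rw [Finset.sum_range_succ, Finset.sum_range_succ'] at this
          have h5 : ∑ i ∈ Finset.range m, (m + 1).choose (i + 1) ≤ 2 ^ (m + 1) := by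
            rw [← this]
            exact (Nat.le_add_right _ _).trans (Nat.le_add_right _ _)
          exact_mod_cast h5
      _ = _ := by
          rw [hσ, pow_succ _ (m + 1), ENNReal.mul_inv (by simp) (by simp), mul_right_comm _ _
              (2 ^ _),
            ENNReal.inv_mul_cancel (by simp) (by simp), one_mul]
  rw [← hnC]
  refine qnorm_le_two (by rw [hσ]; simp) hun ?_
  have e1 : g * g⁻¹ = 1 := PowerSeries.mul_inv_cancel _ hg0
  rw [hu]
  linear_combination e1 + g * g⁻¹ * hC

/-- The expansions at `w = 0` of the coefficients of the hypergeometric series in the case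
`|a| = n`. -/
def hyperExp (n : ℕ) {l : ℕ} (a : Fin l → ℕ) (d : ℕ) : PowerSeries ℚ :=
  (∏ k, ∏ r ∈ Finset.Icc 1 (a k * d), (C (a k : ℚ) * X + C (r : ℚ))) *
    (∏ r ∈ Finset.Icc 1 d, ((X + C (r : ℚ)) ^ n - X ^ n))⁻¹

/-- For `|a| = n`, the `n` new factors of the numerator are of order `d`, and so is the `n`-th root
of the new factor of the denominator; the growth in `d` is therefore geometric. -/
theorem qnorm_hyperExp_succ_le {n l : ℕ} {a : Fin l → ℕ} (hn : 1 ≤ n) (ha : absDeg a = n) (d : ℕ) :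
    qnorm (2 ^ (n + 1))⁻¹ (hyperExp n a (d + 1)) ≤
      (2 * ∏ k, (2 * a k) ^ a k : ℕ) * qnorm (2 ^ (n + 1))⁻¹ (hyperExp n a d) := by
  set σ : ℝ≥0∞ := (2 ^ (n + 1))⁻¹ with hσ
  have hσ1 : σ ≤ 1 := by
    rw [hσ, ENNReal.inv_le_one]
    exact one_le_pow₀ (by norm_num)
  have e : hyperExp n a (d + 1) =
      (∏ k, ∏ r ∈ Finset.Ioc (a k * d) (a k * (d + 1)), (C (a k : ℚ) * X + C (r : ℚ))) *
        ((X + C ((d + 1 : ℕ) : ℚ)) ^ n - X ^ n)⁻¹ * hyperExp n a d := by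
    unfold hyperExp
    rw [Finset.prod_Icc_succ_top (by omega), PowerSeries.mul_inv_rev]
    have : ∀ k, ∏ r ∈ Finset.Icc 1 (a k * (d + 1)), (C (a k : ℚ) * X + C (r : ℚ) : PowerSeries ℚ) =
        (∏ r ∈ Finset.Icc 1 (a k * d), (C (a k : ℚ) * X + C (r : ℚ))) *
          ∏ r ∈ Finset.Ioc (a k * d) (a k * (d + 1)), (C (a k : ℚ) * X + C (r : ℚ)) := fun k => by
      rw [Icc_one_eq_Ioc, Icc_one_eq_Ioc, Finset.prod_Ioc_consecutive _ (Nat.zero_le _)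
        (Nat.mul_le_mul_left _ (Nat.le_succ d))]
    simp_rw [this]
    rw [Finset.prod_mul_distrib]
    ring
  rw [e]
  refine (qnorm_mul_le _ _ _).trans (mul_le_mul_left ((qnorm_mul_le _ _ _).trans ?_) _)
  have h1 : qnorm σ (∏ k, ∏ r ∈ Finset.Ioc (a k * d) (a k * (d + 1)),
      (C (a k : ℚ) * X + C (r : ℚ))) ≤ ((∏ k, (2 * a k) ^ a k : ℕ) : ℝ≥0∞) *
          ((d + 1 : ℕ) : ℝ≥0∞) ^ n := by
    have h2 : (∏ k, (2 * a k) ^ a k) * (d + 1) ^ n = ∏ k, (2 * a k * (d + 1)) ^ a k := by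
      conv_lhs => rw [← ha, absDeg, ← Finset.prod_pow_eq_pow_sum, ← Finset.prod_mul_distrib]
      simp_rw [← mul_pow]
    rw [← Nat.cast_pow, ← Nat.cast_mul, h2, Nat.cast_prod]
    refine (qnorm_prod_le _ _ _).trans (Finset.prod_le_prod' fun k _ => ?_)
    refine (qnorm_prod_le _ _ _).trans ?_
    have h3 : ∀ r ∈ Finset.Ioc (a k * d) (a k * (d + 1)),
        qnorm σ (C (a k : ℚ) * X + C (r : ℚ)) ≤ ((2 * a k * (d + 1) : ℕ) : ℝ≥0∞) := fun r hr => by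
      rw [Finset.mem_Ioc] at hr
      refine (wnorm_add_le _ _ _).trans ?_
      have h4 : qnorm σ (C (a k : ℚ) * X) ≤ a k := by
        rw [mul_comm, qnorm_X_mul, qnorm_C, enorm_natCast]
        exact mul_le_of_le_one_left' hσ1
      have h5 : qnorm σ (C (r : ℚ)) = r := by rw [qnorm_C, enorm_natCast]
      refine (add_le_add h4 h5.le).trans ?_
      have : a k + r ≤ 2 * a k * (d + 1) := by nlinarith [hr.2]
      exact_mod_cast this
    refine (Finset.prod_le_pow_card _ _ _ h3).trans (le_of_eq ?_)
    rw [Nat.card_Ioc, ← Nat.mul_sub, Nat.add_sub_cancel_left, mul_one, Nat.cast_pow]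
  calc _ ≤ ((∏ k, (2 * a k) ^ a k : ℕ) : ℝ≥0∞) * ((d + 1 : ℕ) : ℝ≥0∞) ^ n *
        qnorm σ ((X + C ((d + 1 : ℕ) : ℚ)) ^ n - X ^ n)⁻¹ := by gcongr
    _ ≤ ((∏ k, (2 * a k) ^ a k : ℕ) : ℝ≥0∞) * 2 := by
      rw [mul_assoc]
      gcongr
      exact qnorm_inv_pow_sub_pow_le hn (by omega)
    _ = _ := by
      push_cast
      ring

theorem regular_hyperF {n l : ℕ} {a : Fin l → ℕ} (hn : 1 ≤ n) (ha : absDeg a = n) :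
    Regular (hyperF n a) (hyperExp n a) := by
  refine ⟨fun d => ?_, ?_⟩
  · rw [hyperF, coeff_mk, show nu n a = 0 by simp [nu, ha], zero_mul, pow_zero, one_mul,
      div_eq_mul_inv]
    refine (Expands.prod _ fun k _ => Expands.prod _ fun r _ =>
      ((Expands.C _).mul Expands.X).add (Expands.C _)).mul (Expands.inv (Expands.prod _ fun r _ =>
        ((Expands.X.add (Expands.C _)).pow n).sub (Expands.X.pow n)) ?_)
    rw [map_prod, Finset.prod_ne_zero_iff]
    intro r hr
    rw [Finset.mem_Icc] at hr
    have : (r : ℚ) ≠ 0 := by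
      have := hr.1
      positivity
    have hn' : n ≠ 0 := by omega
    simp [this, hn']
  · set E : ℕ := 2 * ∏ k, (2 * a k) ^ a k with hE
    have hE1 : 1 ≤ E := by
      refine Nat.mul_pos two_pos (Finset.prod_pos fun k _ => ?_)
      rcases Nat.eq_zero_or_pos (a k) with h | h
      · simp [h]
      · positivity
    have h1 : ∀ d, qnorm (2 ^ (n + 1))⁻¹ (hyperExp n a d) ≤ (E : ℝ≥0∞) ^ d := fun d => by
      induction d with
      | zero => simp [hyperExp, qnorm_one]
      | succ d ih =>
        refine (qnorm_hyperExp_succ_le hn ha d).trans ?_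
        rw [pow_succ' (E : ℝ≥0∞)]
        exact mul_le_mul' le_rfl ih
    refine ⟨E * 2 ^ (n + 1), Nat.mul_pos hE1 (by positivity), fun d s => ?_⟩
    have h2 := (enorm_coeff_mul_le _ (hyperExp n a d) s).trans (h1 d)
    rw [← ENNReal.inv_pow, ← div_eq_mul_inv, ENNReal.div_le_iff (by simp) (by simp)] at h2
    refine h2.trans ?_
    push_cast
    rw [mul_pow]
    gcongr
    · exact_mod_cast hE1
    · omega
    · exact one_le_pow₀ (by norm_num)
    · omega

theorem convergent_seriesI {n l : ℕ} {a : Fin l → ℕ} (hn : 1 ≤ n) (c : ℕ) : Convergent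
    (seriesI n a c) := by
  unfold seriesI
  split_ifs with h
  · have : ∃ g, Regular (opM^[c] (hyperF n a)) g := by
      induction c with
      | zero => exact ⟨_, regular_hyperF hn h⟩
      | succ c ih =>
        obtain ⟨g, hg⟩ := ih
        rw [Function.iterate_succ_apply']
        exact hg.opM
    obtain ⟨g, hg⟩ := this
    exact hg.convergent_atZero
  · exact Convergent.one

/-! ### The series `Φ_{p;b}` are of Gevrey type -/

theorem gevrey_phiHatUp {n l : ℕ} {a : Fin l → ℕ} (hn : 1 ≤ n) (ha : absDeg a ≤ n) (p : ℕ) :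
    Gevrey (phiHatUp n a p) := by
  induction p with
  | zero => exact gevrey_phi hn ha
  | succ p ih =>
    have hσ : Convergent (-∑ r ∈ Finset.range (p + 1), qD (seriesI n a r) * (seriesI n a r)⁻¹) :=
      (Convergent.sum _ fun r _ => (convergent_seriesI hn r).qD.mul
          (convergent_seriesI hn r).inv).neg
    have := ((ih.convergent_mul (convergent_seriesL hn ha)).add ih.shift_qD).add
        ((ih.shift 1).convergent_mul hσ)
    convert this using 2 with b
    rcases b with _ | b
    · simp [phiHatUp]
    · simp [phiHatUp]
      ring

/-- The recursion downwards contains the unknown itself with index `b - 1`, see `Gevrey.of_rec`. -/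
theorem gevrey_phiHatDown {n l : ℕ} {a : Fin l → ℕ} (hn : 1 ≤ n) (ha : absDeg a ≤ n) (k : ℕ) :
    Gevrey (phiHatDown n a k) := by
  induction k with
  | zero =>
    have e : phiHatDown n a 0 = phi n a := by
      funext b
      rw [phiHatDown]
    rw [e]
    exact gevrey_phi hn ha
  | succ k ih =>
    have e0 : phiHatDown n a (k + 1) 0 = (seriesL n a)⁻¹ * phiHatDown n a k 0 := by
      rw [phiHatDown]
    have es : ∀ b, phiHatDown n a (k + 1) (b + 1) =
        (seriesL n a)⁻¹ * (phiHatDown n a k (b + 1) - qD (phiHatDown n a (k + 1) b)) := fun b => by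
      rw [phiHatDown]
    generalize phiHatDown n a (k + 1) = h at *
    exact ih.of_rec (convergent_seriesL hn ha).inv e0 es

theorem gevrey_phiHat {n l : ℕ} {a : Fin l → ℕ} (hn : 1 ≤ n) (ha : absDeg a ≤ n) (p : ℤ) :
    Gevrey fun b => phiHat n a p b := by
  by_cases hp : 0 ≤ p
  · convert gevrey_phiHatUp hn ha p.toNat using 2 with b
    rw [phiHat, if_neg (by omega), if_pos hp, Int.toNat_natCast]
  · convert gevrey_phiHatDown hn ha (-p).toNat using 2 with b
    rw [phiHat, if_neg (by omega), if_neg hp, Int.toNat_natCast]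

theorem gevrey_phiP {n l : ℕ} {a : Fin l → ℕ} (hn : 1 ≤ n) (ha : absDeg a ≤ n) (p : ℕ) :
    Gevrey fun b => phiP n a p b := by
  unfold phiP
  split_ifs with h
  · exact gevrey_phiHat hn ha _
  · refine Gevrey.sum _ fun d _ => ?_
    split_ifs with h2
    · refine Gevrey.sum _ fun s hs => ?_
      refine Gevrey.convergent_mul ((Convergent.const _).mul (Convergent.X.pow d)) ?_
      rw [Finset.mem_range] at hs
      convert (gevrey_phiHat hn ha ((s : ℤ) - l)).shift (p - nu n a * d - s) using 2 with b
      split_ifs with h3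
      · congr 1
        push_cast [h2, h3]
        omega
      · rw [phiHat, if_pos (by omega)]
    · exact Gevrey.zero

/-! ### Uniform bounds for the series -/

/-- Uniform bounds, at `ρ = A⁻¹`, for all power series that enter the recursion for the structure
constants. -/
structure SeriesBound (n : ℕ) {l : ℕ} (a : Fin l → ℕ) (A : ℕ) : Prop where
  one_le : 1 ≤ A
  phiP_le : ∀ (p : Fin n) (b : ℕ), qnorm (A : ℝ≥0∞)⁻¹ (seriesI n a 0 ^ 2 *
    (seriesL n a ^ (deltaNu n a * n) * phi n a 0)⁻¹ * phiP n a p b) ≤ b ! * (A : ℝ≥0∞) ^ (b + 1)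
  phi_zero_le : qnorm (A : ℝ≥0∞)⁻¹ (phi n a 0 ^ 2 * (seriesI n a 0 ^ 2)⁻¹) ≤ A
  phi_le : ∀ r, qnorm (A : ℝ≥0∞)⁻¹ ((phi n a 0)⁻¹ * phi n a r) ≤ r ! * (A : ℝ≥0∞) ^ (r + 1)
  twoPoint_le : ∀ t ∈ Finset.range (n + l + 1), qnorm (A : ℝ≥0∞)⁻¹
    (seriesL n a ^ (deltaNu n a * ((1 + t) * n)) * (seriesI n a 0 ^ 2)⁻¹) ≤ A

theorem convergent_phi_zero {n l : ℕ} {a : Fin l → ℕ} (hn : 1 ≤ n) (ha : absDeg a ≤ n) :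
    Convergent (phi n a 0) := by
  filter_upwards [(gevrey_phi hn ha).eventually_qnorm_le] with A hA
  exact ne_top_of_le_ne_top (by simp) (hA 0)

theorem exists_seriesBound {n l : ℕ} {a : Fin l → ℕ} (hn : 1 ≤ n) (ha : absDeg a ≤ n) :
    ∃ A, SeriesBound n a A := by
  have hI := (convergent_seriesI (a := a) hn 0).pow 2
  have hL := convergent_seriesL hn ha
  have h0 := convergent_phi_zero hn ha
  have h1 : ∀ᶠ A : ℕ in atTop, ∀ (p : Fin n) (b : ℕ), qnorm (A : ℝ≥0∞)⁻¹ (seriesI n a 0 ^ 2 *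
      (seriesL n a ^ (deltaNu n a * n) * phi n a 0)⁻¹ * phiP n a p b) ≤
        b ! * (A : ℝ≥0∞) ^ (b + 1) :=
    eventually_all.2 fun p =>
      ((gevrey_phiP hn ha p).convergent_mul (hI.mul ((hL.pow _).mul h0).inv)).eventually_qnorm_le
  have h2 := (Gevrey.of_convergent ((h0.pow 2).mul hI.inv)).eventually_qnorm_le
  have h3 := ((gevrey_phi hn ha).convergent_mul h0.inv).eventually_qnorm_le
  have h4 : ∀ᶠ A : ℕ in atTop, ∀ t ∈ Finset.range (n + l + 1), ∀ b : ℕ, qnorm (A : ℝ≥0∞)⁻¹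
      (seriesL n a ^ (deltaNu n a * ((1 + t) * n)) * (seriesI n a 0 ^ 2)⁻¹) ≤
        b ! * (A : ℝ≥0∞) ^ (b + 1) := by
    rw [eventually_all_finset]
    exact fun t _ => (Gevrey.of_convergent ((hL.pow _).mul hI.inv)).eventually_qnorm_le
  obtain ⟨A, g0, g1, g2, g3, g4⟩ :=
    ((eventually_ge_atTop 1).and (h1.and (h2.and (h3.and h4)))).exists
  exact ⟨A, g0, g1, by simpa using g2 0, g3, fun t ht => by simpa using g4 t ht 0⟩

/-! ### The vertices of the recursion -/

/-- The weight of a leg with index `b'`: it is `(2A)^{β+1} (β+1)!` if `b' = β ≥ 0`, and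
`1 / ((8A)^β β!)` if `b' = -1 - β < 0`. -/
def legWeight (A : ℕ) : ℤ → ℝ≥0∞
  | Int.ofNat β => (2 * A : ℝ≥0∞) ^ (β + 1) * (β + 1)!
  | Int.negSucc β => ((8 * A : ℝ≥0∞) ^ β * β !)⁻¹

theorem add_factorial_le (i j : ℕ) : (i + j)! ≤ 2 ^ (i + j) * (i ! * j !) := by
  rw [← Nat.add_choose_mul_factorial_mul_factorial, mul_assoc]
  gcongr
  exact Nat.choose_le_two_pow _ _

theorem enorm_inv_natCast {m : ℕ} (hm : m ≠ 0) : ‖((m : ℚ))⁻¹‖ₑ = (m : ℝ≥0∞)⁻¹ := by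
  rw [enorm_inv (by exact_mod_cast hm), enorm_natCast]

/-- The contribution of one leg.  If `b' = -1 - β`, the series `Φ_{p;b'+1+b''}` vanishes for
`b'' < β`, and `1/b''!` then outweighs `(b''-β)!` by the factor `1/β!` that `legWeight` records. -/
theorem qnorm_leg_le {n l : ℕ} {a : Fin l → ℕ} {A : ℕ} (hA : SeriesBound n a A) (p : Fin n)
    (b' : ℤ) (b'' : ℕ) :
    qnorm (A : ℝ≥0∞)⁻¹ (seriesI n a 0 ^ 2 * phiP n a p (b' + 1 + (b'' : ℤ)) *
      (C (b'' ! : ℚ) * seriesL n a ^ (deltaNu n a * n) * phi n a 0)⁻¹) ≤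
      A * (8 * A) ^ b'' * legWeight A b' := by
  have e : ∀ x : ℤ, seriesI n a 0 ^ 2 * phiP n a p x *
      (C (b'' ! : ℚ) * seriesL n a ^ (deltaNu n a * n) * phi n a 0)⁻¹ =
      C (b'' ! : ℚ)⁻¹ * (seriesI n a 0 ^ 2 * (seriesL n a ^ (deltaNu n a * n) * phi n a 0)⁻¹ *
        phiP n a p x) := fun x => by
    rw [mul_assoc (C (b'' ! : ℚ)), PowerSeries.mul_inv_rev (C (b'' ! : ℚ)), PowerSeries.C_inv]
    ring
  have hA0 : (A : ℝ≥0∞) ≠ 0 := by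
    have := hA.one_le
    simp
    omega
  have h1A : (1 : ℝ≥0∞) ≤ A := by exact_mod_cast hA.one_le
  have hf : ∀ k : ℕ, (k ! : ℝ≥0∞) ≠ 0 := fun k => by exact_mod_cast k.factorial_ne_zero
  rw [e, qnorm, wnorm_C_mul, enorm_inv_natCast b''.factorial_ne_zero]
  rcases b' with β | β
  · have hx : Int.ofNat β + 1 + (b'' : ℤ) = ((β + 1 + b'' : ℕ) : ℤ) := by
      rw [Int.ofNat_eq_natCast]
      push_cast
      ring
    rw [hx, legWeight]
    refine (mul_le_mul' le_rfl (hA.phiP_le p _)).trans ?_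
    rw [mul_comm, ← div_eq_mul_inv]
    refine ENNReal.div_le_of_le_mul ?_
    calc ((β + 1 + b'')! : ℝ≥0∞) * (A : ℝ≥0∞) ^ (β + 1 + b'' + 1)
        ≤ (2 ^ (β + 1 + b'') * ((β + 1)! * b'' !)) * (A : ℝ≥0∞) ^ (β + 1 + b'' + 1) := by
          gcongr
          exact_mod_cast add_factorial_le (β + 1) b''
      _ = A * (2 * A) ^ b'' * ((2 * A) ^ (β + 1) * (β + 1)!) * b'' ! := by ring
      _ ≤ _ := by
          gcongr
          norm_num
  · rw [legWeight]
    rcases lt_or_ge b'' β with h | h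
    · rw [phiP_of_neg _ _ _ _ (by omega), mul_zero, wnorm_zero, mul_zero]
      exact zero_le
    · obtain ⟨c, rfl⟩ := Nat.exists_eq_add_of_le h
      have hx : Int.negSucc β + 1 + ((β + c : ℕ) : ℤ) = (c : ℤ) := by omega
      rw [hx]
      refine (mul_le_mul' le_rfl (hA.phiP_le p _)).trans ?_
      have h8 : (8 * A : ℝ≥0∞) ^ β ≠ 0 := pow_ne_zero _ (mul_ne_zero (by norm_num) hA0)
      have h8' : (8 * A : ℝ≥0∞) ^ β ≠ ∞ := ENNReal.pow_ne_top
          (ENNReal.mul_ne_top (by simp) (by simp))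
      rw [ENNReal.mul_inv (Or.inl h8) (Or.inl h8'), pow_add _ β c]
      have e2 : (A : ℝ≥0∞) * ((8 * A) ^ β * (8 * A) ^ c) *
          (((8 * A : ℝ≥0∞) ^ β)⁻¹ * (β ! : ℝ≥0∞)⁻¹) =
          A * (8 * A) ^ c * (β ! : ℝ≥0∞)⁻¹ * ((8 * A) ^ β * ((8 * A : ℝ≥0∞) ^ β)⁻¹) := by ring
      rw [e2, ENNReal.mul_inv_cancel h8 h8', mul_one, mul_comm, ← div_eq_mul_inv]
      refine ENNReal.div_le_of_le_mul ?_
      have h3 : (c ! : ℝ≥0∞) ≤ (β ! : ℝ≥0∞)⁻¹ * ((β + c)! : ℝ≥0∞) := by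
        rw [mul_comm, ← div_eq_mul_inv, ENNReal.le_div_iff_mul_le (Or.inl (hf _)) (by simp)]
        rw [mul_comm]
        exact_mod_cast Nat.le_of_dvd (Nat.factorial_pos _)
          (Nat.factorial_mul_factorial_dvd_factorial_add β c)
      calc (c ! : ℝ≥0∞) * (A : ℝ≥0∞) ^ (c + 1)
          ≤ ((β ! : ℝ≥0∞)⁻¹ * ((β + c)! : ℝ≥0∞)) * ((8 * A) ^ c * A) := by
            rw [pow_succ]
            gcongr
            exact le_mul_of_one_le_left' (by norm_num)
        _ = _ := by ring

/-- The multinomial coefficient of a multiset of positive integers is bounded by means of the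
multinomial theorem for `∑_r 2^{-r} ≤ 2`. -/
theorem card_factorial_le (s : Multiset ℕ) :
    s.card ! ≤ 2 ^ (s.sum + s.card) * ∏ r ∈ s.toFinset, (s.count r)! := by
  have hsum : ∑ r ∈ s.toFinset, s.count r = s.card := Multiset.toFinset_sum_count_eq s
  have h1 := Nat.multinomial_spec s.toFinset fun r => s.count r
  rw [hsum] at h1
  have h2 : (∑ r ∈ s.toFinset, (2⁻¹ : ℝ≥0∞) ^ r) ^ s.card ≤ 2 ^ s.card := by
    gcongr
    refine (ENNReal.sum_le_tsum _).trans ?_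
    rw [ENNReal.tsum_geometric, ENNReal.one_sub_inv_two, inv_inv]
  rw [Finset.sum_pow_eq_sum_piAntidiag] at h2
  have h3 := (Finset.single_le_sum (f := fun k : ℕ → ℕ => (Nat.multinomial s.toFinset k : ℝ≥0∞) *
    ∏ i ∈ s.toFinset, ((2⁻¹ : ℝ≥0∞) ^ i) ^ k i) (fun _ _ => zero_le)
    (Finset.mem_piAntidiag.2 ⟨hsum, fun r hr => by
      rw [Multiset.mem_toFinset]
      exact Multiset.count_ne_zero.1 hr⟩)).trans h2
  have h4 : ∏ i ∈ s.toFinset, ((2⁻¹ : ℝ≥0∞) ^ i) ^ s.count i = (2 ^ s.sum)⁻¹ := by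
    simp_rw [← pow_mul]
    rw [Finset.prod_pow_eq_pow_sum, Finset.sum_multiset_count, ENNReal.inv_pow]
    simp [mul_comm]
  rw [h4, ← div_eq_mul_inv, ENNReal.div_le_iff (by simp) (by simp), ← pow_add] at h3
  have h5 : Nat.multinomial s.toFinset (fun r => s.count r) ≤ 2 ^ (s.card + s.sum) := by
    exact_mod_cast h3
  rw [← h1, mul_comm, add_comm s.sum]
  gcongr

/-- The factorial `(M + |c|)!` is compensated by `M!` and the `c_r!`, up to a geometric factor,
and the Gevrey growth `r!` of `Φ_r` by the denominators `(r+1)!`. -/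
theorem qnorm_phiM_le {n l : ℕ} {a : Fin l → ℕ} {A : ℕ} (hA : SeriesBound n a A) {M y : ℕ}
    (hy : y ≤ M) (c : Nat.Partition y) :
    qnorm (A : ℝ≥0∞)⁻¹ (phiM n a M c.parts) ≤ M ! * (A * (16 * A ^ 2) ^ M) := by
  set s := c.parts with hs
  have hsum : s.sum = y := c.parts_sum
  have h1A : (1 : ℝ≥0∞) ≤ A := by exact_mod_cast hA.one_le
  have hcard : s.card ≤ y := by
    rw [← hsum]
    simpa using Multiset.card_nsmul_le_sum (s := s) (a := 1) fun x hx => c.parts_pos hx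
  have hr : ∀ r ∈ s.toFinset, qnorm (A : ℝ≥0∞)⁻¹ (C (1 / ((s.count r)! : ℚ)) *
      (phi n a r * (C ((r + 1)! : ℚ) * phi n a 0)⁻¹) ^ s.count r) ≤
      ((s.count r)! : ℝ≥0∞)⁻¹ * ((A : ℝ≥0∞) ^ 2) ^ (s.count r * r) := by
    intro r hr
    have hr1 : 0 < r := c.parts_pos (Multiset.mem_toFinset.1 hr)
    rw [qnorm, wnorm_C_mul, one_div, enorm_inv_natCast (Nat.factorial_ne_zero _),
      mul_comm _ r, pow_mul]
    gcongr
    refine (qnorm_pow_le _ _ _).trans ?_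
    gcongr
    have e : phi n a r * (C ((r + 1)! : ℚ) * phi n a 0)⁻¹ =
        C ((r + 1)! : ℚ)⁻¹ * ((phi n a 0)⁻¹ * phi n a r) := by
      rw [PowerSeries.mul_inv_rev (C ((r + 1)! : ℚ)), PowerSeries.C_inv]
      ring
    rw [e, qnorm, wnorm_C_mul, enorm_inv_natCast (Nat.factorial_ne_zero _)]
    refine (mul_le_mul' le_rfl (hA.phi_le r)).trans ?_
    rw [mul_comm, ← div_eq_mul_inv]
    refine ENNReal.div_le_of_le_mul ?_
    rw [mul_comm, ← pow_mul]
    refine mul_le_mul' (pow_le_pow_right₀ h1A (by omega)) ?_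
    exact_mod_cast Nat.factorial_le (Nat.le_succ r)
  have hprod : qnorm (A : ℝ≥0∞)⁻¹ (∏ r ∈ s.toFinset, (C (1 / ((s.count r)! : ℚ)) *
      (phi n a r * (C ((r + 1)! : ℚ) * phi n a 0)⁻¹) ^ s.count r)) ≤
      ((∏ r ∈ s.toFinset, (s.count r)! : ℕ) : ℝ≥0∞)⁻¹ * ((A : ℝ≥0∞) ^ 2) ^ y := by
    refine (qnorm_prod_le _ _ _).trans ((Finset.prod_le_prod' hr).trans (le_of_eq ?_))
    rw [Finset.prod_mul_distrib, Finset.prod_pow_eq_pow_sum, Nat.cast_prod,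
      ENNReal.prod_inv_distrib]
    · congr 2
      rw [← hsum, Finset.sum_multiset_count]
      simp
    · exact fun _ _ _ _ _ => Or.inr (by simp)
  have hfac : (M + s.card)! ≤ M ! * 16 ^ M * ∏ r ∈ s.toFinset, (s.count r)! := by
    calc (M + s.card)! ≤ 2 ^ (M + s.card) * (M ! * s.card !) := add_factorial_le _ _
      _ ≤ 2 ^ (M + M) * (M ! * (2 ^ (M + M) * ∏ r ∈ s.toFinset, (s.count r)!)) := by
        have h1 := card_factorial_le s
        have h2 : s.card ! ≤ 2 ^ (M + M) * ∏ r ∈ s.toFinset, (s.count r)! := by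
          refine h1.trans ?_
          gcongr <;> omega
        gcongr
        · omega
        · omega
      _ = M ! * 16 ^ M * ∏ r ∈ s.toFinset, (s.count r)! := by
        have : 16 ^ M = 2 ^ (M + M) * 2 ^ (M + M) := by
          rw [← pow_add, show M + M + (M + M) = 4 * M by ring, pow_mul]
          norm_num
        rw [this]
        ring
  rw [phiM]
  refine (qnorm_mul_le _ _ _).trans ((mul_le_mul' ((qnorm_mul_le _ _ _).trans
    (mul_le_mul' hA.phi_zero_le (qnorm_C _ _).le)) hprod).trans ?_)
  rw [enorm_mul, enorm_natCast, enorm_pow, enorm_neg, enorm_one, one_pow, one_mul]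
  set Q := ∏ r ∈ s.toFinset, (s.count r)! with hQ
  have hQ0 : (Q : ℝ≥0∞) ≠ 0 := by
    have : Q ≠ 0 := Finset.prod_ne_zero_iff.2 fun _ _ => Nat.factorial_ne_zero _
    exact_mod_cast this
  calc (A : ℝ≥0∞) * (M + s.card)! * ((Q : ℝ≥0∞)⁻¹ * ((A : ℝ≥0∞) ^ 2) ^ y)
      ≤ (A : ℝ≥0∞) * (M ! * 16 ^ M * Q) * ((Q : ℝ≥0∞)⁻¹ * ((A : ℝ≥0∞) ^ 2) ^ M) := by
        gcongr
        · exact_mod_cast hfac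
        · exact one_le_pow₀ h1A
    _ = M ! * (A * (16 * A ^ 2) ^ M) * (Q * (Q : ℝ≥0∞)⁻¹) := by rw [mul_pow]; ring
    _ = _ := by rw [ENNReal.mul_inv_cancel hQ0 (by simp), mul_one]

/-- The number of compositions is bounded by means of `(∑_j 2^{-j})^m ≤ 2^m`. -/
theorem card_piAntidiag_univ_le {ι : Type} [Fintype ι] [DecidableEq ι] (x : ℕ) :
    (Finset.piAntidiag (Finset.univ : Finset ι) x).card ≤ 2 ^ (x + Fintype.card ι) := by
  have h1 : ∑ k ∈ Finset.piAntidiag (Finset.univ : Finset ι) x, ∏ i, (2⁻¹ : ℝ≥0∞) ^ k i ≤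
      2 ^ Fintype.card ι := by
    calc _ ≤ ∑ k ∈ Fintype.piFinset fun _ : ι => Finset.range (x + 1), ∏ i, (2⁻¹ : ℝ≥0∞) ^ k i := by
          refine Finset.sum_le_sum_of_subset fun k hk => ?_
          rw [Fintype.mem_piFinset]
          intro i
          rw [Finset.mem_range, Nat.lt_succ_iff, ← (Finset.mem_piAntidiag.1 hk).1]
          exact Finset.single_le_sum (fun _ _ => Nat.zero_le _) (Finset.mem_univ i)
      _ = ∏ _i : ι, ∑ j ∈ Finset.range (x + 1), (2⁻¹ : ℝ≥0∞) ^ j :=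
          (Finset.prod_univ_sum _ _).symm
      _ ≤ ∏ _i : ι, 2 := Finset.prod_le_prod' fun i _ => by
          refine (ENNReal.sum_le_tsum _).trans ?_
          rw [ENNReal.tsum_geometric, ENNReal.one_sub_inv_two, inv_inv]
      _ = _ := by rw [Finset.prod_const, Finset.card_univ]
  have h2 : ∀ k ∈ Finset.piAntidiag (Finset.univ : Finset ι) x,
      ∏ i, (2⁻¹ : ℝ≥0∞) ^ k i = (2 ^ x)⁻¹ := fun k hk => by
    have e := (Finset.mem_piAntidiag.1 hk).1
    change ∑ i, k i = x at e
    rw [Finset.prod_pow_eq_pow_sum, e, ENNReal.inv_pow]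
  rw [Finset.sum_congr rfl h2, Finset.sum_const, nsmul_eq_mul, ← div_eq_mul_inv,
    ENNReal.div_le_iff (by simp) (by simp), ← pow_add, add_comm] at h1
  exact_mod_cast h1

theorem card_partition_le (y : ℕ) : Fintype.card (Nat.Partition y) ≤ 2 ^ y := by
  refine (Fintype.card_le_of_surjective _ Nat.Partition.ofComposition_surj).trans ?_
  rw [composition_card]
  exact Nat.pow_le_pow_right two_pos (Nat.sub_le _ _)

/-- The bound for the vertex with `m` legs: `(m-3)!` times a geometric factor times the weights of
the legs. -/
theorem qnorm_vertexFactor_le {n l : ℕ} {a : Fin l → ℕ} {A : ℕ} (hA : SeriesBound n a A)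
    {ι : Type} [Fintype ι] [DecidableEq ι] (hι : 3 ≤ Fintype.card ι) (p' : ι → Fin n)
    (b' : ι → ℤ) :
    qnorm (A : ℝ≥0∞)⁻¹ (mk fun d' => vertexFactor n a p' b' d') ≤
      (Fintype.card ι - 3)! * ((2048 * A ^ 5 : ℕ) : ℝ≥0∞) ^ Fintype.card ι *
        ∏ i, legWeight A (b' i) := by
  set m := Fintype.card ι with hm
  set M := m - 3 with hM
  have h1A : (1 : ℝ≥0∞) ≤ A := by exact_mod_cast hA.one_le
  have e : (mk fun d' => vertexFactor n a p' b' d') =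
      ∑ x ∈ Finset.HasAntidiagonal.antidiagonal M,
        ∑ b'' ∈ Finset.piAntidiag (Finset.univ : Finset ι) x.1, ∑ c : Nat.Partition x.2,
          (phiM n a M c.parts *
            ∏ i, (seriesI n a 0 ^ 2 * phiP n a (p' i) (b' i + 1 + (b'' i : ℤ)) *
              (C ((b'' i)! : ℚ) * seriesL n a ^ (deltaNu n a * n) * phi n a 0)⁻¹)) := by
    ext d
    simp only [coeff_mk, map_sum, vertexFactor, hM, hm]
  rw [e]
  set W := ∏ i, legWeight A (b' i) with hW
  set T : ℝ≥0∞ := M ! * (A * (16 * A ^ 2) ^ M) * (A ^ m * (8 * A) ^ M * W) with hT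
  clear_value T
  have hterm : ∀ x ∈ Finset.HasAntidiagonal.antidiagonal M,
      ∀ b'' ∈ Finset.piAntidiag (Finset.univ : Finset ι) x.1, ∀ c : Nat.Partition x.2,
      qnorm (A : ℝ≥0∞)⁻¹ (phiM n a M c.parts *
            ∏ i, (seriesI n a 0 ^ 2 * phiP n a (p' i) (b' i + 1 + (b'' i : ℤ)) *
              (C ((b'' i)! : ℚ) * seriesL n a ^ (deltaNu n a * n) * phi n a 0)⁻¹)) ≤ T := by
    intro x hx b'' hb c
    have hxs := Finset.HasAntidiagonal.mem_antidiagonal.1 hx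
    have hbs := (Finset.mem_piAntidiag.1 hb).1
    change ∑ i, b'' i = x.1 at hbs
    rw [hT]
    refine (qnorm_mul_le _ _ _).trans (mul_le_mul' (qnorm_phiM_le hA (by omega) c) ?_)
    refine (qnorm_prod_le _ _ _).trans ((Finset.prod_le_prod' fun i _ =>
      qnorm_leg_le hA (p' i) (b' i) (b'' i)).trans ?_)
    rw [Finset.prod_mul_distrib, Finset.prod_mul_distrib, Finset.prod_pow_eq_pow_sum, hbs,
      Finset.prod_const, Finset.card_univ, ← hm]
    gcongr
    · exact one_le_mul (by norm_num) h1A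
    · omega
  have hcount : ∑ x ∈ Finset.HasAntidiagonal.antidiagonal M,
        ∑ b'' ∈ Finset.piAntidiag (Finset.univ : Finset ι) x.1, ∑ c : Nat.Partition x.2, T ≤
      (2 ^ m * 4 ^ m * 2 ^ m) * T := by
    calc _ ≤ ∑ x ∈ Finset.HasAntidiagonal.antidiagonal M, (4 ^ m * 2 ^ m) * T := by
          refine Finset.sum_le_sum fun x hx => ?_
          have hxs := Finset.HasAntidiagonal.mem_antidiagonal.1 hx
          rw [Finset.sum_const, Finset.sum_const, Finset.card_univ, nsmul_eq_mul, nsmul_eq_mul,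
            ← mul_assoc]
          gcongr
          · have h1 : (Finset.piAntidiag (Finset.univ : Finset ι) x.1).card ≤ 4 ^ m := by
              refine (card_piAntidiag_univ_le x.1).trans ?_
              rw [show 4 = 2 ^ 2 by norm_num, ← pow_mul]
              exact Nat.pow_le_pow_right two_pos (by omega)
            exact_mod_cast h1
          · have h1 : Fintype.card (Nat.Partition x.2) ≤ 2 ^ m :=
              (card_partition_le x.2).trans (Nat.pow_le_pow_right two_pos (by omega))
            exact_mod_cast h1
      _ ≤ _ := by
          rw [Finset.sum_const, Finset.Nat.card_antidiagonal, nsmul_eq_mul, ← mul_assoc,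
            ← mul_assoc]
          gcongr
          have h1 : M + 1 ≤ 2 ^ m :=
            Nat.lt_two_pow_self.le.trans (Nat.pow_le_pow_right two_pos (by omega))
          exact_mod_cast h1
  refine (wnorm_sum_le _ _ _).trans ((Finset.sum_le_sum fun x hx => (wnorm_sum_le _ _ _).trans
    (Finset.sum_le_sum fun b'' hb => (wnorm_sum_le _ _ _).trans (Finset.sum_le_sum fun c _ =>
      hterm x hx b'' hb c))).trans (hcount.trans ?_))
  have hMm : M ≤ m := by omega
  have hAm : (A : ℝ≥0∞) ≤ A ^ m := le_self_pow₀ h1A (by omega)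
  calc (2 ^ m * 4 ^ m * 2 ^ m) * T
      ≤ (2 ^ m * 4 ^ m * 2 ^ m) *
          (M ! * (A ^ m * (16 * A ^ 2) ^ m) * (A ^ m * (8 * A) ^ m * W)) := by
        rw [hT]
        gcongr
        · exact one_le_mul (by norm_num) (one_le_pow₀ h1A)
        · exact one_le_mul (by norm_num) h1A
    _ = M ! * ((2 * 4 * 2 * A * (16 * A ^ 2) * A * (8 * A) : ℝ≥0∞)) ^ m * W := by
        simp only [mul_pow]
        ring
    _ = _ := by
        congr 3
        push_cast
        ring

/-! ### Sums over set partitions -/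

theorem sum_piAntidiag_cons {ι : Type*} [DecidableEq ι] (y : ℕ → ℝ≥0) (i : ι) (s : Finset ι)
    (hi : i ∉ s) (k : ℕ) :
    ∑ κ ∈ Finset.piAntidiag (Finset.cons i s hi) k, ∏ t ∈ Finset.cons i s hi, y (κ t) =
      ∑ x ∈ Finset.HasAntidiagonal.antidiagonal k,
        y x.1 * ∑ κ ∈ Finset.piAntidiag s x.2, ∏ t ∈ s, y (κ t) := by
  rw [Finset.piAntidiag_cons, Finset.sum_disjiUnion]
  refine Finset.sum_congr rfl fun x _ => ?_
  rw [Finset.sum_map, Finset.mul_sum]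
  refine Finset.sum_congr rfl fun κ hκ => ?_
  have h0 : κ i = 0 := by
    by_contra h
    exact hi ((Finset.mem_piAntidiag.1 hκ).2 i h)
  rw [Finset.prod_cons]
  congr 1
  · simp [h0]
  · refine Finset.prod_congr rfl fun t ht => ?_
    have : t ≠ i := fun h => hi (h ▸ ht)
    simp [this]

theorem sum_inv_sq_le_two (k : ℕ) : ∑ a ∈ Finset.range (k + 1), ((a : ℝ≥0) ^ 2)⁻¹ ≤ 2 := by
  have h : ∀ k : ℕ, ∑ a ∈ Finset.range (k + 2), ((a : ℝ) ^ 2)⁻¹ ≤ 2 - 1 / ((k : ℝ) + 1) := by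
    intro k
    induction k with
    | zero => norm_num [Finset.sum_range_succ]
    | succ k ih =>
      rw [Finset.sum_range_succ]
      have h1 : (((k + 2 : ℕ) : ℝ) ^ 2)⁻¹ ≤ 1 / ((k : ℝ) + 1) - 1 / ((k : ℝ) + 1 + 1) := by
        push_cast
        rw [div_sub_div _ _ (by positivity) (by positivity), ← one_div,
          div_le_div_iff₀ (by positivity) (by positivity)]
        nlinarith [(Nat.cast_nonneg k : (0 : ℝ) ≤ k)]
      push_cast at h1 ⊢
      linarith
  rcases k with _ | k
  · simp
  · rw [← NNReal.coe_le_coe]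
    push_cast
    refine (h k).trans ?_
    have : (0 : ℝ) ≤ 1 / ((k : ℝ) + 1) := by positivity
    linarith

/-- The bound also holds if `a` or `b` is zero, since then the left-hand side is zero by the
convention `0⁻¹ = 0`. -/
theorem inv_sq_mul_inv_sq_le (a b : ℕ) :
    ((a : ℝ≥0) ^ 2)⁻¹ * ((b : ℝ≥0) ^ 2)⁻¹ ≤
      2 * (((a + b : ℕ) : ℝ≥0) ^ 2)⁻¹ * (((a : ℝ≥0) ^ 2)⁻¹ + ((b : ℝ≥0) ^ 2)⁻¹) := by
  rcases Nat.eq_zero_or_pos a with rfl | ha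
  · simp
  rcases Nat.eq_zero_or_pos b with rfl | hb
  · simp
  rw [← NNReal.coe_le_coe]
  push_cast
  have ha' : (0 : ℝ) < a := by exact_mod_cast ha
  have hb' : (0 : ℝ) < b := by exact_mod_cast hb
  have e : 2 * (((a : ℝ) + b) ^ 2)⁻¹ * (((a : ℝ) ^ 2)⁻¹ + ((b : ℝ) ^ 2)⁻¹) -
      ((a : ℝ) ^ 2)⁻¹ * ((b : ℝ) ^ 2)⁻¹ =
      ((a : ℝ) - b) ^ 2 * ((((a : ℝ) + b) ^ 2)⁻¹ * ((a : ℝ) ^ 2)⁻¹ * ((b : ℝ) ^ 2)⁻¹) := by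
    field_simp
    ring
  have : 0 ≤ ((a : ℝ) - b) ^ 2 * ((((a : ℝ) + b) ^ 2)⁻¹ * ((a : ℝ) ^ 2)⁻¹ * ((b : ℝ) ^ 2)⁻¹) := by
    positivity
  linarith

theorem sum_antidiagonal_inv_sq_le (k : ℕ) :
    ∑ x ∈ Finset.HasAntidiagonal.antidiagonal k, ((x.1 : ℝ≥0) ^ 2)⁻¹ * ((x.2 : ℝ≥0) ^ 2)⁻¹ ≤
      8 * ((k : ℝ≥0) ^ 2)⁻¹ := by
  have h1 : ∑ x ∈ Finset.HasAntidiagonal.antidiagonal k, ((x.1 : ℝ≥0) ^ 2)⁻¹ ≤ 2 := by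
    rw [Finset.Nat.sum_antidiagonal_eq_sum_range_succ_mk]
    exact sum_inv_sq_le_two k
  have h2 : ∑ x ∈ Finset.HasAntidiagonal.antidiagonal k, ((x.2 : ℝ≥0) ^ 2)⁻¹ ≤ 2 := by
    rw [← Finset.Nat.sum_antidiagonal_swap]
    exact h1
  calc _ ≤ ∑ x ∈ Finset.HasAntidiagonal.antidiagonal k,
        2 * ((k : ℝ≥0) ^ 2)⁻¹ * (((x.1 : ℝ≥0) ^ 2)⁻¹ + ((x.2 : ℝ≥0) ^ 2)⁻¹) := by
        refine Finset.sum_le_sum fun x hx => ?_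
        rw [← Finset.HasAntidiagonal.mem_antidiagonal.1 hx]
        exact inv_sq_mul_inv_sq_le _ _
    _ ≤ 2 * ((k : ℝ≥0) ^ 2)⁻¹ * (2 + 2) := by
        rw [← Finset.mul_sum, Finset.sum_add_distrib]
        gcongr
    _ = _ := by ring

/-- The sequence `1/k²` is, up to a constant, stable under convolution. -/
theorem sum_piAntidiag_inv_sq_le {ι : Type*} [DecidableEq ι] {s : Finset ι} (hs : s.Nonempty) :
    ∀ k : ℕ, ∑ κ ∈ Finset.piAntidiag s k, ∏ t ∈ s, ((κ t : ℝ≥0) ^ 2)⁻¹ ≤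
      8 ^ s.card * ((k : ℝ≥0) ^ 2)⁻¹ := by
  induction hs using Finset.Nonempty.cons_induction with
  | singleton i =>
    intro k
    have := sum_piAntidiag_cons (fun k => ((k : ℝ≥0) ^ 2)⁻¹) i ∅ (Finset.notMem_empty i) k
    rw [Finset.cons_eq_insert, insert_empty_eq] at this
    rw [this, Finset.sum_eq_single (k, 0)]
    · simp only [Finset.piAntidiag_zero, Finset.prod_empty, Finset.sum_singleton, mul_one,
        Finset.card_singleton, pow_one]
      exact le_mul_of_one_le_left' (by norm_num)
    · rintro ⟨x, y⟩ hx hne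
      have hy : y ≠ 0 := by
        rintro rfl
        simp at hx
        exact hne (by simp [hx])
      simp [Finset.piAntidiag_empty_of_ne_zero hy]
    · intro h
      simp at h
  | cons i s hi hs ih =>
    intro k
    rw [sum_piAntidiag_cons (fun k => ((k : ℝ≥0) ^ 2)⁻¹) i s hi k, Finset.card_cons]
    calc _ ≤ ∑ x ∈ Finset.HasAntidiagonal.antidiagonal k,
          8 ^ s.card * (((x.1 : ℝ≥0) ^ 2)⁻¹ * ((x.2 : ℝ≥0) ^ 2)⁻¹) := by
          refine Finset.sum_le_sum fun x _ => ?_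
          rw [mul_left_comm]
          gcongr
          exact ih _
      _ ≤ 8 ^ s.card * (8 * ((k : ℝ≥0) ^ 2)⁻¹) := by
          rw [← Finset.mul_sum]
          gcongr
          exact sum_antidiagonal_inv_sq_le k
      _ = _ := by ring

/-- The exponential formula: the maps with fibres of cardinalities `κ_i` are counted by a
multinomial coefficient. -/
theorem sum_prod_fiber_eq (j k : ℕ) (y : ℕ → ℝ≥0) :
    ∑ f : Fin k → Fin j, ∏ i, ((Finset.univ.filter fun x => f x = i).card ! *
        y (Finset.univ.filter fun x => f x = i).card) =
      k ! * ∑ κ ∈ Finset.piAntidiag (Finset.univ : Finset (Fin j)) k, ∏ i, y (κ i) := by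
  -- Both sides are values of the linear functional `x^κ ↦ ∏ κ_i! y(κ_i)` at `(∑ x_i)^k`.
  set Λ : MvPolynomial (Fin j) ℝ≥0 →ₗ[ℝ≥0] ℝ≥0 := (MvPolynomial.basisMonomials (Fin j) ℝ≥0).constr
    ℝ≥0 fun κ => ∏ i, ((κ i)! * y (κ i) : ℝ≥0) with hΛ
  have hΛm : ∀ κ : Fin j → ℕ, Λ (∏ i, MvPolynomial.X i ^ κ i) = ∏ i, ((κ i)! * y (κ i) : ℝ≥0) := by
    intro κ
    have e : ∏ i, (MvPolynomial.X i : MvPolynomial (Fin j) ℝ≥0) ^ κ i =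
        MvPolynomial.basisMonomials (Fin j) ℝ≥0 (Finsupp.equivFunOnFinite.symm κ) := by
      rw [MvPolynomial.coe_basisMonomials]
      dsimp only
      rw [MvPolynomial.monomial_eq, map_one, one_mul,
        Finsupp.prod_fintype _ _ (fun _ => pow_zero _)]
      rfl
    rw [e, hΛ, Module.Basis.constr_basis]
    rfl
  have h1 : Λ ((∑ i, MvPolynomial.X i) ^ k) = ∑ f : Fin k → Fin j,
      ∏ i, ((Finset.univ.filter fun x => f x = i).card ! *
        y (Finset.univ.filter fun x => f x = i).card) := by
    rw [Fintype.sum_pow, map_sum]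
    refine Finset.sum_congr rfl fun f _ => ?_
    rw [← hΛm]
    congr 1
    rw [← Finset.prod_fiberwise Finset.univ f]
    refine Finset.prod_congr rfl fun i _ => ?_
    rw [Finset.prod_congr rfl (g := fun _ => MvPolynomial.X i)
      (fun x hx => by rw [(Finset.mem_filter.1 hx).2]), Finset.prod_const]
  rw [← h1, Finset.sum_pow_eq_sum_piAntidiag, map_sum, Finset.mul_sum]
  refine Finset.sum_congr rfl fun κ hκ => ?_
  have hsum := (Finset.mem_piAntidiag.1 hκ).1
  change ∑ i, κ i = k at hsum
  rw [← nsmul_eq_mul, map_nsmul, hΛm, nsmul_eq_mul, Finset.prod_mul_distrib, ← mul_assoc]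
  congr 1
  have := Nat.multinomial_spec Finset.univ κ
  rw [hsum, mul_comm] at this
  rw [← Nat.cast_prod, ← Nat.cast_mul, this]

/-- The set partitions of `{0, …, k}` that have the last element as a block, and `j` other
blocks. -/
def lastSingleton (k j : ℕ) : Finset (Finpartition (Finset.univ : Finset (Fin (k + 1)))) :=
  Finset.univ.filter fun P => {Fin.last k} ∈ P.parts ∧ P.parts.card = j + 1

theorem last_notMem {k : ℕ} {P : Finpartition (Finset.univ : Finset (Fin (k + 1)))}
    (h : {Fin.last k} ∈ P.parts) {S : Finset (Fin (k + 1))}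
    (hS : S ∈ P.parts.erase {Fin.last k}) : Fin.last k ∉ S := by
  intro hl
  rw [Finset.mem_erase] at hS
  exact hS.1 (P.eq_of_mem_parts hS.2 h hl (Finset.mem_singleton_self _))

theorem part_castSucc_mem {k : ℕ} {P : Finpartition (Finset.univ : Finset (Fin (k + 1)))}
    (x : Fin k) : P.part x.castSucc ∈ P.parts.erase {Fin.last k} := by
  rw [Finset.mem_erase]
  refine ⟨fun h => ?_, P.part_mem.2 (Finset.mem_univ _)⟩
  have := P.mem_part (Finset.mem_univ x.castSucc)
  rw [h, Finset.mem_singleton] at this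
  exact (Fin.castSucc_lt_last x).ne this

/-- The map to `Fin j` given by a partition in `lastSingleton k j` and a numbering of its blocks
other than the last singleton. -/
def labelling {k j : ℕ} (x : Σ P : lastSingleton k j, P.1.parts.erase {Fin.last k} ≃ Fin j) :
    Fin k → Fin j := fun s => x.2 ⟨x.1.1.part s.castSucc, part_castSucc_mem s⟩

theorem coe_symm_eq_map_fiber {k j : ℕ}
    (x : Σ P : lastSingleton k j, P.1.parts.erase {Fin.last k} ≃ Fin j) (i : Fin j) :
    ((x.2.symm i : _) : Finset (Fin (k + 1))) =
      (Finset.univ.filter fun s => labelling x s = i).map Fin.castSuccEmb := by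
  obtain ⟨⟨P, hP⟩, σ⟩ := x
  have hl := (Finset.mem_filter.1 hP).2.1
  have hS := (σ.symm i).2
  have hS' := (Finset.mem_erase.1 hS).2
  ext s
  refine Fin.lastCases ?_ (fun s => ?_) s
  · refine iff_of_false (last_notMem hl hS) fun h => ?_
    obtain ⟨s, -, hs⟩ := Finset.mem_map.1 h
    exact (Fin.castSucc_lt_last s).ne hs
  · have h1 : s.castSucc ∈ (Finset.univ.filter fun s => labelling ⟨⟨P, hP⟩, σ⟩ s = i).map
        Fin.castSuccEmb ↔ labelling ⟨⟨P, hP⟩, σ⟩ s = i := by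
      rw [← Fin.coe_castSuccEmb, Finset.mem_map']
      simp
    rw [h1, labelling, ← Equiv.eq_symm_apply, Subtype.ext_iff]
    constructor
    · exact fun h => P.part_eq_of_mem hS' h
    · intro h
      have := P.mem_part (Finset.mem_univ s.castSucc)
      dsimp only at h
      rwa [h] at this

theorem labelling_injective (k j : ℕ) : Function.Injective (labelling (k := k) (j := j)) := by
  intro x x' h
  have h1 : ∀ i, ((x.2.symm i : _) : Finset (Fin (k + 1))) = (x'.2.symm i : _) := fun i => by
    rw [coe_symm_eq_map_fiber, coe_symm_eq_map_fiber, h]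
  obtain ⟨⟨P, hP⟩, σ⟩ := x
  obtain ⟨⟨P', hP'⟩, σ'⟩ := x'
  have h2 : P.parts.erase {Fin.last k} = P'.parts.erase {Fin.last k} := by
    ext S
    constructor
    · intro hS
      have := h1 (σ ⟨S, hS⟩)
      dsimp only at this
      rw [Equiv.symm_apply_apply] at this
      dsimp only at this
      rw [this]
      exact (σ'.symm _).2
    · intro hS
      have := h1 (σ' ⟨S, hS⟩)
      dsimp only at this
      rw [Equiv.symm_apply_apply] at this
      dsimp only at this
      rw [← this]
      exact (σ.symm _).2
  have h3 : P = P' := by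
    apply Finpartition.ext
    rw [← Finset.insert_erase (Finset.mem_filter.1 hP).2.1, h2,
      Finset.insert_erase (Finset.mem_filter.1 hP').2.1]
  subst h3
  congr 1
  have : σ.symm = σ'.symm := Equiv.ext fun i => Subtype.ext (h1 i)
  exact Equiv.symm_bijective.injective this

/-- Each partition in `lastSingleton k j` arises from `j!` maps `Fin k → Fin j`. -/
theorem sum_lastSingleton_le (k j : ℕ) (h : ℕ → ℝ≥0) :
    j ! * ∑ P ∈ lastSingleton k j, ∏ S ∈ P.parts.erase {Fin.last k}, h S.card ≤
      ∑ f : Fin k → Fin j, ∏ i, h (Finset.univ.filter fun x => f x = i).card := by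
  have h1 : ∑ x : Σ P : lastSingleton k j, P.1.parts.erase {Fin.last k} ≃ Fin j,
      ∏ S ∈ x.1.1.parts.erase {Fin.last k}, h S.card =
      j ! * ∑ P ∈ lastSingleton k j, ∏ S ∈ P.parts.erase {Fin.last k}, h S.card := by
    rw [Fintype.sum_sigma, Finset.mul_sum, ← Finset.sum_coe_sort (lastSingleton k j)]
    refine Finset.sum_congr rfl fun P _ => ?_
    dsimp only
    have hP := (Finset.mem_filter.1 P.2).2
    have hc : Fintype.card (P.1.parts.erase {Fin.last k}) = j := by
      rw [Fintype.card_coe, Finset.card_erase_of_mem hP.1, hP.2, Nat.add_sub_cancel]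
    rw [Finset.sum_const, Finset.card_univ, Fintype.card_equiv (Fintype.equivFinOfCardEq hc), hc,
      nsmul_eq_mul]
  rw [← h1]
  calc _ = ∑ x : Σ P : lastSingleton k j, P.1.parts.erase {Fin.last k} ≃ Fin j,
        ∏ i, h (Finset.univ.filter fun s => labelling x s = i).card := by
        refine Finset.sum_congr rfl fun x _ => ?_
        rw [← Finset.prod_coe_sort, ← x.2.symm.prod_comp]
        refine Finset.prod_congr rfl fun i _ => ?_
        rw [coe_symm_eq_map_fiber, Finset.card_map]
    _ = ∑ f ∈ Finset.univ.map ⟨labelling, labelling_injective k j⟩,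
        ∏ i, h (Finset.univ.filter fun s => f s = i).card := by
        rw [Finset.sum_map]
        rfl
    _ ≤ _ := Finset.sum_le_sum_of_subset (Finset.subset_univ _)

/-- The majorant `k! (K/M) M^k / k²` for the structure constants with `k + 1` marked points; it
is used for `k ≥ 1` only.  The factor `1/k²` makes it stable under convolution up to constants. -/
def majorant (K M : ℝ≥0) (k : ℕ) : ℝ≥0 := k ! * (K / M * M ^ k * ((k : ℝ≥0) ^ 2)⁻¹)

theorem sum_lastSingleton_majorant_le (K : ℝ≥0) {M : ℝ≥0} (k : ℕ) {j : ℕ} (hj : 1 ≤ j) :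
    j ! * ∑ P ∈ lastSingleton k j, ∏ S ∈ P.parts.erase {Fin.last k}, majorant K M S.card ≤
      k ! * ((8 * K / M) ^ j * M ^ k * ((k : ℝ≥0) ^ 2)⁻¹) := by
  refine (sum_lastSingleton_le k j _).trans ?_
  unfold majorant
  rw [sum_prod_fiber_eq j k fun k => K / M * M ^ k * ((k : ℝ≥0) ^ 2)⁻¹]
  gcongr
  have h1 : ∀ κ ∈ Finset.piAntidiag (Finset.univ : Finset (Fin j)) k,
      ∏ i, (K / M * M ^ κ i * ((κ i : ℝ≥0) ^ 2)⁻¹) =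
        (K / M) ^ j * M ^ k * ∏ i, ((κ i : ℝ≥0) ^ 2)⁻¹ := fun κ hκ => by
    have hsum := (Finset.mem_piAntidiag.1 hκ).1
    change ∑ i, κ i = k at hsum
    rw [Finset.prod_mul_distrib, Finset.prod_mul_distrib, Finset.prod_pow_eq_pow_sum, hsum,
      Finset.prod_const, Finset.card_univ, Fintype.card_fin]
  rw [Finset.sum_congr rfl h1, ← Finset.mul_sum]
  have : Nonempty (Fin j) := ⟨⟨0, hj⟩⟩
  have h2 := sum_piAntidiag_inv_sq_le (Finset.univ_nonempty (α := Fin j)) k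
  rw [Finset.card_univ, Fintype.card_fin] at h2
  calc _ ≤ (K / M) ^ j * M ^ k * (8 ^ j * ((k : ℝ≥0) ^ 2)⁻¹) := by gcongr
    _ = _ := by
      rw [mul_div_assoc, mul_pow]
      ring

/-- The set partitions that occur in the recursion for the structure constants with `k + 1` marked
points. -/
def recursionPartitions (k : ℕ) : Finset (Finpartition (Finset.univ : Finset (Fin (k + 1)))) :=
  Finset.univ.filter fun P => {Fin.last k} ∈ P.parts ∧ 3 ≤ P.parts.card

/-- If `M` is large, the majorant solves the recursion with an inequality.  The recursion has at
least two blocks beside the last singleton, which yields a factor `M⁻²`, whereas the majorant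
contains only `M⁻¹`. -/
theorem sum_recursionPartitions_le {K M B : ℝ≥0} (hM : M ≠ 0) (hKB : 16 * (K * B) ≤ M) (k : ℕ) :
    ∑ P ∈ recursionPartitions k, ((P.parts.card - 3)! : ℝ≥0) * B ^ P.parts.card *
        ∏ S ∈ P.parts.erase {Fin.last k}, majorant K M S.card ≤
      k ! * (128 * B * (K * B / M) ^ 2 * M ^ k * ((k : ℝ≥0) ^ 2)⁻¹) := by
  set r : ℝ≥0 := 8 * (K * B) / M with hr
  have hr2 : r ≤ 2⁻¹ := by
    rw [hr, div_le_iff₀ (pos_iff_ne_zero.2 hM)]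
    calc 8 * (K * B) = 2⁻¹ * (16 * (K * B)) := by
          rw [← NNReal.coe_inj]
          push_cast
          ring
      _ ≤ _ := by gcongr
  have hmaps : ∀ P ∈ recursionPartitions k, P.parts.card - 3 ∈ Finset.range (k + 1) := by
    intro P _
    have := P.card_parts_le_card
    rw [Finset.card_univ, Fintype.card_fin] at this
    rw [Finset.mem_range]
    omega
  rw [← Finset.sum_fiberwise_of_maps_to hmaps]
  have hi : ∀ i ∈ Finset.range (k + 1), ∑ P ∈ recursionPartitions k with P.parts.card - 3 = i,
      ((P.parts.card - 3)! : ℝ≥0) * B ^ P.parts.card *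
        ∏ S ∈ P.parts.erase {Fin.last k}, majorant K M S.card ≤
      k ! * (64 * B * (K * B / M) ^ 2 * M ^ k * ((k : ℝ≥0) ^ 2)⁻¹) * 2⁻¹ ^ i := by
    intro i _
    have e : (recursionPartitions k).filter (fun P => P.parts.card - 3 = i) =
        lastSingleton k (i + 2) := by
      ext P
      simp only [recursionPartitions, lastSingleton, Finset.mem_filter, Finset.mem_univ, true_and]
      constructor
      · rintro ⟨⟨h1, h2⟩, h3⟩
        exact ⟨h1, by omega⟩
      · rintro ⟨h1, h2⟩
        exact ⟨⟨h1, by omega⟩, by omega⟩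
    rw [e]
    have hc : ∀ P ∈ lastSingleton k (i + 2), P.parts.card = i + 3 := fun P hP =>
      (Finset.mem_filter.1 hP).2.2
    calc _ = B ^ (i + 3) * (i ! * ∑ P ∈ lastSingleton k (i + 2),
          ∏ S ∈ P.parts.erase {Fin.last k}, majorant K M S.card) := by
          rw [Finset.mul_sum, Finset.mul_sum]
          refine Finset.sum_congr rfl fun P hP => ?_
          rw [hc P hP, Nat.add_sub_cancel]
          ring
      _ ≤ B ^ (i + 3) * (k ! * ((8 * K / M) ^ (i + 2) * M ^ k * ((k : ℝ≥0) ^ 2)⁻¹)) := by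
          refine mul_le_mul' le_rfl (le_trans (mul_le_mul' ?_ le_rfl)
            (sum_lastSingleton_majorant_le K k (by omega : 1 ≤ i + 2)))
          exact_mod_cast Nat.factorial_le (by omega)
      _ = k ! * (64 * B * (K * B / M) ^ 2 * M ^ k * ((k : ℝ≥0) ^ 2)⁻¹) * r ^ i := by
          have e2 : r = 8 * K / M * B := by rw [hr]; ring
          have e3 : 64 * B * (K * B / M) ^ 2 = B ^ 3 * (8 * K / M) ^ 2 := by
            rw [show (64 : ℝ≥0) = 8 ^ 2 by norm_num]
            ring
          rw [e2, e3, mul_pow, pow_add, pow_add]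
          ring
      _ ≤ _ := by gcongr
  refine (Finset.sum_le_sum hi).trans ?_
  rw [← Finset.mul_sum]
  have hgeom : ∑ i ∈ Finset.range (k + 1), (2⁻¹ : ℝ≥0) ^ i ≤ 2 := by
    have h1 : ((∑ i ∈ Finset.range (k + 1), (2⁻¹ : ℝ≥0) ^ i : ℝ≥0) : ℝ≥0∞) ≤ 2 := by
      push_cast
      refine (ENNReal.sum_le_tsum _).trans ?_
      rw [ENNReal.tsum_geometric, ENNReal.one_sub_inv_two, inv_inv]
    exact_mod_cast h1
  calc _ ≤ k ! * (64 * B * (K * B / M) ^ 2 * M ^ k * ((k : ℝ≥0) ^ 2)⁻¹) * 2 := by gcongr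
    _ = _ := by ring

/-! ### The recursion in terms of norms -/

theorem coeff_prod_univ {ι : Type*} [Fintype ι] [DecidableEq ι] (f : ι → PowerSeries ℚ) (d : ℕ) :
    coeff d (∏ i, f i) =
      ∑ e ∈ Finset.piAntidiag (Finset.univ : Finset ι) d, ∏ i, coeff (e i) (f i) := by
  rw [coeff_prod]
  refine Finset.sum_nbij' (fun x => ⇑x) (fun e => Finsupp.equivFunOnFinite.symm e) ?_ ?_ ?_ ?_ ?_
  · intro x hx
    rw [Finset.mem_finsuppAntidiag] at hx
    exact Finset.mem_piAntidiag.2 ⟨hx.1, fun _ _ => Finset.mem_univ _⟩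
  · intro e he
    rw [Finset.mem_finsuppAntidiag]
    exact ⟨(Finset.mem_piAntidiag.1 he).1, Finset.subset_univ _⟩
  · intro x _
    ext
    rfl
  · intro e _
    rfl
  · intro x _
    rfl

/-- For fixed `p'`, `b'` and `t'`, the generating function in `q^{d'}` of the factors
`vertexFactor` that occur in the recursion: the other degrees `d'` are cut off by `InS`. -/
def vertexSeries (n : ℕ) {l : ℕ} (a : Fin l → ℕ) {ι : Type} [Fintype ι] [DecidableEq ι]
    (p' : ι → Fin n) (b' : ι → ℤ) (t' : ℤ) : PowerSeries ℚ :=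
  mk fun d' => if InS n a p' b' d' t' then vertexFactor n a p' b' d' else 0

/-- Since `n ≥ 1`, the degree `d'` determines `t'` in the condition `InS`. -/
theorem tsum_qnorm_vertexSeries_le {n l : ℕ} {a : Fin l → ℕ} (hn : 1 ≤ n) {ι : Type} [Fintype ι]
    [DecidableEq ι] (p' : ι → Fin n) (b' : ι → ℤ) (σ : ℤ) (ρ : ℝ≥0∞) :
    ∑' t : ℕ, qnorm ρ (vertexSeries n a p' b' ((t : ℤ) - σ)) ≤
      qnorm ρ (mk fun d' => vertexFactor n a p' b' d') := by
  simp only [qnorm, wnorm]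
  rw [ENNReal.tsum_comm]
  refine ENNReal.tsum_le_tsum fun d => ?_
  simp only [vertexSeries, coeff_mk]
  by_cases h : ∃ t : ℕ, InS n a p' b' d ((t : ℤ) - σ)
  · obtain ⟨t, ht⟩ := h
    rw [tsum_eq_single t, if_pos ht]
    intro s hs
    rw [if_neg, enorm_zero, zero_mul]
    intro hs'
    apply hs
    unfold InS at ht hs'
    rw [ht] at hs'
    have hn' : (n : ℤ) ≠ 0 := by omega
    have := mul_left_cancel₀ hn' (add_left_cancel hs')
    omega
  · push Not at h
    simp [h]

/-- The generating function over the degree of the factors of the recursion that come from blocks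
with `k` elements. -/
def blockSeries (n : ℕ) {l : ℕ} (a : Fin l → ℕ) (k : ℕ) (q : Fin k → Fin n) (c : Fin k → ℤ)
    (p' : Fin n) (b' : ℤ) (τ : ℕ) : PowerSeries ℚ :=
  mk fun e => if b' < 0 ∧ 2 ≤ k then 0 else
    structConst n a (k + 1) (Fin.snoc (α := fun _ => Fin n) q p')
      (Fin.snoc (α := fun _ => ℤ) c b') e τ

/-- The sum of the norms of all generating functions of structure constants with the first `k`
marked points given by `q` and `c`, weighted by `legWeight` at the last marked point. -/
def blockNorm (n : ℕ) {l : ℕ} (a : Fin l → ℕ) (A k : ℕ) (q : Fin k → Fin n) (c : Fin k → ℤ) :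
    ℝ≥0∞ :=
  ∑ p' : Fin n, ∑' b' : ℤ, ∑' τ : ℕ,
    legWeight A b' * qnorm (A : ℝ≥0∞)⁻¹ (blockSeries n a k q c p' b' τ)

/-- The factor of the recursion that comes from the block `S`. -/
def partSeries (n : ℕ) {l : ℕ} (a : Fin l → ℕ) {k : ℕ} (p : Fin (k + 1) → Fin n)
    (b : Fin (k + 1) → ℤ) (S : Finset (Fin (k + 1))) (p' : Fin n) (b' : ℤ) (τ : ℕ) :
    PowerSeries ℚ :=
  if S.card < k then
    blockSeries n a S.card (fun i => p (S.orderEmbOfFin rfl i))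
      (fun i => b (S.orderEmbOfFin rfl i)) p' b' τ
  else 0

theorem mk_structConst_eq (n : ℕ) {l : ℕ} (a : Fin l → ℕ) {k : ℕ} (hk : 2 ≤ k)
    (p : Fin (k + 1) → Fin n) (b : Fin (k + 1) → ℤ) (t : ℕ) :
    (mk fun d => structConst n a (k + 1) p b d t) =
      ∑ P ∈ recursionPartitions k, ∑ p' : P.parts → Fin n,
        ∑ b' ∈ Fintype.piFinset fun S : P.parts =>
            Finset.Icc (-1 - ∑ s ∈ S.1, |b s|) ((k + 1 : ℕ) : ℤ),
          ∑ τ ∈ Fintype.piFinset fun _ : P.parts => Finset.range (k + 1 + 1),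
            vertexSeries n a p' b' ((t : ℤ) - ∑ S, (τ S : ℤ)) *
              ∏ S : P.parts, partSeries n a p b S.1 (p' S) (b' S) (τ S) := by
  ext d
  rw [coeff_mk, structConst, dif_neg (by omega), dif_pos (by omega)]
  simp only [map_sum, recursionPartitions]
  rw [Finset.sum_filter]
  refine Finset.sum_congr rfl fun P _ => if_congr Iff.rfl ?_ rfl
  refine Finset.sum_congr rfl fun p' _ => Finset.sum_congr rfl fun b' _ =>
    Finset.sum_congr rfl fun τ _ => ?_
  rw [coeff_mul, Finset.Nat.sum_antidiagonal_eq_sum_range_succ fun i j =>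
    coeff i (vertexSeries n a p' b' ((t : ℤ) - ∑ S, (τ S : ℤ))) *
      coeff j (∏ S : P.parts, partSeries n a p b S.1 (p' S) (b' S) (τ S))]
  refine Finset.sum_congr rfl fun d' _ => ?_
  rw [coeff_prod_univ, Finset.mul_sum]
  refine Finset.sum_congr rfl fun e _ => ?_
  rw [vertexSeries, coeff_mk]
  by_cases hS : InS n a p' b' d' ((t : ℤ) - ∑ S, (τ S : ℤ))
  · rw [if_pos hS, if_pos hS, mul_comm]
    congr 1
    refine Finset.prod_congr rfl fun S _ => ?_
    rw [partSeries]
    by_cases h : S.1.card < k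
    · rw [if_pos h, blockSeries, coeff_mk, dif_pos (by omega)]
    · rw [if_neg h, dif_neg (by omega), ite_self, map_zero]
  · rw [if_neg hS, if_neg hS, zero_mul]

/-- The sums over the tuples indexed by the blocks factor into sums for the individual blocks, which
may then be extended to all integers `b'` and all `τ`. -/
theorem prod_sum_mul_tsum_le {k : ℕ} {P : Finset (Finset (Fin (k + 1)))} {n : ℕ}
    (I : P → Finset ℤ) (J : P → Finset ℕ) (w : ℤ → ℝ≥0∞) (x : P → Fin n → ℤ → ℕ → ℝ≥0∞) :
    ∑ p' : P → Fin n, ∑ b' ∈ Fintype.piFinset I, ∑ τ ∈ Fintype.piFinset J,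
        ∏ S, (w (b' S) * x S (p' S) (b' S) (τ S)) ≤
      ∏ S, ∑ p', ∑' b' : ℤ, ∑' τ : ℕ, w b' * x S p' b' τ := by
  calc _ = ∏ S, ∑ p', ∑ b' ∈ I S, ∑ τ ∈ J S, w b' * x S p' b' τ := by
        rw [Finset.prod_univ_sum, Fintype.piFinset_univ]
        refine Finset.sum_congr rfl fun p' _ => ?_
        rw [Finset.prod_univ_sum]
        refine Finset.sum_congr rfl fun b' _ => ?_
        rw [Finset.prod_univ_sum]
    _ ≤ _ := Finset.prod_le_prod' fun S _ => Finset.sum_le_sum fun p' _ =>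
        (Finset.sum_le_sum fun b' _ => ENNReal.sum_le_tsum _).trans (ENNReal.sum_le_tsum _)

/-- The recursion, as an inequality between norms. -/
theorem tsum_qnorm_structConst_le {n l : ℕ} {a : Fin l → ℕ} {A : ℕ} (hn : 1 ≤ n)
    (hA : SeriesBound n a A) {k : ℕ} (hk : 2 ≤ k) (p : Fin (k + 1) → Fin n)
    (b : Fin (k + 1) → ℤ) :
    ∑' t : ℕ, qnorm (A : ℝ≥0∞)⁻¹ (mk fun d => structConst n a (k + 1) p b d t) ≤
      ∑ P ∈ recursionPartitions k, ((P.parts.card - 3)! : ℝ≥0∞) *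
        ((2048 * A ^ 5 : ℕ) : ℝ≥0∞) ^ P.parts.card * ∏ S : P.parts,
          ∑ p', ∑' b' : ℤ, ∑' τ : ℕ,
            legWeight A b' * qnorm (A : ℝ≥0∞)⁻¹ (partSeries n a p b S.1 p' b' τ) := by
  set ρ : ℝ≥0∞ := (A : ℝ≥0∞)⁻¹ with hρ
  calc _ ≤ ∑' t : ℕ, ∑ P ∈ recursionPartitions k, ∑ p' : P.parts → Fin n,
        ∑ b' ∈ Fintype.piFinset fun S : P.parts =>
            Finset.Icc (-1 - ∑ s ∈ S.1, |b s|) ((k + 1 : ℕ) : ℤ),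
          ∑ τ ∈ Fintype.piFinset fun _ : P.parts => Finset.range (k + 1 + 1),
            qnorm ρ (vertexSeries n a p' b' ((t : ℤ) - ∑ S, (τ S : ℤ))) *
              ∏ S : P.parts, qnorm ρ (partSeries n a p b S.1 (p' S) (b' S) (τ S)) := by
        refine ENNReal.tsum_le_tsum fun t => ?_
        rw [mk_structConst_eq n a hk p b t]
        refine (wnorm_sum_le _ _ _).trans (Finset.sum_le_sum fun P _ => ?_)
        refine (wnorm_sum_le _ _ _).trans (Finset.sum_le_sum fun p' _ => ?_)
        refine (wnorm_sum_le _ _ _).trans (Finset.sum_le_sum fun b' _ => ?_)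
        refine (wnorm_sum_le _ _ _).trans (Finset.sum_le_sum fun τ _ => ?_)
        exact (qnorm_mul_le _ _ _).trans (mul_le_mul' le_rfl (qnorm_prod_le _ _ _))
    _ = ∑ P ∈ recursionPartitions k, ∑ p' : P.parts → Fin n,
        ∑ b' ∈ Fintype.piFinset fun S : P.parts =>
            Finset.Icc (-1 - ∑ s ∈ S.1, |b s|) ((k + 1 : ℕ) : ℤ),
          ∑ τ ∈ Fintype.piFinset fun _ : P.parts => Finset.range (k + 1 + 1),
            (∑' t : ℕ, qnorm ρ (vertexSeries n a p' b' ((t : ℤ) - ∑ S, (τ S : ℤ)))) *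
              ∏ S : P.parts, qnorm ρ (partSeries n a p b S.1 (p' S) (b' S) (τ S)) := by
        rw [Summable.tsum_finsetSum fun _ _ => ENNReal.summable]
        refine Finset.sum_congr rfl fun P _ => ?_
        rw [Summable.tsum_finsetSum fun _ _ => ENNReal.summable]
        refine Finset.sum_congr rfl fun p' _ => ?_
        rw [Summable.tsum_finsetSum fun _ _ => ENNReal.summable]
        refine Finset.sum_congr rfl fun b' _ => ?_
        rw [Summable.tsum_finsetSum fun _ _ => ENNReal.summable]
        refine Finset.sum_congr rfl fun τ _ => ?_
        rw [ENNReal.tsum_mul_right]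
    _ ≤ ∑ P ∈ recursionPartitions k, ((P.parts.card - 3)! : ℝ≥0∞) *
        ((2048 * A ^ 5 : ℕ) : ℝ≥0∞) ^ P.parts.card * ∑ p' : P.parts → Fin n,
        ∑ b' ∈ Fintype.piFinset fun S : P.parts =>
            Finset.Icc (-1 - ∑ s ∈ S.1, |b s|) ((k + 1 : ℕ) : ℤ),
          ∑ τ ∈ Fintype.piFinset fun _ : P.parts => Finset.range (k + 1 + 1),
            ∏ S : P.parts, (legWeight A (b' S) *
              qnorm ρ (partSeries n a p b S.1 (p' S) (b' S) (τ S))) := by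
        refine Finset.sum_le_sum fun P hP => ?_
        have hc : 3 ≤ Fintype.card P.parts := by
          rw [Fintype.card_coe]
          exact (Finset.mem_filter.1 hP).2.2
        simp only [Finset.mul_sum]
        refine Finset.sum_le_sum fun p' _ => Finset.sum_le_sum fun b' _ =>
          Finset.sum_le_sum fun τ _ => ?_
        rw [Finset.prod_mul_distrib, ← mul_assoc]
        refine mul_le_mul' ?_ le_rfl
        have := qnorm_vertexFactor_le hA hc p' b'
        rw [Fintype.card_coe] at this
        exact (tsum_qnorm_vertexSeries_le hn p' b' _ ρ).trans this
    _ ≤ _ := Finset.sum_le_sum fun P _ => mul_le_mul' le_rfl (prod_sum_mul_tsum_le _ _ _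
        fun S p' b' τ => qnorm ρ (partSeries n a p b S.1 p' b' τ))

/-! ### The bound for the structure constants -/

theorem enorm_neg_one_pow (k : ℕ) : ‖(-1 : ℚ) ^ k‖ₑ = 1 := by
  rw [enorm_pow, enorm_neg, enorm_one, one_pow]

/-- A block with one element contributes only for `b' = -1 - β` and for boundedly many `τ`. -/
theorem qnorm_blockSeries_one_le {n l : ℕ} {a : Fin l → ℕ} {A : ℕ} (hA : SeriesBound n a A)
    (hn : 1 ≤ n) (q : Fin 1 → Fin n) (β : ℕ) (p' : Fin n) (b' : ℤ) (τ : ℕ) :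
    qnorm (A : ℝ≥0∞)⁻¹ (blockSeries n a 1 q (fun _ => (β : ℤ)) p' b' τ) ≤
      if b' = Int.negSucc β ∧ τ ∈ Finset.range (n + l + 1) then (A : ℝ≥0∞) else 0 := by
  have e : blockSeries n a 1 q (fun _ => (β : ℤ)) p' b' τ =
      mk fun d => twoPointConst n a (q 0) p' β b' d τ := by
    ext d
    rw [blockSeries, coeff_mk, coeff_mk, if_neg (by omega), structConst, dif_pos rfl]
    rfl
  rw [e]
  by_cases h : (β : ℤ) + b' = -1 ∧ (q 0 : ℕ) + p' + n * τ + 1 = n + l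
  · have hτ : τ < n + l + 1 := by
      have : τ ≤ n * τ := Nat.le_mul_of_pos_left τ hn
      omega
    rw [if_pos ⟨by omega, Finset.mem_range.2 hτ⟩]
    have e2 : (mk fun d => twoPointConst n a (q 0) p' β b' d τ) = C ((-1 : ℚ) ^ β) *
        (seriesL n a ^ (deltaNu n a * ((1 + τ) * n)) * (seriesI n a 0 ^ 2)⁻¹) := by
      ext d
      rw [coeff_mk, twoPointConst, if_pos ⟨by omega, h⟩, coeff_C_mul, Int.toNat_natCast]
    rw [e2, qnorm, wnorm_C_mul, enorm_neg_one_pow, one_mul]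
    exact hA.twoPoint_le τ (Finset.mem_range.2 hτ)
  · have e2 : (mk fun d => twoPointConst n a (q 0) p' β b' d τ) = 0 := by
      ext d
      rw [coeff_mk, twoPointConst, if_neg fun h' => h h'.2, map_zero]
    rw [e2, qnorm, wnorm_zero]
    exact zero_le

theorem blockNorm_one_le {n l : ℕ} {a : Fin l → ℕ} {A : ℕ} (hA : SeriesBound n a A) (hn : 1 ≤ n)
    (q : Fin 1 → Fin n) (β : ℕ) :
    blockNorm n a A 1 q (fun _ => (β : ℤ)) ≤
      ((n * (n + l + 1) * A : ℕ) : ℝ≥0∞) * legWeight A (Int.negSucc β) := by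
  have h : ∀ p' : Fin n, ∑' b' : ℤ, ∑' τ : ℕ, legWeight A b' *
      qnorm (A : ℝ≥0∞)⁻¹ (blockSeries n a 1 q (fun _ => (β : ℤ)) p' b' τ) ≤
      ((n + l + 1 : ℕ) : ℝ≥0∞) * (A * legWeight A (Int.negSucc β)) := by
    intro p'
    calc _ ≤ ∑' b' : ℤ, ∑' τ : ℕ, legWeight A b' *
          (if b' = Int.negSucc β ∧ τ ∈ Finset.range (n + l + 1) then (A : ℝ≥0∞) else 0) :=
          ENNReal.tsum_le_tsum fun b' => ENNReal.tsum_le_tsum fun τ =>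
            mul_le_mul' le_rfl (qnorm_blockSeries_one_le hA hn q β p' b' τ)
      _ = _ := by
          rw [tsum_eq_single (Int.negSucc β), tsum_eq_sum (s := Finset.range (n + l + 1))]
          · rw [Finset.sum_congr rfl fun τ hτ => by rw [if_pos ⟨rfl, hτ⟩], Finset.sum_const,
              Finset.card_range, nsmul_eq_mul, mul_comm (A : ℝ≥0∞)]
          · intro τ hτ
            rw [if_neg fun h => hτ h.2, mul_zero]
          · intro b' hb'
            simp [hb']
  refine (Finset.sum_le_sum fun p' _ => h p').trans (le_of_eq ?_)
  rw [Finset.sum_const, Finset.card_univ, Fintype.card_fin, nsmul_eq_mul]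
  push_cast
  ring

theorem legWeight_negSucc_le {A : ℕ} (hA : 1 ≤ A) (β : ℕ) :
    legWeight A (Int.negSucc β) ≤ (β ! : ℝ≥0∞)⁻¹ := by
  have h1A : (1 : ℝ≥0∞) ≤ A := by exact_mod_cast hA
  rw [legWeight]
  gcongr
  exact le_mul_of_one_le_left' (one_le_pow₀ (one_le_mul (by norm_num) h1A))

theorem factorial_le_legWeight {A : ℕ} (hA : 1 ≤ A) (β : ℕ) :
    (β ! : ℝ≥0∞) ≤ legWeight A β := by
  have h1A : (1 : ℝ≥0∞) ≤ A := by exact_mod_cast hA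
  change _ ≤ (2 * A : ℝ≥0∞) ^ (β + 1) * (β + 1)!
  calc (β ! : ℝ≥0∞) ≤ (β + 1)! := by exact_mod_cast Nat.factorial_le (Nat.le_succ β)
    _ ≤ _ := le_mul_of_one_le_left' (one_le_pow₀ (one_le_mul (by norm_num) h1A))

/-- The two weights at an edge of the recursion, with indices `β` and `-1 - β`, cancel up to a
geometric sequence. -/
theorem tsum_legWeight_mul_le {A : ℕ} (hA : 1 ≤ A) :
    ∑' β : ℕ, legWeight A β * legWeight A (Int.negSucc β) ≤ ((4 * A : ℕ) : ℝ≥0∞) := by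
  have hA0 : (A : ℝ≥0∞) ≠ 0 := by
    simp
    omega
  have h : ∀ β : ℕ, legWeight A β * legWeight A (Int.negSucc β) ≤ 2 * A * 2⁻¹ ^ β := by
    intro β
    have h0 : (8 * A : ℝ≥0∞) ^ β * β ! ≠ 0 := mul_ne_zero (pow_ne_zero _ (mul_ne_zero (by norm_num)
      hA0)) (by exact_mod_cast β.factorial_ne_zero)
    have h1 : (8 * A : ℝ≥0∞) ^ β * β ! ≠ ∞ :=
      ENNReal.mul_ne_top (ENNReal.pow_ne_top (ENNReal.mul_ne_top (by simp) (by simp))) (by simp)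
    change (2 * A : ℝ≥0∞) ^ (β + 1) * (β + 1)! * ((8 * A : ℝ≥0∞) ^ β * β !)⁻¹ ≤ _
    rw [← div_eq_mul_inv, ENNReal.div_le_iff h0 h1]
    have h2 : ((β + 1 : ℕ) : ℝ≥0∞) ≤ 2 ^ β := by exact_mod_cast Nat.lt_two_pow_self
    have h3 : (2 : ℝ≥0∞)⁻¹ ^ β * 8 ^ β = 2 ^ β * 2 ^ β := by
      rw [show (8 : ℝ≥0∞) = 2 * (2 * 2) by norm_num, mul_pow 2 (2 * 2 : ℝ≥0∞) β, ← mul_assoc,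
        ← mul_pow, ENNReal.inv_mul_cancel (by simp) (by simp), one_pow, one_mul, mul_pow]
    calc (2 * A : ℝ≥0∞) ^ (β + 1) * (β + 1)!
        = 2 * A * (2 ^ β * A ^ β * β !) * ((β + 1 : ℕ) : ℝ≥0∞) := by
          rw [Nat.factorial_succ, Nat.cast_mul, pow_succ, mul_pow]
          ring
      _ ≤ 2 * A * (2 ^ β * A ^ β * β !) * 2 ^ β := by gcongr
      _ = 2 * A * (2 ^ β * 2 ^ β) * (A ^ β * β !) := by ring
      _ = _ := by
          rw [← h3, mul_pow]
          ring
  refine (ENNReal.tsum_le_tsum h).trans (le_of_eq ?_)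
  rw [ENNReal.tsum_mul_left, ENNReal.tsum_geometric, ENNReal.one_sub_inv_two, inv_inv]
  push_cast
  ring

theorem prod_orderEmb {N : ℕ} (S : Finset (Fin N)) (f : Fin N → ℝ≥0∞) :
    ∏ i, f (S.orderEmbOfFin rfl i) = ∏ s ∈ S, f s := by
  conv_rhs => rw [← Finset.map_orderEmbOfFin_univ S rfl, Finset.prod_map]
  rfl

theorem prod_parts {N : ℕ} (P : Finpartition (Finset.univ : Finset (Fin N))) (f : Fin N → ℝ≥0∞) :
    ∏ S ∈ P.parts, ∏ s ∈ S, f s = ∏ s, f s := by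
  conv_rhs => rw [← P.biUnion_parts, Finset.prod_biUnion P.disjoint]
  rfl

/-- The factor of the block `S` in the recursion, if the structure constants with fewer marked
points are bounded by the majorant. -/
theorem sum_partSeries_le {n l : ℕ} {a : Fin l → ℕ} {A : ℕ} (hA : SeriesBound n a A) (hn : 1 ≤ n)
    {K M : ℝ≥0} (hK : K = ((n * (n + l + 1) * A : ℕ) : ℝ≥0)) {k : ℕ}
    (ih : ∀ j, 1 ≤ j → j < k → ∀ (q : Fin j → Fin n) (c : Fin j → ℕ),
      blockNorm n a A j q (fun s => (c s : ℤ)) ≤ majorant K M j * ∏ s, ((c s)! : ℝ≥0∞)⁻¹)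
    (p : Fin (k + 1) → Fin n) (b : Fin k → ℕ) (β : ℕ) {S : Finset (Fin (k + 1))}
    (hS : S.Nonempty) (hl : Fin.last k ∈ S → S = {Fin.last k}) :
    ∑ p', ∑' b' : ℤ, ∑' τ : ℕ, legWeight A b' * qnorm (A : ℝ≥0∞)⁻¹
        (partSeries n a p (fun s => ((Fin.snoc (α := fun _ => ℕ) b β s : ℕ) : ℤ)) S p' b' τ) ≤
      (if S = {Fin.last k} then K * legWeight A (Int.negSucc β) else (majorant K M S.card : ℝ≥0∞)) *
        ∏ s ∈ S, Fin.snoc (α := fun _ => ℝ≥0∞) (fun s => ((b s)! : ℝ≥0∞)⁻¹) 1 s := by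
  by_cases hk : S.card < k
  swap
  · simp [partSeries, hk, qnorm, wnorm_zero]
  simp only [partSeries, if_pos hk]
  change blockNorm n a A S.card _ _ ≤ _
  split_ifs with h1
  · have h2 : ∀ j (q : Fin j → Fin n) (c : Fin j → ℤ), j = 1 → (∀ i, c i = β) →
        blockNorm n a A j q c ≤ K * legWeight A (Int.negSucc β) := by
      rintro j q c rfl hc
      obtain rfl : c = fun _ => (β : ℤ) := funext hc
      rw [hK]
      exact_mod_cast blockNorm_one_le hA hn q β
    refine (h2 _ _ _ (by rw [h1, Finset.card_singleton]) fun i => ?_).trans (le_of_eq ?_)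
    · have : S.orderEmbOfFin rfl i ∈ ({Fin.last k} : Finset _) :=
        h1 ▸ Finset.orderEmbOfFin_mem S rfl i
      rw [Finset.mem_singleton.1 this, Fin.snoc_last]
    · rw [h1, Finset.prod_singleton, Fin.snoc_last, mul_one]
  · refine (ih _ (Finset.card_pos.2 hS) hk _ _).trans (mul_le_mul' le_rfl (le_of_eq ?_))
    rw [prod_orderEmb S fun s => (((Fin.snoc (α := fun _ => ℕ) b β s)! : ℕ) : ℝ≥0∞)⁻¹]
    refine Finset.prod_congr rfl fun s hs => ?_
    refine Fin.lastCases (fun hs => ?_) (fun s _ => ?_) s hs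
    · exact absurd (hl hs) h1
    · rw [Fin.snoc_castSucc, Fin.snoc_castSucc]

theorem eq_singleton_last {k : ℕ} {P : Finpartition (Finset.univ : Finset (Fin (k + 1)))}
    (h : {Fin.last k} ∈ P.parts) {S : Finset (Fin (k + 1))} (hS : S ∈ P.parts)
    (hl : Fin.last k ∈ S) : S = {Fin.last k} :=
  P.eq_of_mem_parts hS h hl (Finset.mem_singleton_self _)

/-- The recursion, after the majorant has been inserted for all blocks other than that of the last
marked point. -/
theorem tsum_qnorm_structConst_snoc_le {n l : ℕ} {a : Fin l → ℕ} {A : ℕ} (hA : SeriesBound n a A)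
    (hn : 1 ≤ n) {K M B : ℝ≥0} (hK : K = ((n * (n + l + 1) * A : ℕ) : ℝ≥0))
    (hB : B = ((2048 * A ^ 5 : ℕ) : ℝ≥0)) (hM : M ≠ 0) (hKB : 16 * (K * B) ≤ M)
    {k : ℕ} (hk : 2 ≤ k)
    (ih : ∀ j, 1 ≤ j → j < k → ∀ (q : Fin j → Fin n) (c : Fin j → ℕ),
      blockNorm n a A j q (fun s => (c s : ℤ)) ≤ majorant K M j * ∏ s, ((c s)! : ℝ≥0∞)⁻¹)
    (p : Fin (k + 1) → Fin n) (b : Fin k → ℕ) (β : ℕ) :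
    ∑' t : ℕ, qnorm (A : ℝ≥0∞)⁻¹ (mk fun d => structConst n a (k + 1) p
        (fun s => ((Fin.snoc (α := fun _ => ℕ) b β s : ℕ) : ℤ)) d t) ≤
      K * legWeight A (Int.negSucc β) * (∏ s, ((b s)! : ℝ≥0∞)⁻¹) *
        ((k ! * (128 * B * (K * B / M) ^ 2 * M ^ k * ((k : ℝ≥0) ^ 2)⁻¹) : ℝ≥0) : ℝ≥0∞) := by
  refine (tsum_qnorm_structConst_le hn hA hk p _).trans ?_
  set Q := ∏ s, ((b s)! : ℝ≥0∞)⁻¹ with hQ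
  calc _ ≤ ∑ P ∈ recursionPartitions k, ((P.parts.card - 3)! : ℝ≥0∞) * (B : ℝ≥0∞) ^ P.parts.card *
        (K * legWeight A (Int.negSucc β) *
          (∏ S ∈ P.parts.erase {Fin.last k}, (majorant K M S.card : ℝ≥0∞)) * Q) := by
        refine Finset.sum_le_sum fun P hP => ?_
        have hl := (Finset.mem_filter.1 hP).2.1
        rw [hB]
        refine mul_le_mul' (by simp) ?_
        refine (Finset.prod_le_prod' fun S _ => sum_partSeries_le hA hn hK ih p b β
          (P.nonempty_of_mem_parts S.2) (eq_singleton_last hl S.2)).trans (le_of_eq ?_)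
        rw [Finset.prod_coe_sort P.parts fun S : Finset (Fin (k + 1)) =>
          (if S = {Fin.last k} then K * legWeight A (Int.negSucc β)
            else (majorant K M S.card : ℝ≥0∞)) *
          ∏ s ∈ S, Fin.snoc (α := fun _ => ℝ≥0∞) (fun s => ((b s)! : ℝ≥0∞)⁻¹) 1 s,
          Finset.prod_mul_distrib, prod_parts, Fin.prod_univ_castSucc]
        simp only [Fin.snoc_castSucc, Fin.snoc_last, mul_one]
        congr 1
        rw [← Finset.mul_prod_erase _ _ hl, if_pos rfl]
        congr 1
        exact Finset.prod_congr rfl fun S hS => if_neg (Finset.ne_of_mem_erase hS)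
    _ = K * legWeight A (Int.negSucc β) * Q *
        ((∑ P ∈ recursionPartitions k, ((P.parts.card - 3)! : ℝ≥0) * B ^ P.parts.card *
          ∏ S ∈ P.parts.erase {Fin.last k}, majorant K M S.card : ℝ≥0) : ℝ≥0∞) := by
        push_cast
        rw [Finset.mul_sum]
        refine Finset.sum_congr rfl fun P _ => ?_
        ring
    _ ≤ _ := by
        gcongr
        exact sum_recursionPartitions_le hM hKB k

/-- The majorant bounds the structure constants: the inductive step gains a factor
`512 n A K² B³ / M ≤ 1`. -/
theorem blockNorm_le {n l : ℕ} {a : Fin l → ℕ} {A : ℕ} (hA : SeriesBound n a A)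
    (hn : 1 ≤ n) {K M B : ℝ≥0} (hK : K = ((n * (n + l + 1) * A : ℕ) : ℝ≥0))
    (hB : B = ((2048 * A ^ 5 : ℕ) : ℝ≥0)) (hM : M ≠ 0) (hKB : 16 * (K * B) ≤ M)
    (hM2 : 512 * (n * A) * K ^ 2 * B ^ 3 ≤ M) (k : ℕ) :
    1 ≤ k → ∀ (q : Fin k → Fin n) (c : Fin k → ℕ),
      blockNorm n a A k q (fun s => (c s : ℤ)) ≤ majorant K M k * ∏ s, ((c s)! : ℝ≥0∞)⁻¹ := by
  induction k using Nat.strong_induction_on with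
  | _ k ih =>
  intro hk q c
  rcases eq_or_lt_of_le hk with rfl | hk
  · have e : (fun s : Fin 1 => (c s : ℤ)) = fun _ => ((c 0 : ℕ) : ℤ) :=
      funext fun s => by rw [Subsingleton.elim s 0]
    have hmaj : majorant K M 1 = K := by
      simp [majorant, div_mul_cancel₀ K hM]
    rw [e, hmaj, Fin.prod_univ_one]
    refine (blockNorm_one_le hA hn q (c 0)).trans ?_
    rw [hK, ENNReal.coe_natCast]
    gcongr
    exact legWeight_negSucc_le hA.one_le _
  set Q := ∏ s, ((c s)! : ℝ≥0∞)⁻¹ with hQ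
  set R : ℝ≥0 := k ! * (128 * B * (K * B / M) ^ 2 * M ^ k * ((k : ℝ≥0) ^ 2)⁻¹) with hR
  have h1 : ∀ p' : Fin n, ∑' b' : ℤ, ∑' τ : ℕ, legWeight A b' *
      qnorm (A : ℝ≥0∞)⁻¹ (blockSeries n a k q (fun s => (c s : ℤ)) p' b' τ) ≤
      K * Q * R * ((4 * A : ℕ) : ℝ≥0∞) := by
    intro p'
    have hinj : Function.Injective (fun β : ℕ => (β : ℤ)) := Nat.cast_injective
    -- blocks with at least two elements contribute only for `b' ≥ 0`
    rw [← hinj.tsum_eq]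
    · calc _ ≤ ∑' β : ℕ, K * Q * R * (legWeight A β * legWeight A (Int.negSucc β)) := by
            refine ENNReal.tsum_le_tsum fun β => ?_
            rw [ENNReal.tsum_mul_left]
            have h2 := tsum_qnorm_structConst_snoc_le hA hn hK hB hM hKB hk
              (fun j h1 h2 => ih j h2 h1) (Fin.snoc (α := fun _ => Fin n) q p') c β
            calc _ ≤ legWeight A β * (K * legWeight A (Int.negSucc β) * Q * R) := by
                  refine mul_le_mul' le_rfl (le_trans (le_of_eq (tsum_congr fun t => ?_)) h2)
                  congr 1
                  ext d
                  rw [blockSeries, coeff_mk, coeff_mk, if_neg (by omega)]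
                  congr 1
                  funext s
                  refine Fin.lastCases ?_ (fun s => ?_) s
                  · rw [Fin.snoc_last, Fin.snoc_last]
                  · rw [Fin.snoc_castSucc, Fin.snoc_castSucc]
              _ = _ := by ring
        _ ≤ _ := by
            rw [ENNReal.tsum_mul_left]
            gcongr
            exact tsum_legWeight_mul_le hA.one_le
    · intro b' hb'
      rw [Function.mem_support] at hb'
      by_contra h
      apply hb'
      have hneg : b' < 0 := by
        by_contra h0
        exact h ⟨b'.toNat, by
          dsimp only
          omega⟩
      have e0 : ∀ τ, blockSeries n a k q (fun s => (c s : ℤ)) p' b' τ = 0 := fun τ => by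
        ext d
        rw [blockSeries, coeff_mk, if_pos ⟨hneg, hk⟩, map_zero]
      simp [e0, qnorm, wnorm_zero]
  calc _ ≤ (n : ℝ≥0∞) * (K * Q * R * ((4 * A : ℕ) : ℝ≥0∞)) := by
        refine (Finset.sum_le_sum fun p' _ => h1 p').trans (le_of_eq ?_)
        rw [Finset.sum_const, Finset.card_univ, Fintype.card_fin, nsmul_eq_mul]
    _ = ((n * (K * R * (4 * A)) : ℝ≥0) : ℝ≥0∞) * Q := by
        push_cast
        ring
    _ ≤ _ := by
        gcongr
        rw [majorant, hR]
        have h3 : 512 * (n * A) * K ^ 2 * B ^ 3 * M⁻¹ ≤ 1 := by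
          rw [← div_eq_mul_inv]
          exact div_le_one_of_le₀ hM2 zero_le
        calc _ = (512 * (n * A) * K ^ 2 * B ^ 3 * M⁻¹) *
              (k ! * (K / M * M ^ k * ((k : ℝ≥0) ^ 2)⁻¹)) := by
              rw [div_eq_mul_inv, div_eq_mul_inv]
              ring
          _ ≤ 1 * (k ! * (K / M * M ^ k * ((k : ℝ≥0) ^ 2)⁻¹)) := by gcongr
          _ = _ := one_mul _

/-- The weight `legWeight A β ≥ β!` at the last marked point supplies the missing factor of
`1 / b!`. -/
theorem enorm_structConst_le {n l : ℕ} {a : Fin l → ℕ} {A : ℕ} (hA : SeriesBound n a A)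
    {K M : ℝ≥0} (h : ∀ k, 1 ≤ k → ∀ (q : Fin k → Fin n) (c : Fin k → ℕ),
      blockNorm n a A k q (fun s => (c s : ℤ)) ≤ majorant K M k * ∏ s, ((c s)! : ℝ≥0∞)⁻¹)
    {k : ℕ} (hk : 1 ≤ k) (p : Fin (k + 1) → Fin n) (b : Fin (k + 1) → ℕ) (d t : ℕ) :
    ‖structConst n a (k + 1) p (fun s => (b s : ℤ)) d t‖ₑ ≤
      (A : ℝ≥0∞) ^ d * majorant K M k * ∏ s, ((b s)! : ℝ≥0∞)⁻¹ := by
  set c := structConst n a (k + 1) p (fun s => (b s : ℤ)) d t with hc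
  set β := b (Fin.last k) with hβ
  have hA0 : (A : ℝ≥0∞) ≠ 0 := by
    have := hA.one_le
    simp
    omega
  have h1 : legWeight A β * (‖c‖ₑ * (A : ℝ≥0∞)⁻¹ ^ d) ≤
      blockNorm n a A k (fun s => p s.castSucc) (fun s => (b s.castSucc : ℤ)) := by
    have e : coeff d (blockSeries n a k (fun s => p s.castSucc) (fun s => (b s.castSucc : ℤ))
        (p (Fin.last k)) β t) = c := by
      rw [blockSeries, coeff_mk, if_neg (by omega), hc]
      congr 1
      · funext s
        refine Fin.lastCases ?_ (fun s => ?_) s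
        · rw [Fin.snoc_last]
        · rw [Fin.snoc_castSucc]
      · funext s
        refine Fin.lastCases ?_ (fun s => ?_) s
        · rw [Fin.snoc_last]
        · rw [Fin.snoc_castSucc]
    calc _ ≤ legWeight A β * qnorm (A : ℝ≥0∞)⁻¹ (blockSeries n a k (fun s => p s.castSucc)
          (fun s => (b s.castSucc : ℤ)) (p (Fin.last k)) β t) := by
          rw [← e]
          exact mul_le_mul' le_rfl (enorm_coeff_mul_le _ _ d)
      _ ≤ ∑' τ : ℕ, legWeight A β * qnorm (A : ℝ≥0∞)⁻¹ (blockSeries n a k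
          (fun s => p s.castSucc) (fun s => (b s.castSucc : ℤ)) (p (Fin.last k)) β τ) :=
          ENNReal.le_tsum t
      _ ≤ ∑' b' : ℤ, ∑' τ : ℕ, legWeight A b' * qnorm (A : ℝ≥0∞)⁻¹ (blockSeries n a k
          (fun s => p s.castSucc) (fun s => (b s.castSucc : ℤ)) (p (Fin.last k)) b' τ) :=
          ENNReal.le_tsum (β : ℤ)
      _ ≤ _ := Finset.single_le_sum (f := fun p' : Fin n => ∑' b' : ℤ, ∑' τ : ℕ,
          legWeight A b' * qnorm (A : ℝ≥0∞)⁻¹ (blockSeries n a k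
            (fun s => p s.castSucc) (fun s => (b s.castSucc : ℤ)) p' b' τ))
          (fun _ _ => zero_le) (Finset.mem_univ (p (Fin.last k)))
  have h2 := h1.trans (h k hk _ _)
  have h3 := (mul_le_mul' (factorial_le_legWeight hA.one_le β) le_rfl).trans h2
  have hf : (β ! : ℝ≥0∞) ≠ 0 := by exact_mod_cast β.factorial_ne_zero
  calc ‖c‖ₑ = (A : ℝ≥0∞) ^ d * (β ! : ℝ≥0∞)⁻¹ * (β ! * (‖c‖ₑ * (A : ℝ≥0∞)⁻¹ ^ d)) := by
        rw [← ENNReal.inv_pow]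
        have e1 : ∀ x y x' y' : ℝ≥0∞, x * y' * (y * (‖c‖ₑ * x')) = ‖c‖ₑ * (x * x') * (y * y') :=
          fun _ _ _ _ => by ring
        rw [e1, ENNReal.mul_inv_cancel (pow_ne_zero _ hA0) (ENNReal.pow_ne_top (by simp)),
          ENNReal.mul_inv_cancel hf (by simp), mul_one, mul_one]
    _ ≤ _ := mul_le_mul' le_rfl h3
    _ = _ := by
        rw [Fin.prod_univ_castSucc]
        ring

/-- The statement of the theorem in terms of extended non-negative reals. -/
theorem exists_enorm_structConst_le {n l : ℕ} {a : Fin l → ℕ} (hn : 1 ≤ n) (ha : absDeg a ≤ n) :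
    ∃ C : ℕ, 0 < C ∧ ∀ N : ℕ, 3 ≤ N → ∀ (d : ℕ) (p : Fin N → Fin n) (b : Fin N → ℕ),
      ‖structConst n a N p (fun s => (b s : ℤ)) d 0‖ₑ ≤
        (((N ! : ℝ≥0) / (∏ s, ((b s)! : ℝ≥0)) * (C : ℝ≥0) ^ (N + d) : ℝ≥0) : ℝ≥0∞) := by
  obtain ⟨A, hA⟩ := exists_seriesBound hn ha
  have hA1 := hA.one_le
  obtain ⟨K, hK⟩ : ∃ K, K = n * (n + l + 1) * A := ⟨_, rfl⟩
  obtain ⟨B, hB⟩ : ∃ B, B = 2048 * A ^ 5 := ⟨_, rfl⟩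
  -- This is the smallest `M` for which the inductive step of `blockNorm_le` applies.
  obtain ⟨M, hM⟩ : ∃ M, M = 512 * (n * A) * K ^ 2 * B ^ 3 := ⟨_, rfl⟩
  have hK1 : 1 ≤ K := by
    rw [hK]
    exact Nat.mul_pos (Nat.mul_pos hn (Nat.succ_pos _)) hA1
  have hB1 : 1 ≤ B := by
    rw [hB]
    exact Nat.mul_pos (by norm_num) (pow_pos hA1 5)
  have hM1 : 1 ≤ M := by
    rw [hM]
    exact Nat.mul_pos (Nat.mul_pos (Nat.mul_pos (by norm_num) (Nat.mul_pos hn hA1)) (pow_pos hK1 2))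
      (pow_pos hB1 3)
  have hKB : 16 * (K * B) ≤ M := by
    rw [hM]
    calc 16 * (K * B) ≤ 512 * (1 * 1) * K ^ 2 * B ^ 3 := by
          rw [mul_assoc (512 * (1 * 1))]
          gcongr
          · norm_num
          · exact Nat.le_self_pow two_ne_zero K
          · exact Nat.le_self_pow three_ne_zero B
      _ ≤ _ := by gcongr
  have hbound := blockNorm_le (K := K) (M := M) (B := B) hA hn (by rw [hK]) (by rw [hB])
    (by exact_mod_cast Nat.one_le_iff_ne_zero.1 hM1) (by exact_mod_cast hKB)
        (by exact_mod_cast hM.ge)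
  refine ⟨A * K * M, Nat.mul_pos (Nat.mul_pos hA1 hK1) hM1, fun N hN d p b => ?_⟩
  obtain ⟨k, rfl⟩ : ∃ k, N = k + 1 := ⟨N - 1, by omega⟩
  have h1 := enorm_structConst_le hA hbound (by omega : 1 ≤ k) p b d 0
  set c := structConst n a (k + 1) p (fun s => (b s : ℤ)) d 0
  have hmaj : majorant K M k ≤ (k ! : ℝ≥0) * (K * M ^ k) := by
    rw [majorant]
    refine mul_le_mul' le_rfl ?_
    have hM1' : (1 : ℝ≥0) ≤ M := by exact_mod_cast hM1
    have hk1 : (1 : ℝ≥0) ≤ (k : ℝ≥0) ^ 2 := one_le_pow₀ (by exact_mod_cast (by omega : 1 ≤ k))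
    calc (K / M * M ^ k * ((k : ℝ≥0) ^ 2)⁻¹ : ℝ≥0) ≤ K / 1 * M ^ k * 1 := by
          gcongr
          exact inv_le_one_of_one_le₀ hk1
      _ = _ := by rw [div_one, mul_one]
  have h2 : ‖c‖ₑ ≤ ((((k + 1)! : ℝ≥0) / (∏ s, ((b s)! : ℝ≥0)) * (A * K * M) ^ (k + 1 + d) : ℝ≥0) :
      ℝ≥0∞) := by
    refine h1.trans ?_
    have e : ∏ s, ((b s)! : ℝ≥0∞)⁻¹ = (((∏ s, ((b s)! : ℝ≥0))⁻¹ : ℝ≥0) : ℝ≥0∞) := by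
      rw [← Finset.prod_inv_distrib, ENNReal.ofNNReal_finsetProd]
      refine Finset.prod_congr rfl fun s _ => ?_
      rw [ENNReal.coe_inv (by exact_mod_cast (b s).factorial_ne_zero), ENNReal.coe_natCast]
    rw [e]
    have hA1' : (1 : ℝ≥0) ≤ A := by exact_mod_cast hA1
    have hK1' : (1 : ℝ≥0) ≤ K := by exact_mod_cast hK1
    have hM1' : (1 : ℝ≥0) ≤ M := by exact_mod_cast hM1
    have h3 : (A : ℝ≥0) ^ d * majorant K M k * (∏ s, ((b s)! : ℝ≥0))⁻¹ ≤
        ((k + 1)! : ℝ≥0) / (∏ s, ((b s)! : ℝ≥0)) * (A * K * M) ^ (k + 1 + d) := by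
      calc _ ≤ (A : ℝ≥0) ^ d * ((k ! : ℝ≥0) * (K * M ^ k)) * (∏ s, ((b s)! : ℝ≥0))⁻¹ := by gcongr
        _ ≤ (A : ℝ≥0) ^ (k + 1 + d) * (((k + 1)! : ℝ≥0) * (K ^ (k + 1 + d) * M ^ (k + 1 + d))) *
            (∏ s, ((b s)! : ℝ≥0))⁻¹ := by
            have hfac : (k ! : ℝ≥0) ≤ ((k + 1)! : ℝ≥0) := by
              exact_mod_cast Nat.factorial_le k.le_succ
            exact mul_le_mul' (mul_le_mul' (pow_le_pow_right₀ hA1' (by omega)) (mul_le_mul' hfac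
              (mul_le_mul' (le_self_pow₀ hK1' (by omega)) (pow_le_pow_right₀ hM1' (by omega)))))
              le_rfl
        _ = _ := by
            rw [mul_pow, mul_pow, div_eq_mul_inv]
            ring
    exact_mod_cast h3
  rw [Nat.cast_mul, Nat.cast_mul]
  exact h2

end GWStructure

end

theorem proposition5p4 (n l : ℕ) (hn : 1 ≤ n) (a : Fin l → ℕ) (ha : ∀ k, 1 ≤ a k)
    (han : ∑ k, a k ≤ n) :
    ∃ C : ℝ, 0 < C ∧ ∀ N : ℕ, 3 ≤ N → ∀ (d : ℕ) (p : Fin N → Fin n) (b : Fin N → ℕ),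
      |((GWStructure.structConst n a N p (fun s => (b s : ℤ)) d 0 : ℚ) : ℝ)| ≤
        (N.factorial : ℝ) / (∏ s, ((b s).factorial : ℝ)) * C ^ (N + d) := by
  obtain ⟨C, hC, h⟩ := GWStructure.exists_enorm_structConst_le hn han
  refine ⟨C, by exact_mod_cast hC, fun N hN d p b => ?_⟩
  have h1 := h N hN d p b
  rw [GWStructure.enorm_ratCast, ENNReal.ofReal_le_iff_le_toReal ENNReal.coe_ne_top,
    ENNReal.coe_toReal] at h1
  push_cast at h1
  exact_mod_cast h1
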